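/- Let $\mathcal H$ be a complex Hilbert space with orthonormal basis $\{|n\rangle : n\in\mathbb N\}$, $\mathbb N=\{0,1,2,\dots\}$, let $\mathbb T=\{t\in\mathbb C:|t|=1\}$, and let $U$ be the unitary representation of $\mathbb T$ on $\mathcal H$ with $U(t)|n\rangle=t^n|n\rangle$. An observable on $\mathbb T$ is a map $\mathsf E$ from the Borel sets of $\mathbb T$ to the bounded operators on $\mathcal H$ with $0\le \mathsf E(X)\le I$, $\mathsf E(\mathbb T)=I$, which is countably additive in the weak operator topology. It is a phase observable if $U(t)\mathsf E(X)U(t)^*=\mathsf E(tX)$ for all $t\in\mathbb T$ and all Borel $X\subseteq\mathbb T$. A state is a positive trace class operator of trace $1$, and $\Theta_{\mathsf E}$ maps a state $\varrho$ to the Borel probability measure $X\mapsto\operatorname{tr}(\varrho\,\mathsf E(X))$. An observable $\mathsf F$ on $\mathbb T$ is a postprocessing of $\mathsf E$ if there is a map $\Psi$ of the set of Borel probability measures on $\mathbb T$ into itself that preserves convex combinations and satisfies $\Theta_{\mathsf F}=\Psi\circ\Theta_{\mathsf E}$. $\mathsf E$ and $\mathsf F$ are postprocessing equivalent if each is a postprocessing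 of the other. A phase observable $\mathsf E$ is postprocessing clean (among phase observables) if every phase observable $\mathsf F$ such that $\mathsf E$ is a postprocessing of $\mathsf F$ is postprocessing equivalent to $\mathsf E$. The canonical phase observable $\mathsf E_{\mathrm{can}}$ is given by $\langle m|\mathsf E_{\mathrm{can}}(X)|n\rangle=\frac1{2\pi}\int_{\arg X}e^{i(m-n)\theta}\,d\theta$ for all $m,n\in\mathbb N$, where $\arg X\subseteq[0,2\pi)$ is the set of arguments of the elements of $X$. For a diagonal state $T=\sum_n\lambda_n|n\rangle\langle n|$ ($\lambda_n\ge0$, $\sum_n\lambda_n=1$), the phase observable generated by $T$ is given weakly by $$\mathsf E_T(X)=\frac1\pi\int_{\arg X}\int_0^\infty D(re^{i\theta})\,T\,D(re^{i\theta})^*\,r\,dr\,d\theta ,$$ where $D(z)=e^{za^*-\bar z a}$, $a|n\rangle=\sqrt n\,|n-1\rangle$ and $a^*|n\rangle=\sqrt{n+1}\,|n+1\rangle$. Proposition. $\mathsf E_{\mathrm{can}}$ and all $\mathsf E_T$, $T$ a diagonal state, are (well-defined phase observables and) postprocessing clean. No two of them are postprocessing equivalent: $\mathsf E_{\mathrm{can}}$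 is not postprocessing equivalent to any $\mathsf E_T$, and $\mathsf E_T$, $\mathsf E_{T'}$ are not postprocessing equivalent if $T\ne T'$. -/

import Mathlib

open MeasureTheory
open scoped InnerProductSpace ComplexConjugate

noncomputable section

namespace PhaseObs

set_option linter.unusedSectionVars false

/-! ### Observables, states, outcome distributions -/

/-- An observable (normalized positive operator measure) with outcome space `Ω`.  Only the values
on measurable sets matter. -/
structure Observable (Ω : Type*) [MeasurableSpace Ω] (H : Type*) [NormedAddCommGroup H]
    [InnerProductSpace ℂ H] [CompleteSpace H] where
  /-- the underlying set function -/
  effect : Set Ω → (H →L[ℂ] H)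
  nonneg : ∀ X, MeasurableSet X → 0 ≤ effect X
  le_one : ∀ X, MeasurableSet X → effect X ≤ 1
  univ : effect Set.univ = 1
  sigma_additive : ∀ X : ℕ → Set Ω, (∀ i, MeasurableSet (X i)) →
    Pairwise (fun i j => Disjoint (X i) (X j)) →
    ∀ u v : H, HasSum (fun i => ⟪u, effect (X i) v⟫_ℂ) ⟪u, effect (⋃ i, X i) v⟫_ℂ

variable {H : Type*} [NormedAddCommGroup H] [InnerProductSpace ℂ H] [CompleteSpace H]

/-- The trace of an operator, computed in the orthonormal basis `b`. -/
def trace (b : HilbertBasis ℕ ℂ H) (A : H →L[ℂ] H) : ℂ := ∑' n, ⟪b n, A (b n)⟫_ℂ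

/-- A state: a positive operator that is trace class with trace `1`.  (For a positive operator,
convergence of the trace series in one orthonormal basis is equivalent to being trace class.) -/
structure State (b : HilbertBasis ℕ ℂ H) where
  /-- the density operator -/
  op : H →L[ℂ] H
  nonneg : 0 ≤ op
  hasTrace : HasSum (fun n => ⟪b n, op (b n)⟫_ℂ) 1

theorem hasSum_norm_inner_sq (b : HilbertBasis ℕ ℂ H) (x : H) :
    HasSum (fun m => ‖⟪b m, x⟫_ℂ‖ ^ 2) (‖x‖ ^ 2) := by
  have h := Complex.reCLM.hasSum (b.hasSum_inner_mul_inner x x)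
  have e : Complex.reCLM ⟪x, x⟫_ℂ = ‖x‖ ^ 2 := inner_self_eq_norm_sq (𝕜 := ℂ) x
  rw [e] at h
  refine h.congr_fun fun m => ?_
  rw [← inner_conj_symm, Complex.mul_conj', Complex.norm_conj]
  norm_cast

theorem hasSum_trace_adjoint_mul (b : HilbertBasis ℕ ℂ H) (S E : H →L[ℂ] H)
    (hS : Summable fun n => ‖S (b n)‖ ^ 2) :
    HasSum (fun m => ⟪S.adjoint (b m), E (S.adjoint (b m))⟫_ℂ)
      (trace b (S.adjoint ∘L S ∘L E)) := by
  have hfib1 : ∀ n, HasSum (fun m => ⟪b n, S.adjoint (b m)⟫_ℂ * ⟪S.adjoint (b m), E (b n)⟫_ℂ)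
      ⟪b n, (S.adjoint ∘L S ∘L E) (b n)⟫_ℂ := by
    intro n
    have h := b.hasSum_inner_mul_inner (S (b n)) (S (E (b n)))
    simp only [ContinuousLinearMap.comp_apply, ContinuousLinearMap.adjoint_inner_right,
      ContinuousLinearMap.adjoint_inner_left]
    exact h
  have hfib2 : ∀ m, HasSum (fun n => ⟪b n, S.adjoint (b m)⟫_ℂ * ⟪S.adjoint (b m), E (b n)⟫_ℂ)
      ⟪S.adjoint (b m), E (S.adjoint (b m))⟫_ℂ := by
    intro m
    have h := b.hasSum_inner_mul_inner (E.adjoint (S.adjoint (b m))) (S.adjoint (b m))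
    rw [ContinuousLinearMap.adjoint_inner_left] at h
    refine h.congr_fun fun n => ?_
    rw [ContinuousLinearMap.adjoint_inner_left E, mul_comm]
  have hsq1 : Summable fun p : ℕ × ℕ => ‖⟪b p.1, S.adjoint (b p.2)⟫_ℂ‖ ^ 2 := by
    have h1 : ∀ n, HasSum (fun m => ‖⟪b n, S.adjoint (b m)⟫_ℂ‖ ^ 2) (‖S (b n)‖ ^ 2) := by
      intro n
      refine (hasSum_norm_inner_sq b (S (b n))).congr_fun fun m => ?_
      rw [ContinuousLinearMap.adjoint_inner_right, norm_inner_symm]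
    refine (summable_prod_of_nonneg (fun _ => by positivity)).2 ⟨fun n => (h1 n).summable, ?_⟩
    simpa only [(h1 _).tsum_eq] using hS
  have hS' : Summable fun m => ‖S.adjoint (b m)‖ ^ 2 := by
    have h2 := ((Equiv.prodComm ℕ ℕ).summable_iff.2 hsq1)
    have h3 := ((summable_prod_of_nonneg (fun _ => by simp only [Function.comp_apply]; positivity)).1
      h2).2
    refine h3.congr fun m => ?_
    exact (hasSum_norm_inner_sq b (S.adjoint (b m))).tsum_eq
  have hsq2 : Summable fun p : ℕ × ℕ => ‖⟪S.adjoint (b p.2), E (b p.1)⟫_ℂ‖ ^ 2 := by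
    have h1 : ∀ m, HasSum (fun n => ‖⟪S.adjoint (b m), E (b n)⟫_ℂ‖ ^ 2)
        (‖E.adjoint (S.adjoint (b m))‖ ^ 2) := by
      intro m
      refine (hasSum_norm_inner_sq b _).congr_fun fun n => ?_
      rw [ContinuousLinearMap.adjoint_inner_right, norm_inner_symm]
    rw [← (Equiv.prodComm ℕ ℕ).summable_iff]
    refine (summable_prod_of_nonneg
      (fun _ => by simp only [Function.comp_apply]; positivity)).2
        ⟨fun m => (h1 m).summable, ?_⟩
    have e : (fun m => ∑' n, ((fun p : ℕ × ℕ => ‖⟪S.adjoint (b p.2), E (b p.1)⟫_ℂ‖ ^ 2) ∘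
        (Equiv.prodComm ℕ ℕ)) (m, n)) = fun m => ‖E.adjoint (S.adjoint (b m))‖ ^ 2 :=
      funext fun m => (h1 m).tsum_eq
    rw [e]
    refine Summable.of_nonneg_of_le (fun _ => by positivity) (fun m => ?_)
      (hS'.mul_left (‖E.adjoint‖ ^ 2))
    rw [← mul_pow]
    exact pow_le_pow_left₀ (norm_nonneg _) (E.adjoint.le_opNorm _) 2
  have hsum : Summable fun p : ℕ × ℕ =>
      ⟪b p.1, S.adjoint (b p.2)⟫_ℂ * ⟪S.adjoint (b p.2), E (b p.1)⟫_ℂ := by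
    refine Summable.of_norm_bounded (hsq1.add hsq2) fun p => ?_
    rw [norm_mul]
    nlinarith [sq_nonneg (‖⟪b p.1, S.adjoint (b p.2)⟫_ℂ‖ - ‖⟪S.adjoint (b p.2), E (b p.1)⟫_ℂ‖),
      sq_nonneg (‖⟪b p.1, S.adjoint (b p.2)⟫_ℂ‖), sq_nonneg (‖⟪S.adjoint (b p.2), E (b p.1)⟫_ℂ‖)]
  have h1 := hsum.hasSum.prod_fiberwise hfib1
  have h2 := ((Equiv.prodComm ℕ ℕ).hasSum_iff.2 hsum.hasSum).prod_fiberwise hfib2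
  rw [trace, h1.tsum_eq]
  exact h2

section Outcome

variable {Ω : Type*} [MeasurableSpace Ω]

theorem Observable.inner_nonneg (E : Observable Ω H) {X : Set Ω} (hX : MeasurableSet X) (v : H) :
    0 ≤ (⟪v, E.effect X v⟫_ℂ).re :=
  ((ContinuousLinearMap.nonneg_iff_isPositive _).1 (E.nonneg X hX)).re_inner_nonneg_right v

theorem Observable.ofReal_inner_iUnion (E : Observable Ω H) {X : ℕ → Set Ω}
    (hX : ∀ i, MeasurableSet (X i)) (hd : Pairwise (fun i j => Disjoint (X i) (X j))) (v : H) :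
    ENNReal.ofReal (⟪v, E.effect (⋃ i, X i) v⟫_ℂ).re =
      ∑' i, ENNReal.ofReal (⟪v, E.effect (X i) v⟫_ℂ).re := by
  have h := Complex.reCLM.hasSum (E.sigma_additive X hX hd v v)
  rw [← ENNReal.ofReal_tsum_of_nonneg (fun i => E.inner_nonneg (hX i) v) h.summable]
  congr 1
  exact h.tsum_eq.symm

theorem State.exists_sqrt {b : HilbertBasis ℕ ℂ H} (ρ : State b) :
    ∃ S : H →L[ℂ] H, ρ.op = S.adjoint ∘L S ∧ Summable fun n => ‖S (b n)‖ ^ 2 := by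
  obtain ⟨S, hS⟩ := CStarAlgebra.nonneg_iff_eq_star_mul_self.1 ρ.nonneg
  refine ⟨S, hS, ?_⟩
  refine (Complex.reCLM.hasSum ρ.hasTrace).summable.congr fun n => ?_
  rw [hS]
  change (⟪b n, S.adjoint (S (b n))⟫_ℂ).re = ‖S (b n)‖ ^ 2
  rw [ContinuousLinearMap.adjoint_inner_right]
  exact inner_self_eq_norm_sq (𝕜 := ℂ) _

theorem State.exists_ofReal_trace {b : HilbertBasis ℕ ℂ H} (ρ : State b) :
    ∃ v : ℕ → H, ∀ (E : Observable Ω H) (X : Set Ω), MeasurableSet X →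
      ENNReal.ofReal (trace b (ρ.op ∘L E.effect X)).re =
        ∑' m, ENNReal.ofReal (⟪v m, E.effect X (v m)⟫_ℂ).re := by
  obtain ⟨S, hρ, hS⟩ := ρ.exists_sqrt
  refine ⟨fun m => S.adjoint (b m), fun E X hX => ?_⟩
  have h := Complex.reCLM.hasSum (hasSum_trace_adjoint_mul b S (E.effect X) hS)
  rw [← ENNReal.ofReal_tsum_of_nonneg (fun i => E.inner_nonneg hX _) h.summable, hρ]
  congr 1
  exact h.tsum_eq.symm

theorem ofReal_trace_iUnion {b : HilbertBasis ℕ ℂ H} (E : Observable Ω H) (ρ : State b)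
    {X : ℕ → Set Ω} (hX : ∀ i, MeasurableSet (X i))
    (hd : Pairwise (fun i j => Disjoint (X i) (X j))) :
    ENNReal.ofReal (trace b (ρ.op ∘L E.effect (⋃ i, X i))).re =
      ∑' i, ENNReal.ofReal (trace b (ρ.op ∘L E.effect (X i))).re := by
  obtain ⟨v, hv⟩ := ρ.exists_ofReal_trace (Ω := Ω)
  rw [hv E _ (MeasurableSet.iUnion hX)]
  simp_rw [fun i => hv E _ (hX i), E.ofReal_inner_iUnion hX hd]
  exact ENNReal.tsum_comm

theorem Observable.effect_empty (E : Observable Ω H) : E.effect ∅ = 0 := by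
  ext v
  refine ext_inner_left ℂ fun u => ?_
  have h := E.sigma_additive (fun _ => ∅) (fun _ => MeasurableSet.empty)
    (fun _ _ _ => disjoint_bot_left) u v
  have h0 := tendsto_nhds_unique h.summable.tendsto_atTop_zero tendsto_const_nhds
  simpa using h0.symm

/-- The outcome distribution `X ↦ tr (ρ E(X))` of the observable `E` in the state `ρ`. -/
def outcomeMeasure {b : HilbertBasis ℕ ℂ H} (E : Observable Ω H) (ρ : State b) : Measure Ω :=
  Measure.ofMeasurable (fun X _ => ENNReal.ofReal (trace b (ρ.op ∘L E.effect X)).re)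
    (by simp [E.effect_empty, trace])
    (fun _ hX hd => ofReal_trace_iUnion E ρ hX hd)

instance {b : HilbertBasis ℕ ℂ H} (E : Observable Ω H) (ρ : State b) :
    IsProbabilityMeasure (outcomeMeasure E ρ) := by
  refine ⟨?_⟩
  rw [outcomeMeasure, Measure.ofMeasurable_apply _ MeasurableSet.univ, E.univ]
  have : trace b (ρ.op ∘L 1) = 1 := ρ.hasTrace.tsum_eq
  simp [this]

/-- The affine map `Θ_E` from states to probability measures determined by the observable `E`. -/
def Theta (b : HilbertBasis ℕ ℂ H) (E : Observable Ω H) (ρ : State b) : ProbabilityMeasure Ω :=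
  ⟨outcomeMeasure E ρ, inferInstance⟩

/-- `Ψ` maps convex combinations of probability measures to the corresponding convex
combinations. -/
def IsAffine (Ψ : ProbabilityMeasure Ω → ProbabilityMeasure Ω) : Prop :=
  ∀ (s t : NNReal), s + t = 1 → ∀ p q r : ProbabilityMeasure Ω,
    (r : Measure Ω) = s • (p : Measure Ω) + t • (q : Measure Ω) →
    (Ψ r : Measure Ω) = s • (Ψ p : Measure Ω) + t • (Ψ q : Measure Ω)

/-- `F` is a postprocessing of `E`. -/
def IsPostprocessing (b : HilbertBasis ℕ ℂ H) (F E : Observable Ω H) : Prop :=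
  ∃ Ψ : ProbabilityMeasure Ω → ProbabilityMeasure Ω, IsAffine Ψ ∧ Theta b F = Ψ ∘ Theta b E

/-- `E` and `F` are postprocessing equivalent. -/
def PostEquiv (b : HilbertBasis ℕ ℂ H) (E F : Observable Ω H) : Prop :=
  IsPostprocessing b F E ∧ IsPostprocessing b E F

/-- `E` is postprocessing clean in the set `𝒪` of observables. -/
def IsPostClean (b : HilbertBasis ℕ ℂ H) (𝒪 : Set (Observable Ω H)) (E : Observable Ω H) : Prop :=
  E ∈ 𝒪 ∧ ∀ F ∈ 𝒪, IsPostprocessing b E F → PostEquiv b E F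

/-- Covariance of an observable on `G` with respect to a family `U g` of operators. -/
def IsCovariant {G : Type*} [Group G] [MeasurableSpace G] (U : G → (H →L[ℂ] H))
    (E : Observable G H) : Prop :=
  ∀ (g : G) (X : Set G), MeasurableSet X →
    U g ∘L E.effect X ∘L (U g).adjoint = E.effect ((fun x => g * x) '' X)

end Outcome

/-! ### The number representation and phase observables -/

/-- The linear isometry sending the `n`-th vector of `b` to `w n`, for an orthonormal sequence
`w`. -/
def isometryOfOrthonormal (b : HilbertBasis ℕ ℂ H) (w : ℕ → H) (hw : Orthonormal ℂ w) :
    H →ₗᵢ[ℂ] H :=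
  hw.orthogonalFamily.linearIsometry.comp b.repr.toLinearIsometry

theorem isometryOfOrthonormal_apply (b : HilbertBasis ℕ ℂ H) (w : ℕ → H) (hw : Orthonormal ℂ w)
    (n : ℕ) : isometryOfOrthonormal b w hw (b n) = w n := by
  change hw.orthogonalFamily.linearIsometry (b.repr (b n)) = w n
  rw [b.repr_self, OrthogonalFamily.linearIsometry_apply_single]
  simp

theorem orthonormal_rotate (b : HilbertBasis ℕ ℂ H) (t : Circle) :
    Orthonormal ℂ fun n => ((t : ℂ) ^ n) • b n := by
  have hb := orthonormal_iff_ite.1 b.orthonormal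
  rw [orthonormal_iff_ite]
  intro i j
  rw [inner_smul_left, inner_smul_right, hb]
  split_ifs with h
  · subst h
    rw [mul_one, map_pow, ← mul_pow, Complex.conj_mul', Circle.norm_coe]
    simp
  · simp

/-- The number representation of the circle group: `U(t)|n⟩ = tⁿ|n⟩`. -/
def numberRep (b : HilbertBasis ℕ ℂ H) (t : Circle) : H →L[ℂ] H :=
  (isometryOfOrthonormal b _ (orthonormal_rotate b t)).toContinuousLinearMap

instance : MeasurableSpace Circle := borel Circle

instance : BorelSpace Circle := ⟨rfl⟩

/-- The set of phase observables. -/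
def phaseObservables (b : HilbertBasis ℕ ℂ H) : Set (Observable Circle H) :=
  {E | IsCovariant (numberRep b) E}

/-- `arg X ⊆ [0, 2π)`, the set of arguments of the points of `X`. -/
def argSet (X : Set Circle) : Set ℝ := {θ | θ ∈ Set.Ico 0 (2 * Real.pi) ∧ Circle.exp θ ∈ X}

/-- `E` is determined by the matrix `c` through
`⟨m|E(X)|n⟩ = c m n ∫_{arg X} e^{i(m-n)θ} dθ/2π`. -/
def HasPhaseMatrix (b : HilbertBasis ℕ ℂ H) (E : Observable Circle H) (c : ℕ → ℕ → ℂ) : Prop :=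
  ∀ X, MeasurableSet X → ∀ m n : ℕ, ⟪b m, E.effect X (b n)⟫_ℂ =
    c m n * ((2 * Real.pi : ℂ)⁻¹ *
      ∫ θ in argSet X, Complex.exp (Complex.I * ((m : ℂ) - n) * θ))

/-- `E` is the canonical phase observable, with phase matrix `c m n = 1`. -/
def IsCanonicalPhase (b : HilbertBasis ℕ ℂ H) (E : Observable Circle H) : Prop :=
  HasPhaseMatrix b E fun _ _ => 1

/-! ### The shift operators -/

/-- The lowering operator `a|n⟩ = √n |n-1⟩` on finite sequences. -/
def lowering : (ℕ →₀ ℂ) →ₗ[ℂ] (ℕ →₀ ℂ) :=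
  Finsupp.linearCombination ℂ fun n => Finsupp.single (n - 1) (Real.sqrt n : ℂ)

/-- The raising operator `a*|n⟩ = √(n+1) |n+1⟩` on finite sequences. -/
def raising : (ℕ →₀ ℂ) →ₗ[ℂ] (ℕ →₀ ℂ) :=
  Finsupp.linearCombination ℂ fun n => Finsupp.single (n + 1) (Real.sqrt (n + 1) : ℂ)

/-- The operator `z a* - z̄ a` on finite sequences. -/
def shiftGen (z : ℂ) : (ℕ →₀ ℂ) →ₗ[ℂ] (ℕ →₀ ℂ) := z • raising - conj z • lowering

/-- The finite sequence `x` as the vector `∑ x n |n⟩`. -/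
def embed (b : HilbertBasis ℕ ℂ H) : (ℕ →₀ ℂ) →ₗ[ℂ] H := Finsupp.linearCombination ℂ b

/-- The terms of the exponential series of `z a* - z̄ a` applied to `x`. -/
def expTerm (b : HilbertBasis ℕ ℂ H) (z : ℂ) (x : ℕ →₀ ℂ) (k : ℕ) : H :=
  ((k.factorial : ℂ)⁻¹) • embed b ((shiftGen z ^ k) x)

/-- `e^{z a* - z̄ a}|n⟩`, by the (norm convergent) exponential series. -/
def shiftVector (b : HilbertBasis ℕ ℂ H) (z : ℂ) (n : ℕ) : H :=
  ∑' k, expTerm b z (Finsupp.single n 1) k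

theorem shiftGen_single (z : ℂ) (n : ℕ) : shiftGen z (Finsupp.single n 1) =
    (z * Real.sqrt (n + 1)) • Finsupp.single (n + 1) 1
      - (conj z * Real.sqrt n) • Finsupp.single (n - 1) 1 := by
  simp [shiftGen, raising, lowering]

theorem norm_embed_pow_le (b : HilbertBasis ℕ ℂ H) (z : ℂ) (k n : ℕ) :
    ‖embed b ((shiftGen z ^ k) (Finsupp.single n 1))‖ ≤
      (2 * ‖z‖) ^ k * Real.sqrt ((n + 1).ascFactorial k) := by
  induction k generalizing n with
  | zero => simp [embed, b.orthonormal.1 n]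
  | succ k ih =>
    rw [pow_succ, Module.End.mul_apply, shiftGen_single]
    simp only [map_sub, map_smul]
    have h1 : ‖z‖ * Real.sqrt (n + 1) * ((2 * ‖z‖) ^ k * Real.sqrt ((n + 1 + 1).ascFactorial k)) =
        ‖z‖ * (2 * ‖z‖) ^ k * Real.sqrt ((n + 1).ascFactorial (k + 1)) := by
      rw [Nat.ascFactorial_succ, ← Nat.succ_ascFactorial]
      push_cast
      rw [Real.sqrt_mul (by positivity)]
      ring
    have h2 : ‖z‖ * Real.sqrt n * ((2 * ‖z‖) ^ k * Real.sqrt ((n - 1 + 1).ascFactorial k)) ≤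
        ‖z‖ * (2 * ‖z‖) ^ k * Real.sqrt ((n + 1).ascFactorial (k + 1)) := by
      have h3 : (n * (n - 1 + 1).ascFactorial k : ℕ) ≤ (n + 1).ascFactorial (k + 1) := by
        cases n with
        | zero => simp
        | succ m =>
          rw [Nat.ascFactorial_succ]
          exact Nat.mul_le_mul (by omega) (Nat.ascFactorial_le _ (by omega))
      have h4 : Real.sqrt n * Real.sqrt ((n - 1 + 1).ascFactorial k) ≤
          Real.sqrt ((n + 1).ascFactorial (k + 1)) := by
        rw [← Real.sqrt_mul (by positivity)]
        exact Real.sqrt_le_sqrt (by exact_mod_cast h3)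
      calc _ = ‖z‖ * (2 * ‖z‖) ^ k * (Real.sqrt n * Real.sqrt ((n - 1 + 1).ascFactorial k)) := by
            ring
        _ ≤ _ := mul_le_mul_of_nonneg_left h4 (by positivity)
    have n1 := ih (n + 1)
    have n2 := ih (n - 1)
    refine (norm_sub_le _ _).trans ?_
    rw [norm_smul, norm_smul]
    have e1 : ‖z * (Real.sqrt (n + 1) : ℂ)‖ = ‖z‖ * Real.sqrt (n + 1) := by
      rw [norm_mul, Complex.norm_real, Real.norm_of_nonneg (Real.sqrt_nonneg _)]
    have e2 : ‖conj z * (Real.sqrt n : ℂ)‖ = ‖z‖ * Real.sqrt n := by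
      rw [norm_mul, Complex.norm_real, Real.norm_of_nonneg (Real.sqrt_nonneg _), RCLike.norm_conj]
    rw [e1, e2, pow_succ (2 * ‖z‖)]
    have m1 := mul_le_mul_of_nonneg_left n1 (by positivity : 0 ≤ ‖z‖ * Real.sqrt (n + 1))
    have m2 := mul_le_mul_of_nonneg_left n2 (by positivity : 0 ≤ ‖z‖ * Real.sqrt n)
    linarith

theorem summable_norm_expTerm (b : HilbertBasis ℕ ℂ H) (z : ℂ) (n : ℕ) :
    Summable fun k => ‖expTerm b z (Finsupp.single n 1) k‖ := by
  have hs : Summable fun k : ℕ =>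
      2 ^ n * ((32 * ‖z‖ ^ 2) ^ k / (k.factorial : ℝ)) + n.factorial * (1 / 4 : ℝ) ^ k :=
    ((Real.summable_pow_div_factorial _).mul_left _).add
      ((summable_geometric_of_lt_one (by norm_num) (by norm_num)).mul_left _)
  refine Summable.of_nonneg_of_le (fun _ => norm_nonneg _) (fun k => ?_) hs
  have hf : (0 : ℝ) < k.factorial := by exact_mod_cast k.factorial_pos
  have hasc : ((n + 1).ascFactorial k : ℝ) ≤ 2 ^ n * 2 ^ k * (n.factorial * k.factorial) := by
    have h2 : (n + 1).ascFactorial k ≤ 2 ^ (n + k) * n.factorial * k.factorial := by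
      rw [Nat.ascFactorial_eq_factorial_mul_choose, mul_comm]
      exact Nat.mul_le_mul_right _ ((Nat.choose_le_two_pow _ _).trans
        (Nat.le_mul_of_pos_right _ n.factorial_pos))
    have h3 : ((n + 1).ascFactorial k : ℝ) ≤ 2 ^ (n + k) * n.factorial * k.factorial := by
      exact_mod_cast h2
    rw [pow_add] at h3
    linarith
  have hexp : ‖expTerm b z (Finsupp.single n 1) k‖ ≤
      (k.factorial : ℝ)⁻¹ * ((2 * ‖z‖) ^ k * Real.sqrt ((n + 1).ascFactorial k)) := by
    rw [expTerm, norm_smul, norm_inv, Complex.norm_natCast]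
    exact mul_le_mul_of_nonneg_left (norm_embed_pow_le b z k n) (by positivity)
  refine hexp.trans ?_
  set A : ℝ := ((n + 1).ascFactorial k : ℝ) with hA
  have hA0 : 0 ≤ A := by positivity
  have hsq := Real.sq_sqrt hA0
  have hamgm : (2 * ‖z‖) ^ k * Real.sqrt A ≤
      2 ^ n * (32 * ‖z‖ ^ 2) ^ k + n.factorial * (1 / 4 : ℝ) ^ k * k.factorial := by
    have key : ((2 * ‖z‖) ^ k * Real.sqrt A) ^ 2 ≤
        (2 ^ n * (32 * ‖z‖ ^ 2) ^ k) * (n.factorial * (1 / 4 : ℝ) ^ k * k.factorial) := by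
      rw [mul_pow, hsq]
      calc _ ≤ ((2 * ‖z‖) ^ k) ^ 2 * (2 ^ n * 2 ^ k * (n.factorial * k.factorial)) := by gcongr
        _ = (2 ^ n * (8 * ‖z‖ ^ 2) ^ k) * (n.factorial * k.factorial) := by
            rw [← pow_mul, mul_comm k 2, pow_mul,
              show (8 * ‖z‖ ^ 2 : ℝ) = (2 * ‖z‖) ^ 2 * 2 by ring, mul_pow ((2 * ‖z‖) ^ 2)]
            ring
        _ = _ := by
            rw [show (8 * ‖z‖ ^ 2 : ℝ) = (32 * ‖z‖ ^ 2) * (1 / 4) by ring,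
              mul_pow (32 * ‖z‖ ^ 2)]
            ring
    have hp : 0 ≤ 2 ^ n * (32 * ‖z‖ ^ 2) ^ k := by positivity
    have hq : 0 ≤ n.factorial * (1 / 4 : ℝ) ^ k * k.factorial := by positivity
    refine abs_le_of_sq_le_sq' ?_ (add_nonneg hp hq) |>.2
    nlinarith [mul_nonneg hp hq, sq_nonneg (2 ^ n * (32 * ‖z‖ ^ 2) ^ k),
      sq_nonneg (n.factorial * (1 / 4 : ℝ) ^ k * k.factorial)]
  calc _ ≤ (k.factorial : ℝ)⁻¹ *
        (2 ^ n * (32 * ‖z‖ ^ 2) ^ k + n.factorial * (1 / 4 : ℝ) ^ k * k.factorial) := by gcongr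
    _ = _ := by field_simp

theorem inner_embed_single (b : HilbertBasis ℕ ℂ H) (m n : ℕ) :
    ⟪embed b (Finsupp.single m 1), embed b (Finsupp.single n 1)⟫_ℂ = if m = n then 1 else 0 := by
  simpa [embed] using orthonormal_iff_ite.1 b.orthonormal m n

theorem inner_shiftGen (b : HilbertBasis ℕ ℂ H) (z : ℂ) (x y : ℕ →₀ ℂ) :
    ⟪embed b (shiftGen z x), embed b y⟫_ℂ = -⟪embed b x, embed b (shiftGen z y)⟫_ℂ := by
  have hbase : ∀ m n : ℕ,
      ⟪embed b (shiftGen z (Finsupp.single m 1)), embed b (Finsupp.single n 1)⟫_ℂ =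
        -⟪embed b (Finsupp.single m 1), embed b (shiftGen z (Finsupp.single n 1))⟫_ℂ := by
    intro m n
    simp only [shiftGen_single, map_sub, map_smul, inner_sub_left, inner_sub_right,
      inner_smul_left, inner_smul_right, inner_embed_single]
    rcases lt_trichotomy m n with h | h | h
    · rcases Nat.exists_eq_add_of_lt h with ⟨d, rfl⟩
      rcases d with _ | d
      · simp [show ¬ (m = m + 1 + 1) by omega]
      · simp [show ¬ (m - 1 = m + (d + 1) + 1) by omega, show ¬ (m = m + (d + 1) + 1 + 1) by omega]
    · subst h
      cases m with
      | zero => simp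
      | succ m => simp
    · rcases Nat.exists_eq_add_of_lt h with ⟨d, rfl⟩
      rcases d with _ | d
      · simp [show ¬ (n + 1 + 1 = n) by omega, show ¬ (n + 1 = n - 1) by omega]
      · simp [show ¬ (n + (d + 1) + 1 = n - 1) by omega, show ¬ (n + (d + 1) + 1 + 1 = n) by omega]
  have hsingle : ∀ (m : ℕ) (c : ℂ), Finsupp.single m c = c • Finsupp.single m (1 : ℂ) := by
    intro m c
    simp
  induction x using Finsupp.induction_linear with
  | zero => simp
  | add f g hf hg => simp only [map_add, inner_add_left, hf, hg]; ring
  | single m c =>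
    induction y using Finsupp.induction_linear with
    | zero => simp
    | add f g hf hg => simp only [map_add, inner_add_right, hf, hg]; ring
    | single n d =>
      rw [hsingle m c, hsingle n d]
      simp only [map_smul, inner_smul_left, inner_smul_right, hbase]
      ring

theorem inner_shiftGen_pow (b : HilbertBasis ℕ ℂ H) (z : ℂ) (k : ℕ) (x y : ℕ →₀ ℂ) :
    ⟪embed b ((shiftGen z ^ k) x), embed b y⟫_ℂ =
      (-1) ^ k * ⟪embed b x, embed b ((shiftGen z ^ k) y)⟫_ℂ := by
  induction k generalizing y with
  | zero => simp
  | succ k ih =>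
    rw [pow_succ', Module.End.mul_apply, inner_shiftGen, ih, ← Module.End.mul_apply, ← pow_succ,
      ← pow_succ']
    ring

theorem orthonormal_shiftVector (b : HilbertBasis ℕ ℂ H) (z : ℂ) :
    Orthonormal ℂ (shiftVector b z) := by
  rw [orthonormal_iff_ite]
  intro m n
  set f := expTerm b z (Finsupp.single m 1) with hf
  set g := expTerm b z (Finsupp.single n 1) with hg
  have sf : Summable fun j => ‖f j‖ := summable_norm_expTerm b z m
  have sg : Summable fun k => ‖g k‖ := summable_norm_expTerm b z n
  have hfg : ∀ j k, ⟪f j, g k⟫_ℂ = ((j.factorial : ℂ)⁻¹ * (k.factorial : ℂ)⁻¹ * (-1) ^ j) *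
      ⟪embed b (Finsupp.single m 1), embed b ((shiftGen z ^ (j + k)) (Finsupp.single n 1))⟫_ℂ := by
    intro j k
    simp only [hf, hg, expTerm, inner_smul_left, inner_smul_right, inner_shiftGen_pow, pow_add,
      Module.End.mul_apply, map_inv₀, Complex.conj_natCast]
    ring
  have hs : Summable fun p : ℕ × ℕ => ⟪f p.1, g p.2⟫_ℂ :=
    Summable.of_norm_bounded (sf.mul_of_nonneg sg (fun _ => norm_nonneg _) fun _ => norm_nonneg _)
      fun p => norm_inner_le_norm _ _
  have h1 : HasSum (fun j => ⟪f j, shiftVector b z n⟫_ℂ) (∑' p : ℕ × ℕ, ⟪f p.1, g p.2⟫_ℂ) :=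
    hs.hasSum.prod_fiberwise fun j => (innerSL ℂ (f j)).hasSum sg.of_norm.hasSum
  have h2 : HasSum (fun j => ⟪f j, shiftVector b z n⟫_ℂ)
      ⟪shiftVector b z m, shiftVector b z n⟫_ℂ :=
    ((innerSLFlip ℂ) (shiftVector b z n)).hasSum sf.of_norm.hasSum
  rw [h2.unique h1, ← Finset.HasAntidiagonal.sigmaAntidiagonalEquivProd.tsum_eq]
  have hs' := Finset.HasAntidiagonal.sigmaAntidiagonalEquivProd.summable_iff.2 hs
  have h3 := hs'.tsum_sigma
  refine h3.trans ?_
  have hN : ∀ N : ℕ, (∑' c : Finset.HasAntidiagonal.antidiagonal N,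
      ((fun p : ℕ × ℕ => ⟪f p.1, g p.2⟫_ℂ) ∘
        Finset.HasAntidiagonal.sigmaAntidiagonalEquivProd) ⟨N, c⟩) =
      ∑ p ∈ Finset.HasAntidiagonal.antidiagonal N, ⟪f p.1, g p.2⟫_ℂ := by
    intro N
    rw [tsum_fintype]
    exact Finset.sum_coe_sort (Finset.HasAntidiagonal.antidiagonal N)
      fun p => ⟪f p.1, g p.2⟫_ℂ
  simp only [hN]
  rw [tsum_eq_single 0]
  · simp [hfg, inner_embed_single]
  · intro N hN
    have hbin := (Commute.all (-1 : ℂ) 1).add_pow' N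
    rw [neg_add_cancel, zero_pow hN] at hbin
    have hNfact : (N.factorial : ℂ) ≠ 0 := by exact_mod_cast N.factorial_ne_zero
    have : ∀ p ∈ Finset.HasAntidiagonal.antidiagonal N, ⟪f p.1, g p.2⟫_ℂ =
        (N.choose p.1 • ((-1 : ℂ) ^ p.1 * 1 ^ p.2)) * ((N.factorial : ℂ)⁻¹ *
          ⟪embed b (Finsupp.single m 1), embed b ((shiftGen z ^ N) (Finsupp.single n 1))⟫_ℂ) := by
      rintro ⟨j, k⟩ hp
      obtain rfl := Finset.HasAntidiagonal.mem_antidiagonal.1 hp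
      rw [hfg]
      simp only [nsmul_eq_mul, Nat.cast_add_choose ℂ, one_pow, mul_one]
      have : (j.factorial : ℂ) ≠ 0 := by exact_mod_cast j.factorial_ne_zero
      have : (k.factorial : ℂ) ≠ 0 := by exact_mod_cast k.factorial_ne_zero
      field_simp
    rw [Finset.sum_congr rfl this, ← Finset.sum_mul, ← hbin, zero_mul]

/-- The shift operator `D(z) = e^{z a* - z̄ a}`. -/
def shiftOp (b : HilbertBasis ℕ ℂ H) (z : ℂ) : H →L[ℂ] H :=
  (isometryOfOrthonormal b _ (orthonormal_shiftVector b z)).toContinuousLinearMap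

/-! ### State generated phase observables -/

/-- `T = ∑ λₙ |n⟩⟨n|` with `λₙ ≥ 0` and `∑ λₙ = 1`. -/
def IsDiagonalState (b : HilbertBasis ℕ ℂ H) (T : H →L[ℂ] H) : Prop :=
  ∃ l : ℕ → ℝ, (∀ n, 0 ≤ l n) ∧ HasSum l 1 ∧
    ∀ v, HasSum (fun n => (l n : ℂ) • ⟪b n, v⟫_ℂ • b n) (T v)

/-- `E = E_T`, that is, weakly,
`E(X) = π⁻¹ ∫_{arg X} ∫_0^∞ D(r e^{iθ}) T D(r e^{iθ})* r dr dθ`. -/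
def IsGeneratedBy (b : HilbertBasis ℕ ℂ H) (T : H →L[ℂ] H) (E : Observable Circle H) : Prop :=
  ∀ X, MeasurableSet X → ∀ u v : H,
    IntegrableOn (fun p : ℝ × ℝ =>
      (p.2 : ℂ) * ⟪u, (shiftOp b (p.2 * Complex.exp (Complex.I * p.1)) ∘L T ∘L
        (shiftOp b (p.2 * Complex.exp (Complex.I * p.1))).adjoint) v⟫_ℂ)
      (argSet X ×ˢ Set.Ioi 0) ∧
    ⟪u, E.effect X v⟫_ℂ = (Real.pi : ℂ)⁻¹ * ∫ θ in argSet X, ∫ r in Set.Ioi (0 : ℝ),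
      (r : ℂ) * ⟪u, (shiftOp b (r * Complex.exp (Complex.I * θ)) ∘L T ∘L
        (shiftOp b (r * Complex.exp (Complex.I * θ))).adjoint) v⟫_ℂ

end PhaseObs

end

open MeasureTheory Polynomial Filter Topology
open scoped InnerProductSpace ComplexConjugate

noncomputable section

namespace PhaseObs

set_option linter.unusedSectionVars false


/-! ### The radial parts of the displaced number states -/

/-! Covariance forces `⟨m|E(X)|n⟩ = c m n ∫_X z^(m-n)` for a Hermitian matrix `c` with unit diagonal
and entries of modulus at most 1 (`exists_hasPhaseMatrix`, `HasPhaseMatrix.norm_le_one`). Everything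
is decided by how an affine map acts on such matrices.

Suppose `E` is a postprocessing of a phase observable `F` with matrix `d`. In the state `(|m⟩ +
ζ|n⟩)/√2` the outcome density is `1 + Re (ζ d m n z^(m-n))`. An affine map acts linearly on
continuous densities, and comparing one Fourier coefficient for four values of `ζ` gives `c m n = d
m n * a (m - n)`, with a multiplier that depends only on the difference
(`HasPhaseMatrix.eq_mul_of_affine`). Averaging the map over rotations and applying it to Fejér
kernels produces probability measures with Fourier coefficients `(1 - k/N) a k` (`exists_average`);
hence `|a 1| ≤ 1`. If `c (n+1) n → 1`, then `|d| ≤ 1` forces `|a 1| = 1`. A probability measure with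
nearly unimodular first coefficient is nearly a point mass, so `a k = (a 1)^k`
(`multiplier_eq_pow`): the postprocessing acts as a rotation on the matrix. A rotation is undone by
a pushforward, so `E` is clean. If the subdiagonals of both matrices tend to 1, the rotation is
trivial, so postprocessing equivalence implies equality of phase matrices
(`HasPhaseMatrix.eq_of_postEquiv`).

It remains to compute matrices. For the canonical observable all entries are 1. For `T = ∑ λ_s
|s⟩⟨s|` they are `∑ λ_s ∫ 2 r e^(-r²) p_{m,s} p_{n,s} dr`, where `p_{m,s}` is the radial part of
`⟨m|D(r)|s⟩`. The measures `2 r e^(-r²) p_{n,s}²` concentrate near `√(n+s+1)`, whence the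
subdiagonal tends to 1 (`tendsto_gaussInt_radial_succ`, then dominated convergence). The entries at
`(0, 2k+2)` involve only `λ_0, …, λ_k`, with nonzero coefficient at `λ_k`, so the matrix determines
`T`; the entry at `(0, 2)` is `λ_0/√2 < 1`, which excludes the canonical observable.

Existence is by dilation: an orthonormal sequence in an `L²` space gives an isometry `V`, and `V*
1_X V` is an observable. -/

/-- The polynomials `p m s` with `|⟨m|D(r)|s⟩| = e^{-r²/2} |p m s (r)|` for `r ≥ 0`. -/
def radial : ℕ → ℕ → ℝ[X]
  | m, 0 => C (√(m.factorial : ℝ))⁻¹ * X ^ m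
  | m, s + 1 => C (√((s + 1 : ℕ) : ℝ))⁻¹ * (C √(m : ℝ) * radial (m - 1) s - X * radial m s)

theorem C_sqrt_mul_self (n : ℕ) : (C √(n : ℝ) * C √(n : ℝ) : ℝ[X]) = (n : ℝ[X]) := by
  rw [← C_mul, Real.mul_self_sqrt (Nat.cast_nonneg n), map_natCast]

theorem C_sqrt_succ_ne_zero (n : ℕ) : (C √((n + 1 : ℕ) : ℝ) : ℝ[X]) ≠ 0 := by
  rw [Ne, C_eq_zero]
  exact (Real.sqrt_pos.2 (by positivity)).ne'

theorem radial_succ_right (m s : ℕ) : C √((s + 1 : ℕ) : ℝ) * radial m (s + 1) =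
    C √(m : ℝ) * radial (m - 1) s - X * radial m s := by
  rw [radial, ← mul_assoc, ← C_mul, mul_inv_cancel₀ (Real.sqrt_pos.2 (by positivity)).ne', C_1,
    one_mul]

/-- The mirror image of the defining recursion. Both recursions are consistent because the
commutator of lowering and raising is the identity: the leftover coefficient is `(m + 1) - (s + 1) -
m + s = 0`. -/
theorem radial_succ_left (m s : ℕ) : C √((m + 1 : ℕ) : ℝ) * radial (m + 1) s =
    C √(s : ℝ) * radial m (s - 1) + X * radial m s := by
  induction s generalizing m with
  | zero =>
    simp only [radial, Nat.factorial_succ, Nat.cast_zero, Real.sqrt_zero, C_0, zero_mul, zero_add]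
    rw [Nat.cast_mul, Real.sqrt_mul (Nat.cast_nonneg _), mul_inv, C_mul, ← mul_assoc, ← mul_assoc,
      ← C_mul, mul_inv_cancel₀ (Real.sqrt_pos.2 (by positivity)).ne']
    rw [C_1]
    ring
  | succ s ih =>
    -- The extra factor `√m` makes the induction hypothesis at `m - 1` usable for `m = 0` too, where
    -- both sides vanish; `h2` does the same for `s`.
    have h1 : (C √(m : ℝ) * (C √(m : ℝ) * radial m s) : ℝ[X]) =
        C √(m : ℝ) * (C √(s : ℝ) * radial (m - 1) (s - 1) + X * radial (m - 1) s) := by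
      cases m with
      | zero => simp
      | succ m => rw [ih m]; rfl
    have h2 : (C √(s : ℝ) * (C √(s : ℝ) * radial m s) : ℝ[X]) =
        C √(s : ℝ) * (C √(m : ℝ) * radial (m - 1) (s - 1) - X * radial m (s - 1)) := by
      cases s with
      | zero => simp
      | succ s => rw [radial_succ_right m s]; rfl
    refine mul_left_cancel₀ (C_sqrt_succ_ne_zero s) ?_
    have e1 := radial_succ_right (m + 1) s
    have e2 := radial_succ_right m s
    have e3 := C_sqrt_mul_self m
    have e4 := C_sqrt_mul_self s
    have e5 := C_sqrt_mul_self (m + 1)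
    have e6 := C_sqrt_mul_self (s + 1)
    simp only [Nat.add_sub_cancel] at e1 ⊢
    have e7 : ((m + 1 : ℕ) : ℝ[X]) = m + 1 := by push_cast; ring
    have e8 : ((s + 1 : ℕ) : ℝ[X]) = s + 1 := by push_cast; ring
    linear_combination (C √((m + 1 : ℕ) : ℝ)) * e1 - X * e2 - X * ih m + h1 - h2 +
      radial m s * (e5 - e6 + e7 - e8 - e3 + e4)

theorem X_mul_radial_eq_sub (m s : ℕ) : X * radial m s =
    C √((m + 1 : ℕ) : ℝ) * radial (m + 1) s - C √(s : ℝ) * radial m (s - 1) := by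
  linear_combination - radial_succ_left m s

theorem X_mul_radial_eq_sub' (m s : ℕ) : X * radial m s =
    C √(m : ℝ) * radial (m - 1) s - C √((s + 1 : ℕ) : ℝ) * radial m (s + 1) := by
  linear_combination radial_succ_right m s

/-! ### Gaussian integrals of polynomials in the radius -/

theorem integrableOn_eval_mul_gaussian (q : ℝ[X]) :
    IntegrableOn (fun r : ℝ => 2 * r * Real.exp (-r ^ 2) * q.eval r) (Set.Ioi 0) := by
  induction q using Polynomial.induction_on' with
  | add p q hp hq =>
    refine (hp.add hq).congr (ae_of_all _ fun r => ?_)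
    simp only [Pi.add_apply, eval_add]; ring
  | monomial n a =>
    have h := (integrableOn_rpow_mul_exp_neg_mul_sq (b := 1) one_pos (s := (n + 1 : ℕ))
      (by have : (0 : ℝ) ≤ (n + 1 : ℕ) := by positivity
          linarith)).const_mul (2 * a)
    refine h.congr (ae_of_all _ fun r => ?_)
    simp only [eval_monomial, Real.rpow_natCast]
    rw [show -1 * r ^ 2 = -r ^ 2 by ring]; ring

/-- Integration of polynomials against the probability density `2 r e^{-r²}` on `(0, ∞)`. -/
def gaussInt : ℝ[X] →ₗ[ℝ] ℝ where
  toFun q := ∫ r in Set.Ioi (0 : ℝ), 2 * r * Real.exp (-r ^ 2) * q.eval r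
  map_add' p q := by
    rw [← integral_add (integrableOn_eval_mul_gaussian p) (integrableOn_eval_mul_gaussian q)]
    congr with r
    rw [eval_add]; ring
  map_smul' a q := by
    rw [RingHom.id_apply, smul_eq_mul, ← integral_const_mul]
    congr with r
    rw [eval_smul, smul_eq_mul]; ring

theorem gaussInt_apply (q : ℝ[X]) :
    gaussInt q = ∫ r in Set.Ioi (0 : ℝ), 2 * r * Real.exp (-r ^ 2) * q.eval r := rfl

theorem gaussInt_C_mul (a : ℝ) (q : ℝ[X]) : gaussInt (C a * q) = a * gaussInt q := by
  rw [← smul_eq_C_mul, map_smul, smul_eq_mul]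

theorem gaussInt_X_pow (j : ℕ) : gaussInt (X ^ j) = Real.Gamma ((j : ℝ) / 2 + 1) := by
  have h := integral_rpow_mul_exp_neg_rpow (p := 2) (q := (j + 1 : ℕ)) two_pos
    (by have : (0 : ℝ) ≤ (j + 1 : ℕ) := by positivity
        linarith)
  rw [gaussInt_apply]
  have e : ∀ r : ℝ, 2 * r * Real.exp (-r ^ 2) * (X ^ j : ℝ[X]).eval r =
      2 * (r ^ ((j + 1 : ℕ) : ℝ) * Real.exp (-r ^ (2 : ℝ))) := by
    intro r
    rw [Real.rpow_natCast, Real.rpow_two, eval_pow, eval_X]; ring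
  simp_rw [e]
  rw [integral_const_mul, h, show ((j + 1 : ℕ) + 1 : ℝ) / 2 = (j : ℝ) / 2 + 1 by push_cast; ring]
  ring

theorem gaussInt_mono {p q : ℝ[X]} (h : ∀ r : ℝ, 0 < r → p.eval r ≤ q.eval r) :
    gaussInt p ≤ gaussInt q := by
  refine setIntegral_mono_on (integrableOn_eval_mul_gaussian p)
    (integrableOn_eval_mul_gaussian q) measurableSet_Ioi fun r hr => ?_
  exact mul_le_mul_of_nonneg_left (h r hr)
    (mul_nonneg (mul_nonneg two_pos.le (le_of_lt hr)) (Real.exp_pos _).le)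

/-- The factor `X` produced by lowering `s` in the first polynomial is moved to the second one,
where the other recursion absorbs it. All three resulting pairs stay on the same off-diagonal, so
this drives the induction for orthonormality. -/
theorem gaussInt_radial_succ (m s m' s' : ℕ) :
    √((s + 1 : ℕ) : ℝ) * gaussInt (radial m (s + 1) * radial m' s') =
      √(m : ℝ) * gaussInt (radial (m - 1) s * radial m' s') -
        √((m' + 1 : ℕ) : ℝ) * gaussInt (radial m s * radial (m' + 1) s') +
          √(s' : ℝ) * gaussInt (radial m s * radial m' (s' - 1)) := by
  simp only [← gaussInt_C_mul, ← map_sub, ← map_add]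
  congr 1
  linear_combination radial m' s' * radial_succ_right m s - radial m s * X_mul_radial_eq_sub m' s'

/-- Lowering `s` ends at a Gamma integral equal to a factorial. One step above `s = 0` the two
surviving terms cancel because `m = m' + 1`. -/
theorem gaussInt_radial_zero_left (m s m' : ℕ) (h : m = m' + s) :
    gaussInt (radial m s * radial m' 0) = if s = 0 then 1 else 0 := by
  induction s generalizing m m' with
  | zero =>
    obtain rfl : m' = m := by omega
    have e : radial m' 0 * radial m' 0 = C ((m'.factorial : ℝ)⁻¹) * X ^ (2 * m') := by
      simp only [radial]
      rw [show (C (√(m'.factorial : ℝ))⁻¹ * X ^ m' * (C (√(m'.factorial : ℝ))⁻¹ * X ^ m') : ℝ[X]) =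
        C (√(m'.factorial : ℝ))⁻¹ * C (√(m'.factorial : ℝ))⁻¹ * X ^ (2 * m') by ring, ← C_mul,
        ← mul_inv, Real.mul_self_sqrt (Nat.cast_nonneg _)]
    rw [e, gaussInt_C_mul, gaussInt_X_pow]
    push_cast
    rw [show (2 * (m' : ℝ)) / 2 + 1 = m' + 1 by ring, Real.Gamma_nat_eq_factorial,
      inv_mul_cancel₀ (by positivity)]
  | succ s ih =>
    have h1 := gaussInt_radial_succ m s m' 0
    obtain ⟨n, rfl⟩ : ∃ n, m = n + 1 := ⟨m' + s, by omega⟩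
    have e1 := ih n m' (by omega)
    have e2 := ih (n + 1) (m' + 1) (by omega)
    simp only [Nat.add_sub_cancel, Nat.cast_zero, Real.sqrt_zero, zero_mul, add_zero, e1, e2] at h1
    have h2 : (√((s + 1 : ℕ) : ℝ)) ≠ 0 := (Real.sqrt_pos.2 (by positivity)).ne'
    rw [if_neg (Nat.succ_ne_zero s)]
    refine (mul_eq_zero.1 (h1.trans ?_)).resolve_left h2
    split_ifs with hs
    · subst hs
      rw [show n = m' by omega]; ring
    · ring

/-- Orthonormality of the radial polynomials on each off-diagonal. -/
theorem gaussInt_radial_mul_radial (m s m' s' : ℕ) (h : m + s' = m' + s) :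
    gaussInt (radial m s * radial m' s') = if s = s' then 1 else 0 := by
  induction s generalizing m m' s' with
  | zero =>
    rw [mul_comm, gaussInt_radial_zero_left m' s' m (by omega)]
    simp [eq_comm]
  | succ s ih =>
    have h1 := gaussInt_radial_succ m s m' s'
    have h2 : (√((s + 1 : ℕ) : ℝ)) ≠ 0 := (Real.sqrt_pos.2 (by positivity)).ne'
    have e1 : √(m : ℝ) * gaussInt (radial (m - 1) s * radial m' s') =
        √(m : ℝ) * if s = s' then 1 else 0 := by
      cases m with
      | zero => simp
      | succ m => rw [ih _ _ _ (by simp; omega)]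
    have e2 := ih m (m' + 1) s' (by omega)
    have e3 : √(s' : ℝ) * gaussInt (radial m s * radial m' (s' - 1)) =
        √((s + 1 : ℕ) : ℝ) * if s + 1 = s' then 1 else 0 := by
      cases s' with
      | zero => simp
      | succ s' =>
        rw [ih _ _ _ (by simp; omega)]
        by_cases hs : s = s'
        · subst hs; simp
        · simp [hs]
    rw [e1, e2, e3] at h1
    refine mul_left_cancel₀ h2 (h1.trans ?_)
    by_cases hs : s = s'
    · subst hs
      rw [show m = m' + 1 by omega]; ring
    · simp [hs]

theorem gaussInt_radial_self (m s : ℕ) : gaussInt (radial m s * radial m s) = 1 := by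
  rw [gaussInt_radial_mul_radial m s m s rfl, if_pos rfl]

theorem abs_gaussInt_radial_mul_le (m n s t : ℕ) :
    |gaussInt (radial m s * radial n t)| ≤ 1 := by
  have h1 : gaussInt (C 2 * (radial m s * radial n t)) ≤
      gaussInt (radial m s * radial m s + radial n t * radial n t) :=
    gaussInt_mono fun r _ => by
      simp only [eval_add, eval_mul, eval_C]
      nlinarith [sq_nonneg ((radial m s).eval r - (radial n t).eval r)]
  have h2 : gaussInt (C (-2) * (radial m s * radial n t)) ≤
      gaussInt (radial m s * radial m s + radial n t * radial n t) :=
    gaussInt_mono fun r _ => by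
      simp only [eval_add, eval_mul, eval_C]
      nlinarith [sq_nonneg ((radial m s).eval r + (radial n t).eval r)]
  simp only [gaussInt_C_mul, map_add, gaussInt_radial_self] at h1 h2
  rw [abs_le]
  constructor <;> linarith

/-! ### Concentration of the radial weights and the limit along the subdiagonal -/

/-- The three-term recurrence along the diagonal `n - s = const`. With orthonormality it yields the
moments of `r²` under the probability density `2 r e^(-r²) p²`, without explicit Laguerre
polynomials. -/
theorem X_sq_mul_radial (n s : ℕ) : X ^ 2 * radial n s =
    C ((n : ℝ) + s + 1) * radial n s
      - C (√((n + 1 : ℕ) : ℝ) * √((s + 1 : ℕ) : ℝ)) * radial (n + 1) (s + 1)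
      - C (√(n : ℝ) * √(s : ℝ)) * radial (n - 1) (s - 1) := by
  have h1 := X_mul_radial_eq_sub n s
  have h2 := X_mul_radial_eq_sub' (n + 1) s
  have h3 := X_mul_radial_eq_sub' n (s - 1)
  have e5 := C_sqrt_mul_self (n + 1)
  have e6 := C_sqrt_mul_self s
  have h4 : (C √(s : ℝ) * (C √((s - 1 + 1 : ℕ) : ℝ) * radial n (s - 1 + 1)) : ℝ[X]) =
      s * radial n s := by
    cases s with
    | zero => simp
    | succ s => rw [← mul_assoc, Nat.add_sub_cancel, C_sqrt_mul_self]
  have e7 : (C ((n : ℝ) + s + 1) : ℝ[X]) = ((n + 1 : ℕ) : ℝ[X]) + s := by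
    simp only [map_add, map_natCast, C_1]; push_cast; ring
  simp only [Nat.add_sub_cancel] at h2
  rw [e7, C_mul, C_mul]
  linear_combination X * h1 + C √((n + 1 : ℕ) : ℝ) * h2 - C √(s : ℝ) * h3 + h4 +
    radial n s * e5

theorem gaussInt_X_sq_mul_radial (n s : ℕ) :
    gaussInt (X ^ 2 * (radial n s * radial n s)) = n + s + 1 := by
  have h : X ^ 2 * (radial n s * radial n s) = C ((n : ℝ) + s + 1) * (radial n s * radial n s)
      - C (√((n + 1 : ℕ) : ℝ) * √((s + 1 : ℕ) : ℝ)) * (radial (n + 1) (s + 1) * radial n s)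
      - C (√(n : ℝ) * √(s : ℝ)) * (radial (n - 1) (s - 1) * radial n s) := by
    linear_combination radial n s * X_sq_mul_radial n s
  rw [h]
  simp only [map_sub, gaussInt_C_mul, gaussInt_radial_self]
  rw [gaussInt_radial_mul_radial (n + 1) (s + 1) n s (by omega), if_neg (by omega)]
  rcases Nat.eq_zero_or_pos n with rfl | hn
  · simp
  rcases Nat.eq_zero_or_pos s with rfl | hs
  · simp
  rw [gaussInt_radial_mul_radial (n - 1) (s - 1) n s (by omega), if_neg (by omega)]
  ring

theorem gaussInt_X_pow_four_mul_radial_le (n s : ℕ) :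
    gaussInt (X ^ 4 * (radial n s * radial n s)) ≤
      ((n : ℝ) + s + 1) ^ 2 + 4 * ((n + 1) * (s + 1)) := by
  set N : ℝ := (n : ℝ) + s + 1 with hN
  set α : ℝ := √((n + 1 : ℕ) : ℝ) * √((s + 1 : ℕ) : ℝ) with hα
  set β : ℝ := √(n : ℝ) * √(s : ℝ) with hβ
  have hα2 : α ^ 2 = (n + 1) * (s + 1) := by
    rw [hα, mul_pow, Real.sq_sqrt (by positivity), Real.sq_sqrt (by positivity)]; push_cast; ring
  have hβ2 : β ^ 2 = n * s := by
    rw [hβ, mul_pow, Real.sq_sqrt (by positivity), Real.sq_sqrt (by positivity)]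
  -- This is `X⁴ = 2 N X² - N² + (N - X²)²`, where `(N - X²) p` is the off-diagonal part of the
  -- recurrence. Its square is then bounded by `2x² + 2y²`.
  have h : X ^ 4 * (radial n s * radial n s) = C (2 * N) * (X ^ 2 * (radial n s * radial n s)) -
      C (N ^ 2) * (radial n s * radial n s) + (C α * radial (n + 1) (s + 1)
        + C β * radial (n - 1) (s - 1)) ^ 2 := by
    have := X_sq_mul_radial n s
    have e : C α * radial (n + 1) (s + 1) + C β * radial (n - 1) (s - 1) =
      C N * radial n s - X ^ 2 * radial n s := by
      rw [← hN, ← hα, ← hβ] at this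
      linear_combination this
    rw [e]
    simp only [C_mul, C_pow]
    have : (C (2 : ℝ) : ℝ[X]) = 2 := rfl
    rw [this]
    ring
  have h2 : gaussInt ((C α * radial (n + 1) (s + 1) + C β * radial (n - 1) (s - 1)) ^ 2) ≤
      gaussInt (C (2 * α ^ 2) * (radial (n + 1) (s + 1) * radial (n + 1) (s + 1)) +
        C (2 * β ^ 2) * (radial (n - 1) (s - 1) * radial (n - 1) (s - 1))) :=
    gaussInt_mono fun r _ => by
      simp only [eval_add, eval_mul, eval_C, eval_pow]
      nlinarith [sq_nonneg (α * (radial (n + 1) (s + 1)).eval r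
        - β * (radial (n - 1) (s - 1)).eval r)]
  rw [h]
  simp only [map_add, map_sub, gaussInt_C_mul, gaussInt_radial_self, gaussInt_X_sq_mul_radial,
    hα2, hβ2] at h2 ⊢
  rw [← hN]
  nlinarith

theorem gaussInt_X_mul_radial_ge (n s : ℕ) :
    √((n : ℝ) + s + 1) * (1 - 2 * ((n + 1) * (s + 1)) / ((n : ℝ) + s + 1) ^ 2) ≤
      gaussInt (X * (radial n s * radial n s)) := by
  set N : ℝ := (n : ℝ) + s + 1 with hN
  have hN0 : 0 < N := by positivity
  set R := √N with hR
  have hR0 : 0 < R := Real.sqrt_pos.2 hN0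
  have hR2 : R ^ 2 = N := Real.sq_sqrt hN0.le
  have h : gaussInt (C (3 / (2 * R)) * (X ^ 2 * (radial n s * radial n s)) -
      C (1 / (2 * R ^ 3)) * (X ^ 4 * (radial n s * radial n s))) ≤
        gaussInt (X * (radial n s * radial n s)) :=
    gaussInt_mono fun r hr => by
      simp only [eval_sub, eval_mul, eval_C, eval_pow, eval_X]
      -- A lower bound for `r` by even powers that touches it to second order at `r = R`; only the
      -- second and fourth moments are then needed.
      have hu : 3 / (2 * R) * r ^ 2 - 1 / (2 * R ^ 3) * r ^ 4 ≤ r := by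
        have e : r - (3 / (2 * R) * r ^ 2 - 1 / (2 * R ^ 3) * r ^ 4) =
            r * (r - R) ^ 2 * (r + 2 * R) / (2 * R ^ 3) := by
          field_simp
          ring
        have : 0 ≤ r * (r - R) ^ 2 * (r + 2 * R) / (2 * R ^ 3) := by positivity
        linarith
      nlinarith [mul_self_nonneg ((radial n s).eval r)]
  refine le_trans ?_ h
  simp only [map_sub, gaussInt_C_mul, gaussInt_X_sq_mul_radial, ← hN]
  have h4 := gaussInt_X_pow_four_mul_radial_le n s
  rw [← hN] at h4
  have h5 := mul_le_mul_of_nonneg_left h4 (by positivity : 0 ≤ 1 / (2 * R ^ 3))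
  refine le_trans (le_of_eq ?_) (sub_le_sub_left h5 _)
  rw [← hR2]
  field_simp
  ring

/-- By the left recursion `√(n+1)` times this overlap is the mean of `r` plus a term at least `-√s`.
The mean of `r` is at least `√(n+1) - 2(s+1)`. -/
theorem gaussInt_radial_succ_left_ge (n s : ℕ) :
    1 - 2 * ((s : ℝ) + 1) / √((n + 1 : ℕ) : ℝ) - √(s : ℝ) / √((n + 1 : ℕ) : ℝ) ≤
      gaussInt (radial (n + 1) s * radial n s) := by
  set R := √((n + 1 : ℕ) : ℝ) with hR
  have hR0 : 0 < R := Real.sqrt_pos.2 (by positivity)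
  have hR2 : R ^ 2 = n + 1 := by rw [hR, Real.sq_sqrt (by positivity)]; push_cast; ring
  have hR1 : 1 ≤ R := by
    have : (0 : ℝ) ≤ n := n.cast_nonneg
    nlinarith
  have h1 : R * gaussInt (radial (n + 1) s * radial n s) =
      √(s : ℝ) * gaussInt (radial n (s - 1) * radial n s) +
        gaussInt (X * (radial n s * radial n s)) := by
    simp only [← gaussInt_C_mul, ← map_add]
    congr 1
    linear_combination radial n s * radial_succ_left n s
  have h2 := (abs_le.1 (abs_gaussInt_radial_mul_le n n (s - 1) s)).1
  have h3 := gaussInt_X_mul_radial_ge n s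
  set N : ℝ := (n : ℝ) + s + 1 with hN
  have hs0 : (0 : ℝ) ≤ s := s.cast_nonneg
  have hN0 : 0 < N := by positivity
  have hRN : R ≤ √N := Real.sqrt_le_sqrt (by rw [hN]; push_cast; linarith)
  have hS2 : √N ^ 2 = N := Real.sq_sqrt hN0.le
  have hS0 : 0 < √N := hR0.trans_le hRN
  set S := √N
  have h4 : R - 2 * (s + 1) ≤ S * (1 - 2 * ((n + 1) * (s + 1)) / N ^ 2) := by
    have e : S * (1 - 2 * ((n + 1) * (s + 1)) / N ^ 2) =
        S - 2 * (s + 1) * (R ^ 2 / S ^ 3) := by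
      rw [← hS2, ← hR2]
      field_simp
    have h5 : R ^ 2 / S ^ 3 ≤ 1 := by
      rw [div_le_one (by positivity)]
      nlinarith [pow_le_pow_left₀ hR0.le hRN 2, pow_pos (hR0.trans_le hRN) 2]
    rw [e]
    nlinarith
  have h6 : R - 2 * (s + 1) - √(s : ℝ) ≤ R * gaussInt (radial (n + 1) s * radial n s) := by
    rw [h1]
    nlinarith [Real.sqrt_nonneg (s : ℝ)]
  have e : 1 - 2 * ((s : ℝ) + 1) / R - √(s : ℝ) / R = (R - 2 * (s + 1) - √(s : ℝ)) / R := by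
    field_simp
  rw [e, div_le_iff₀ hR0]
  linarith

theorem tendsto_gaussInt_radial_succ (s : ℕ) :
    Tendsto (fun n => gaussInt (radial (n + 1) s * radial n s)) atTop (𝓝 1) := by
  have h0 : Tendsto (fun n : ℕ => √((n + 1 : ℕ) : ℝ)) atTop atTop :=
    Real.tendsto_sqrt_atTop.comp
      (tendsto_natCast_atTop_atTop.comp (tendsto_add_atTop_nat 1))
  have h1 : Tendsto (fun n : ℕ => 1 - 2 * ((s : ℝ) + 1) / √((n + 1 : ℕ) : ℝ) -
      √(s : ℝ) / √((n + 1 : ℕ) : ℝ)) atTop (𝓝 1) := by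
    have := (tendsto_const_nhds (x := (1 : ℝ))).sub
      ((tendsto_const_nhds (x := 2 * ((s : ℝ) + 1))).div_atTop h0) |>.sub
      ((tendsto_const_nhds (x := √(s : ℝ))).div_atTop h0)
    simpa using this
  exact tendsto_of_tendsto_of_tendsto_of_le_of_le h1 tendsto_const_nhds
    (fun n => gaussInt_radial_succ_left_ge n s)
    (fun n => (abs_le.1 (abs_gaussInt_radial_mul_le _ _ _ _)).2)

/-! ### Exact values in the first row -/

/-- Induction on `s`, since lowering `s` trades `radial n (s + 1)` for `radial (n - 1) s` and a
further power of `X`. The bound `s ≤ j + n` keeps the Gamma argument positive. -/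
theorem gaussInt_X_pow_mul_radial (j n s : ℕ) (h : s ≤ j + n) :
    √(n.factorial : ℝ) * √(s.factorial : ℝ) * gaussInt (X ^ j * radial n s) =
      Real.Gamma (((j : ℝ) + n - s) / 2 + 1) *
        ∏ i ∈ Finset.range s, (((n : ℝ) - j - s) / 2 + i) := by
  induction s generalizing j n with
  | zero =>
    have hf : √(n.factorial : ℝ) ≠ 0 := (Real.sqrt_pos.2 (by positivity)).ne'
    have e : X ^ j * radial n 0 = C (√(n.factorial : ℝ))⁻¹ * X ^ (j + n) := by
      rw [radial]; ring
    rw [e, gaussInt_C_mul, gaussInt_X_pow]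
    simp [hf]
  | succ s ih =>
    have h1 : √((s + 1 : ℕ) : ℝ) * gaussInt (X ^ j * radial n (s + 1)) =
        √(n : ℝ) * gaussInt (X ^ j * radial (n - 1) s) - gaussInt (X ^ (j + 1) * radial n s) := by
      simp only [← gaussInt_C_mul, ← map_sub]
      congr 1
      linear_combination X ^ j * radial_succ_right n s
    have e1 : √(n.factorial : ℝ) * √(n : ℝ) * √(s.factorial : ℝ) *
        gaussInt (X ^ j * radial (n - 1) s) = n * (Real.Gamma (((j : ℝ) + n - (s + 1)) / 2 + 1) *
        ∏ i ∈ Finset.range s, (((n : ℝ) - j - (s + 1)) / 2 + i)) := by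
      cases n with
      | zero => simp
      | succ n =>
        have := ih j n (by omega)
        rw [Nat.factorial_succ, Nat.cast_mul, Real.sqrt_mul (Nat.cast_nonneg _), Nat.add_sub_cancel]
        have hs := Real.mul_self_sqrt (Nat.cast_nonneg (α := ℝ) (n + 1))
        have a1 : ((j : ℝ) + (n + 1 : ℕ) - (s + 1)) / 2 + 1 = (j + n - s) / 2 + 1 := by
          push_cast; ring
        have a2 : (((n + 1 : ℕ) : ℝ) - j - (s + 1)) / 2 = (n - j - s) / 2 := by
          push_cast; ring
        rw [a1, a2, ← this]
        linear_combination (√(n.factorial : ℝ) * √(s.factorial : ℝ) *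
          gaussInt (X ^ j * radial n s)) * hs
    have e2 := ih (j + 1) n (by omega)
    have hG : Real.Gamma (((j : ℝ) + (1 : ℕ) + n - s) / 2 + 1) =
        (((j : ℝ) + n - (s + 1)) / 2 + 1) * Real.Gamma (((j : ℝ) + n - (s + 1)) / 2 + 1) := by
      have h0 : (0 : ℝ) ≤ (j : ℝ) + n - (s + 1) := by
        have : ((s + 1 : ℕ) : ℝ) ≤ ((j + n : ℕ) : ℝ) := by exact_mod_cast h
        push_cast at this
        linarith
      rw [← Real.Gamma_add_one (by positivity)]
      congr 1; push_cast; ring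
    rw [Nat.cast_add j 1, hG] at e2
    have a3 : ((n : ℝ) - ((j : ℝ) + (1 : ℕ)) - s) / 2 = (n - j - (s + 1)) / 2 := by
      push_cast; ring
    rw [a3] at e2
    rw [Finset.prod_range_succ, Nat.factorial_succ, Nat.cast_mul,
      Real.sqrt_mul (Nat.cast_nonneg _), Nat.cast_succ s, ← Nat.cast_succ s]
    have a4 : (((s + 1 : ℕ) : ℝ)) = s + 1 := by push_cast; ring
    rw [a4] at h1 ⊢
    linear_combination √(n.factorial : ℝ) * √(s.factorial : ℝ) * h1 + e1 - e2

/-- `radial 0 s` is `(-1)^s X^s / √s!`, so the monomial formula applies with `j = s`. The even index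
`2k+2` makes the product run over the integers `k+1-s, …, k`: it contains 0 exactly when `s > k`.
This is the source of triangularity. -/
theorem gaussInt_radial_zero_mul (k s : ℕ) :
    √((2 * k + 2).factorial : ℝ) * √(s.factorial : ℝ) * √(s.factorial : ℝ) *
      gaussInt (radial 0 s * radial (2 * k + 2) s) = (-1) ^ s *
        (Real.Gamma (k + 2) * ∏ i ∈ Finset.range s, ((k : ℝ) + 1 - s + i)) := by
  have h0 : C √(s.factorial : ℝ) * radial 0 s = C ((-1) ^ s) * X ^ s := by
    induction s with
    | zero => simp [radial]
    | succ s ih =>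
      have := radial_succ_right 0 s
      simp only [Nat.cast_zero, Real.sqrt_zero, C_0, zero_mul, zero_sub] at this
      rw [Nat.factorial_succ, Nat.cast_mul, Real.sqrt_mul (Nat.cast_nonneg _), C_mul]
      simp only [C_pow, C_neg, C_1] at ih ⊢
      linear_combination C √(s.factorial : ℝ) * this - X * ih
  have h1 := gaussInt_X_pow_mul_radial s (2 * k + 2) s (by omega)
  have h2 : √(s.factorial : ℝ) * gaussInt (radial 0 s * radial (2 * k + 2) s) =
      (-1) ^ s * gaussInt (X ^ s * radial (2 * k + 2) s) := by
    rw [← gaussInt_C_mul, ← gaussInt_C_mul, ← mul_assoc, h0, mul_assoc]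
  have a1 : ((s : ℝ) + (2 * k + 2 : ℕ) - s) / 2 + 1 = k + 2 := by push_cast; ring
  have a2 : (((2 * k + 2 : ℕ) : ℝ) - s - s) / 2 = k + 1 - s := by push_cast; ring
  rw [a1, a2] at h1
  rw [← h1]
  linear_combination √((2 * k + 2).factorial : ℝ) * √(s.factorial : ℝ) * h2

theorem gaussInt_radial_zero_mul_eq_zero {k s : ℕ} (h : k < s) :
    gaussInt (radial 0 s * radial (2 * k + 2) s) = 0 := by
  have h1 := gaussInt_radial_zero_mul k s
  have h2 : ∏ i ∈ Finset.range s, ((k : ℝ) + 1 - s + i) = 0 := by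
    refine Finset.prod_eq_zero (i := s - (k + 1)) (Finset.mem_range.2 (by omega)) ?_
    rw [Nat.cast_sub (by omega)]; push_cast; ring
  rw [h2, mul_zero, mul_zero] at h1
  refine (mul_eq_zero.1 h1).resolve_left ?_
  have : ∀ n : ℕ, √(n.factorial : ℝ) ≠ 0 := fun n => (Real.sqrt_pos.2 (by positivity)).ne'
  simp [this]

theorem gaussInt_radial_zero_mul_ne_zero (k : ℕ) :
    gaussInt (radial 0 k * radial (2 * k + 2) k) ≠ 0 := by
  intro h0
  have h1 := gaussInt_radial_zero_mul k k
  rw [h0, mul_zero] at h1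
  have h2 : 0 < ∏ i ∈ Finset.range k, ((k : ℝ) + 1 - k + i) :=
    Finset.prod_pos fun i _ => by
      rw [add_sub_cancel_left]; positivity
  have h3 : 0 < Real.Gamma ((k : ℝ) + 2) := Real.Gamma_pos_of_pos (by positivity)
  exact (mul_ne_zero (pow_ne_zero k (by norm_num)) (mul_pos h3 h2).ne') h1.symm

theorem gaussInt_radial_zero_two : gaussInt (radial 0 0 * radial 2 0) = (√2)⁻¹ := by
  have h1 := gaussInt_radial_zero_mul 0 0
  simp [Nat.factorial] at h1
  exact eq_inv_of_mul_eq_one_right h1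

/-! ### Matrix elements of the shift operators -/

theorem lowering_apply (x : ℕ →₀ ℂ) (m : ℕ) :
    lowering x m = (√((m + 1 : ℕ) : ℝ) : ℂ) * x (m + 1) := by
  induction x using Finsupp.induction_linear with
  | zero => simp
  | add f g hf hg => simp only [map_add, Finsupp.add_apply, hf, hg]; ring
  | single n c =>
    rw [lowering, Finsupp.linearCombination_single]
    rcases n with _ | n
    · simp
    · by_cases h : n = m
      · subst h; simp [mul_comm]
      · simp [h]

theorem raising_apply (x : ℕ →₀ ℂ) (m : ℕ) :
    raising x m = (√(m : ℝ) : ℂ) * x (m - 1) := by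
  induction x using Finsupp.induction_linear with
  | zero => simp
  | add f g hf hg => simp only [map_add, Finsupp.add_apply, hf, hg]; ring
  | single n c =>
    rw [raising, Finsupp.linearCombination_single]
    rcases m with _ | m
    · simp
    · by_cases h : n = m
      · subst h; simp [mul_comm]
      · simp [h]

theorem shiftGen_apply (z : ℂ) (x : ℕ →₀ ℂ) (m : ℕ) : shiftGen z x m =
    z * ((√(m : ℝ) : ℂ) * x (m - 1)) - conj z * ((√((m + 1 : ℕ) : ℝ) : ℂ) * x (m + 1)) := by
  simp [shiftGen, lowering_apply, raising_apply]

theorem ofReal_sqrt_mul_self (n : ℕ) : (√(n : ℝ) : ℂ) * (√(n : ℝ) : ℂ) = n := by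
  rw [← Complex.ofReal_mul, Real.mul_self_sqrt n.cast_nonneg, Complex.ofReal_natCast]

theorem lowering_shiftGen (z : ℂ) (x : ℕ →₀ ℂ) :
    lowering (shiftGen z x) = shiftGen z (lowering x) + z • x := by
  ext m
  have h1 := ofReal_sqrt_mul_self (m + 1)
  have h2 := ofReal_sqrt_mul_self m
  simp only [lowering_apply, shiftGen_apply, Finsupp.add_apply, Finsupp.smul_apply, smul_eq_mul,
    Nat.add_sub_cancel]
  have h3 : (√(m : ℝ) : ℂ) * ((√((m - 1 + 1 : ℕ) : ℝ) : ℂ) * x (m - 1 + 1)) = m * x m := by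
    cases m with
    | zero => simp
    | succ m => rw [Nat.add_sub_cancel, ← mul_assoc, ofReal_sqrt_mul_self]
  rw [h3]
  push_cast at h1
  push_cast
  linear_combination z * x m * h1

theorem raising_shiftGen (z : ℂ) (x : ℕ →₀ ℂ) :
    raising (shiftGen z x) = shiftGen z (raising x) + conj z • x := by
  ext m
  simp only [raising_apply, shiftGen_apply, Finsupp.add_apply, Finsupp.smul_apply, smul_eq_mul,
    Nat.add_sub_cancel]
  rcases m with _ | m
  · simp
  · have h3 := ofReal_sqrt_mul_self (m + 1 + 1)
    have h1 := ofReal_sqrt_mul_self (m + 1)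
    simp only [Nat.add_sub_cancel]
    push_cast at h1 h3 ⊢
    linear_combination conj z * x (m + 1) * (h3 - h1)

/-- A commutator that is a scalar `w` acts as a derivation: `[A, G^(k+1)] = (k+1) w G^k`. -/
theorem commute_shiftGen_pow {A : (ℕ →₀ ℂ) →ₗ[ℂ] (ℕ →₀ ℂ)} {z w : ℂ}
    (h : ∀ x, A (shiftGen z x) = shiftGen z (A x) + w • x) (k : ℕ) (x : ℕ →₀ ℂ) :
    A ((shiftGen z ^ (k + 1)) x) = (shiftGen z ^ (k + 1)) (A x) +
      ((k + 1 : ℂ) * w) • (shiftGen z ^ k) x := by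
  induction k with
  | zero => simp [h]
  | succ k ih =>
    have e : ∀ (j : ℕ) (y : ℕ →₀ ℂ), (shiftGen z ^ (j + 1)) y = shiftGen z ((shiftGen z ^ j) y) :=
      fun j y => by rw [pow_succ', Module.End.mul_apply]
    rw [e (k + 1) x, h, ih, map_add, map_smul, ← e, ← e, add_assoc, ← add_smul]
    congr 2
    push_cast; ring

section

variable {H : Type*} [NormedAddCommGroup H] [InnerProductSpace ℂ H] [CompleteSpace H]

theorem inner_embed (b : HilbertBasis ℕ ℂ H) (m : ℕ) (x : ℕ →₀ ℂ) :
    ⟪b m, embed b x⟫_ℂ = x m := by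
  induction x using Finsupp.induction_linear with
  | zero => simp
  | add f g hf hg => simp only [map_add, inner_add_right, Finsupp.add_apply, hf, hg]
  | single n c =>
    rw [embed, Finsupp.linearCombination_single, inner_smul_right,
      orthonormal_iff_ite.1 b.orthonormal, Finsupp.single_apply]
    simp [eq_comm]

theorem hasSum_inner_shiftVector (b : HilbertBasis ℕ ℂ H) (z : ℂ) (m s : ℕ) :
    HasSum (fun k : ℕ => (k.factorial : ℂ)⁻¹ * (shiftGen z ^ k) (Finsupp.single s 1) m)
      ⟪b m, shiftVector b z s⟫_ℂ := by
  refine ((innerSL ℂ (b m)).hasSum (summable_norm_expTerm b z s).of_norm.hasSum).congr_fun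
    fun k => ?_
  simp [expTerm, inner_embed]

/-- The identity `A e^G = e^G A + w e^G` in matrix elements. Since `A` is unbounded, it is applied
to the exponential series term by term on finite sequences; `hA` transfers it to the bra and `hs` to
the ket. -/
theorem inner_shiftVector_of_commute (b : HilbertBasis ℕ ℂ H)
    {A : (ℕ →₀ ℂ) →ₗ[ℂ] (ℕ →₀ ℂ)} {z w : ℂ}
    (h : ∀ x, A (shiftGen z x) = shiftGen z (A x) + w • x) {m m' s s' : ℕ} {α β : ℂ}
    (hA : ∀ x, A x m = α * x m')
    (hs : A (Finsupp.single s 1) = β • Finsupp.single s' 1) :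
    α * ⟪b m', shiftVector b z s⟫_ℂ =
      β * ⟪b m, shiftVector b z s'⟫_ℂ + w * ⟪b m, shiftVector b z s⟫_ℂ := by
  have h1 := ((hasSum_inner_shiftVector b z m' s).mul_left α).sub
    ((hasSum_inner_shiftVector b z m s').mul_left β)
  have h2 := (hasSum_inner_shiftVector b z m s).mul_left w
  -- The order-zero terms of the two series cancel, and the factor `k + 1` of the commutator turns
  -- `1/(k+1)!` into `1/k!`, matching the shifted series with `w e^G`.
  rw [← hasSum_nat_add_iff' 1] at h1
  have h3 := (h1.congr_fun (f := _) (g := fun k : ℕ => w * ((k.factorial : ℂ)⁻¹ *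
    (shiftGen z ^ k) (Finsupp.single s 1) m)) fun k => ?_).unique h2
  · have h4 := hA (Finsupp.single s 1)
    rw [hs] at h4
    simp only [Finsupp.smul_apply, smul_eq_mul] at h4
    simp only [Finset.range_one, Finset.sum_singleton, Nat.factorial_zero, Nat.cast_one, inv_one,
      pow_zero, one_mul, Module.End.one_apply, h4, sub_self, sub_zero] at h3
    linear_combination h3
  · have e := DFunLike.congr_fun (commute_shiftGen_pow h k (Finsupp.single s 1)) m
    rw [hA, hs] at e
    simp only [map_smul, Finsupp.add_apply, Finsupp.smul_apply, smul_eq_mul] at e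
    have hk : ((k + 1).factorial : ℂ)⁻¹ * (k + 1) = (k.factorial : ℂ)⁻¹ := by
      rw [Nat.factorial_succ]
      have : (k.factorial : ℂ) ≠ 0 := by exact_mod_cast k.factorial_ne_zero
      have : (k : ℂ) + 1 ≠ 0 := by exact_mod_cast k.succ_ne_zero
      push_cast
      field_simp
    linear_combination -((k + 1).factorial : ℂ)⁻¹ * e -
      w * (shiftGen z ^ k) (Finsupp.single s 1) m * hk

theorem inner_shiftVector_succ_left (b : HilbertBasis ℕ ℂ H) (z : ℂ) (m s : ℕ) :
    (√((m + 1 : ℕ) : ℝ) : ℂ) * ⟪b (m + 1), shiftVector b z s⟫_ℂ =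
      (√(s : ℝ) : ℂ) * ⟪b m, shiftVector b z (s - 1)⟫_ℂ + z * ⟪b m, shiftVector b z s⟫_ℂ :=
  inner_shiftVector_of_commute b (lowering_shiftGen z) (fun x => lowering_apply x m)
    (by simp [lowering])

theorem inner_shiftVector_succ_right (b : HilbertBasis ℕ ℂ H) (z : ℂ) (m s : ℕ) :
    (√(m : ℝ) : ℂ) * ⟪b (m - 1), shiftVector b z s⟫_ℂ =
      (√((s + 1 : ℕ) : ℝ) : ℂ) * ⟪b m, shiftVector b z (s + 1)⟫_ℂ +
        conj z * ⟪b m, shiftVector b z s⟫_ℂ :=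
  inner_shiftVector_of_commute b (raising_shiftGen z) (fun x => raising_apply x m)
    (by simp [raising])

theorem ofReal_sqrt_succ_ne_zero (n : ℕ) : (√((n + 1 : ℕ) : ℝ) : ℂ) ≠ 0 :=
  Complex.ofReal_ne_zero.2 (Real.sqrt_pos.2 (by positivity)).ne'

/-- The commutation relations give the same two recursions as for `radial`, with `ζ` and its
conjugate carrying the angle. They determine every matrix element up to the vacuum amplitude. -/
theorem inner_shiftVector_eq_radial (b : HilbertBasis ℕ ℂ H) (r : ℝ) {ζ : ℂ} (hζ : ‖ζ‖ = 1)
    (m s : ℕ) : ⟪b m, shiftVector b (r * ζ) s⟫_ℂ =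
      ⟪b 0, shiftVector b (r * ζ) 0⟫_ℂ * (ζ ^ m * conj ζ ^ s * ((radial m s).eval r : ℝ)) := by
  have hζ2 : ζ * conj ζ = 1 := by rw [Complex.mul_conj', hζ]; norm_num
  induction s generalizing m with
  | zero =>
    induction m with
    | zero => simp [radial]
    | succ m ih =>
      have h1 := inner_shiftVector_succ_left b (r * ζ) m 0
      have h2 := congrArg (fun q => ((q.eval r : ℝ) : ℂ)) (radial_succ_left m 0)
      simp only [eval_mul, eval_add, eval_C, eval_X, Nat.cast_zero, Real.sqrt_zero,
        Complex.ofReal_mul, Complex.ofReal_zero, zero_mul, zero_add] at h1 h2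
      refine mul_left_cancel₀ (ofReal_sqrt_succ_ne_zero m) ?_
      rw [h1, ih]
      linear_combination -⟪b 0, shiftVector b (r * ζ) 0⟫_ℂ * ζ ^ (m + 1) * conj ζ ^ 0 * h2
  | succ s ih =>
    have h1 := inner_shiftVector_succ_right b (r * ζ) m s
    have h2 := congrArg (fun q => ((q.eval r : ℝ) : ℂ)) (radial_succ_right m s)
    simp only [eval_mul, eval_sub, eval_C, eval_X, Complex.ofReal_mul, Complex.ofReal_sub,
      map_mul, Complex.conj_ofReal] at h1 h2
    refine mul_left_cancel₀ (ofReal_sqrt_succ_ne_zero s) ?_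
    rw [ih m, ih (m - 1)] at h1
    have h3 : (√(m : ℝ) : ℂ) * (ζ ^ (m - 1) * (1 - ζ * conj ζ)) = 0 := by rw [hζ2]; ring
    have h4 : (√(m : ℝ) : ℂ) * ζ ^ (m - 1) = √(m : ℝ) * (ζ ^ m * conj ζ) := by
      cases m with
      | zero => simp
      | succ m =>
        rw [Nat.add_sub_cancel, pow_succ]
        linear_combination -((√((m + 1 : ℕ) : ℝ) : ℂ)) * ζ ^ m * hζ2
    linear_combination -h1 - ⟪b 0, shiftVector b (r * ζ) 0⟫_ℂ * ζ ^ m * conj ζ ^ (s + 1) * h2 +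
      ⟪b 0, shiftVector b (r * ζ) 0⟫_ℂ * conj ζ ^ s * ((radial (m - 1) s).eval r : ℝ) * h4

/-- Parseval for the unit vector `D(z)|0⟩`: its squared coordinates are the vacuum probability times
the terms `r^(2m)/m!` of the series of `e^(r²)`. -/
theorem norm_sq_inner_shiftVector_zero (b : HilbertBasis ℕ ℂ H) (r : ℝ) {ζ : ℂ} (hζ : ‖ζ‖ = 1) :
    ‖⟪b 0, shiftVector b (r * ζ) 0⟫_ℂ‖ ^ 2 = Real.exp (-r ^ 2) := by
  have h1 := hasSum_norm_inner_sq b (shiftVector b (r * ζ) 0)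
  rw [(orthonormal_shiftVector b (r * ζ)).1 0, one_pow] at h1
  have h2 : HasSum (fun m : ℕ => ‖⟪b 0, shiftVector b (r * ζ) 0⟫_ℂ‖ ^ 2 *
      ((r ^ 2) ^ m / m.factorial)) (‖⟪b 0, shiftVector b (r * ζ) 0⟫_ℂ‖ ^ 2 * Real.exp (r ^ 2)) := by
    rw [Real.exp_eq_exp_ℝ]
    exact (NormedSpace.expSeries_div_hasSum_exp (r ^ 2)).mul_left _
  have h3 := (h2.congr_fun (f := _) fun m => ?_).unique h1
  · rw [Real.exp_neg]
    exact eq_inv_of_mul_eq_one_left h3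
  · rw [inner_shiftVector_eq_radial b r hζ]
    simp only [norm_mul, norm_pow, hζ, one_pow, pow_zero, one_mul, radial, mul_pow,
      Complex.norm_real, eval_mul, eval_C, eval_pow, eval_X, norm_inv, Real.norm_eq_abs, mul_one]
    rw [inv_pow, sq_abs, Real.sq_sqrt (by positivity), ← pow_mul, ← abs_pow,
      mul_comm m 2, pow_mul r, abs_of_nonneg (by positivity : 0 ≤ (r ^ 2) ^ m)]
    ring

/-- Removing a phase factor from `e^{z a* - z̄ a}|s⟩` gives explicit coordinates. -/
theorem exists_phase_shiftVector (b : HilbertBasis ℕ ℂ H) (r : ℝ) {ζ : ℂ} (hζ : ‖ζ‖ = 1) :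
    ∃ κ : ℂ, ‖κ‖ = 1 ∧ ∀ m s, κ * ⟪b m, shiftVector b (r * ζ) s⟫_ℂ =
      Real.exp (-r ^ 2 / 2) * (ζ ^ m * conj ζ ^ s * ((radial m s).eval r : ℝ)) := by
  have h1 := norm_sq_inner_shiftVector_zero b r hζ
  set f := ⟪b 0, shiftVector b (r * ζ) 0⟫_ℂ
  have h2 : ‖f‖ = Real.exp (-r ^ 2 / 2) := by
    rw [← Real.sqrt_sq (norm_nonneg f), h1, Real.sqrt_eq_iff_mul_self_eq (Real.exp_pos _).le
      (Real.exp_pos _).le, ← Real.exp_add]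
    ring_nf
  have hf : f ≠ 0 := by
    rw [← norm_pos_iff, h2]; exact Real.exp_pos _
  -- The phase of the vacuum amplitude is left undetermined; it cancels in every projection onto a
  -- displaced number state.
  refine ⟨‖f‖ / f, by simp [hf], fun m s => ?_⟩
  rw [inner_shiftVector_eq_radial b r hζ, ← mul_assoc, div_mul_cancel₀ _ hf, h2]

end

/-! ### The invariant probability measure of the circle -/

/-- The rotation invariant probability measure `dθ/2π` on the circle. -/
def circleMeasure : Measure Circle :=
  ENNReal.ofReal (2 * Real.pi)⁻¹ •
    Measure.map Circle.exp (volume.restrict (Set.Ico 0 (2 * Real.pi)))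

theorem measurable_circleExp : Measurable Circle.exp := Circle.exp.continuous.measurable

theorem argSet_eq (X : Set Circle) :
    argSet X = Circle.exp ⁻¹' X ∩ Set.Ico 0 (2 * Real.pi) := by
  ext θ; exact and_comm

instance : IsProbabilityMeasure circleMeasure := by
  refine ⟨?_⟩
  rw [circleMeasure, Measure.smul_apply, Measure.map_apply measurable_circleExp MeasurableSet.univ]
  simp only [Set.preimage_univ, Measure.restrict_apply_univ, Real.volume_Ico, sub_zero,
    smul_eq_mul]
  rw [← ENNReal.ofReal_mul (by positivity), inv_mul_cancel₀ (by positivity), ENNReal.ofReal_one]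

theorem setIntegral_circleMeasure {X : Set Circle} (hX : MeasurableSet X) {h : Circle → ℂ}
    (hh : Measurable h) : ∫ z in X, h z ∂circleMeasure =
      (2 * Real.pi : ℂ)⁻¹ * ∫ θ in argSet X, h (Circle.exp θ) := by
  rw [circleMeasure, Measure.restrict_smul, integral_smul_measure,
    setIntegral_map hX hh.aestronglyMeasurable measurable_circleExp.aemeasurable,
    Measure.restrict_restrict (measurable_circleExp hX), ← argSet_eq,
    ENNReal.toReal_ofReal (by positivity), Complex.real_smul]
  push_cast
  rfl

instance : circleMeasure.IsMulLeftInvariant := by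
  have : Fact (0 < 2 * Real.pi) := ⟨Real.two_pi_pos⟩
  have hc : Measurable (AddCircle.toCircle (T := 2 * Real.pi)) :=
    AddCircle.continuous_toCircle.measurable
  have h1 : Measure.map Circle.exp (volume.restrict (Set.Ico 0 (2 * Real.pi))) =
      Measure.map AddCircle.toCircle (volume : Measure (AddCircle (2 * Real.pi))) := by
    rw [← (AddCircle.measurePreserving_mk (2 * Real.pi) 0).map_eq, zero_add,
      Measure.map_map hc AddCircle.measurable_mk', Measure.restrict_congr_set Ico_ae_eq_Ioc]
    congr 1
    ext θ
    simp only [Function.comp_apply, AddCircle.toCircle_apply_mk]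
    rw [div_self Real.two_pi_pos.ne', one_mul]
  refine ⟨fun g => ?_⟩
  obtain ⟨φ, rfl⟩ : ∃ φ : ℝ, Circle.exp φ = g := ⟨_, Circle.exp_arg g⟩
  rw [circleMeasure, Measure.map_smul, h1, Measure.map_map (measurable_const_mul _) hc]
  have h2 : ((Circle.exp φ * ·) ∘ AddCircle.toCircle : AddCircle (2 * Real.pi) → Circle) =
      AddCircle.toCircle ∘ ((φ : AddCircle (2 * Real.pi)) + ·) := by
    funext x
    simp only [Function.comp_apply, AddCircle.toCircle_add, AddCircle.toCircle_apply_mk]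
    rw [div_self Real.two_pi_pos.ne', one_mul]
  rw [h2, ← Measure.map_map hc (measurable_const_add _), map_add_left_eq_self]

/-- Full support allows almost everywhere identities between continuous functions to be read
pointwise. -/
instance : circleMeasure.IsOpenPosMeasure :=
  isOpenPosMeasure_of_mulLeftInvariant_of_compact Set.univ isCompact_univ (by simp)

/-- The character `z ↦ zᵏ` of the circle. -/
def char (k : ℤ) : C(Circle, ℂ) where
  toFun z := ((z ^ k : Circle) : ℂ)
  continuous_toFun :=
    (by fun_prop : Continuous fun z : Circle => (z : ℂ)).comp (continuous_zpow k)

theorem char_apply (k : ℤ) (z : Circle) : char k z = ((z ^ k : Circle) : ℂ) := rfl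

theorem norm_char (k : ℤ) (z : Circle) : ‖char k z‖ = 1 := Circle.norm_coe _

theorem char_mul (k : ℤ) (z w : Circle) : char k (z * w) = char k z * char k w := by
  simp only [char_apply, mul_zpow, Circle.coe_mul]

theorem char_add (j k : ℤ) (z : Circle) : char (j + k) z = char j z * char k z := by
  simp only [char_apply, zpow_add, Circle.coe_mul]

theorem char_neg (k : ℤ) (z : Circle) : char (-k) z = conj (char k z) := by
  simp only [char_apply, zpow_neg, Circle.coe_inv_eq_conj]

theorem char_zero (z : Circle) : char 0 z = 1 := by simp [char_apply]

theorem char_one_right (k : ℤ) : char k 1 = 1 := by simp [char_apply]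

theorem char_natCast (k : ℕ) (z : Circle) : char k z = (z : ℂ) ^ k := by
  simp [char_apply]

theorem char_inv (k : ℤ) (z : Circle) : char k z⁻¹ = conj (char k z) := by
  rw [← char_neg]; simp [char_apply]

theorem char_exp (m n : ℕ) (θ : ℝ) : char ((m : ℤ) - n) (Circle.exp θ) =
    Complex.exp (Complex.I * ((m : ℂ) - n) * θ) := by
  rw [char_apply, ← Circle.exp_zsmul, Circle.coe_exp]
  congr 1
  simp
  ring

theorem integrable_char (μ : Measure Circle) [IsFiniteMeasure μ] (k : ℤ) :
    Integrable (char k) μ :=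
  (integrable_const (1 : ℝ)).mono' (char k).continuous.aestronglyMeasurable
    (ae_of_all _ fun z => (norm_char k z).le)

theorem integral_char (k : ℤ) : ∫ z, char k z ∂circleMeasure = if k = 0 then 1 else 0 := by
  split_ifs with hk
  · subst hk; simp [char_zero]
  · have h1 := integral_mul_left_eq_self (μ := circleMeasure) (char k) (Circle.exp (Real.pi / k))
    -- Translation by a point where the character is `-1` shows that the integral equals its own
    -- negative.
    have h2 : char k (Circle.exp (Real.pi / k)) = -1 := by
      rw [char_apply, ← Circle.exp_zsmul, zsmul_eq_mul,
        mul_div_cancel₀ _ (Int.cast_ne_zero.2 hk)]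
      simp
    simp_rw [char_mul, h2, integral_const_mul] at h1
    linear_combination -(1 / 2 : ℂ) * h1

theorem image_mul_left_eq (g : Circle) (X : Set Circle) :
    (fun x => g * x) '' X = (fun x => g⁻¹ * x) ⁻¹' X := Set.image_mul_left

theorem measurableSet_image_mul_left (g : Circle) {X : Set Circle} (hX : MeasurableSet X) :
    MeasurableSet ((fun x => g * x) '' X) := by
  rw [image_mul_left_eq]
  exact measurable_const_mul _ hX

theorem setIntegral_char_image (k : ℤ) (g : Circle) {X : Set Circle} (hX : MeasurableSet X) :
    ∫ z in (fun x => g * x) '' X, char k z ∂circleMeasure =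
      char k g * ∫ z in X, char k z ∂circleMeasure := by
  rw [← integral_indicator (measurableSet_image_mul_left g hX), ← integral_indicator hX,
    ← integral_mul_left_eq_self _ g, ← integral_const_mul]
  congr 1
  ext z
  by_cases hz : z ∈ X
  · rw [Set.indicator_of_mem hz, Set.indicator_of_mem (Set.mem_image_of_mem _ hz), char_mul]
  · rw [Set.indicator_of_notMem hz, Set.indicator_of_notMem, mul_zero]
    rw [image_mul_left_eq]
    simpa using hz

/-! ### Phase matrices -/

section

variable {H : Type*} [NormedAddCommGroup H] [InnerProductSpace ℂ H] [CompleteSpace H]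

theorem hasPhaseMatrix_iff {b : HilbertBasis ℕ ℂ H} {E : Observable Circle H} {c : ℕ → ℕ → ℂ} :
    HasPhaseMatrix b E c ↔ ∀ X, MeasurableSet X → ∀ m n : ℕ, ⟪b m, E.effect X (b n)⟫_ℂ =
      c m n * ∫ z in X, char ((m : ℤ) - n) z ∂circleMeasure := by
  refine forall₂_congr fun X hX => forall₂_congr fun m n => ?_
  rw [setIntegral_circleMeasure hX (char _).continuous.measurable]
  simp_rw [char_exp]

theorem vector_ext (b : HilbertBasis ℕ ℂ H) {x y : H} (h : ∀ m, ⟪b m, x⟫_ℂ = ⟪b m, y⟫_ℂ) :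
    x = y := by
  apply b.repr.injective
  ext m
  rw [b.repr_apply_apply, b.repr_apply_apply, h]

theorem operator_ext (b : HilbertBasis ℕ ℂ H) {A B : H →L[ℂ] H}
    (h : ∀ m n, ⟪b m, A (b n)⟫_ℂ = ⟪b m, B (b n)⟫_ℂ) : A = B := by
  refine ContinuousLinearMap.ext_on (s := Set.range b) ?_ ?_
  · rw [dense_iff_closure_eq, ← Submodule.topologicalClosure_coe, b.dense_span]
    rfl
  · rintro _ ⟨n, rfl⟩
    exact vector_ext b fun m => h m n

theorem numberRep_apply (b : HilbertBasis ℕ ℂ H) (t : Circle) (n : ℕ) :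
    numberRep b t (b n) = (t : ℂ) ^ n • b n :=
  isometryOfOrthonormal_apply b _ (orthonormal_rotate b t) n

theorem adjoint_numberRep_apply (b : HilbertBasis ℕ ℂ H) (t : Circle) (n : ℕ) :
    (numberRep b t).adjoint (b n) = conj ((t : ℂ) ^ n) • b n := by
  refine vector_ext b fun m => ?_
  rw [ContinuousLinearMap.adjoint_inner_right, numberRep_apply, inner_smul_left, inner_smul_right,
    orthonormal_iff_ite.1 b.orthonormal]
  split_ifs with h
  · rw [h]
  · simp

theorem inner_numberRep_conj (b : HilbertBasis ℕ ℂ H) (t : Circle) (A : H →L[ℂ] H) (m n : ℕ) :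
    ⟪b m, (numberRep b t ∘L A ∘L (numberRep b t).adjoint) (b n)⟫_ℂ =
      char ((m : ℤ) - n) t * ⟪b m, A (b n)⟫_ℂ := by
  rw [ContinuousLinearMap.comp_apply, ContinuousLinearMap.comp_apply, adjoint_numberRep_apply,
    ← ContinuousLinearMap.adjoint_inner_left, adjoint_numberRep_apply, map_smul, inner_smul_left,
    inner_smul_right, Complex.conj_conj, sub_eq_add_neg, char_add, char_neg, char_natCast,
    char_natCast]
  ring

theorem HasPhaseMatrix.isCovariant {b : HilbertBasis ℕ ℂ H} {E : Observable Circle H}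
    {c : ℕ → ℕ → ℂ} (h : HasPhaseMatrix b E c) : IsCovariant (numberRep b) E := by
  rw [hasPhaseMatrix_iff] at h
  intro g X hX
  refine operator_ext b fun m n => ?_
  rw [inner_numberRep_conj, h X hX, h _ (measurableSet_image_mul_left g hX),
    setIntegral_char_image _ _ hX]
  ring

/-! ### Outcome measures of vectors -/

section Vector

variable {Ω : Type*} [MeasurableSpace Ω]

theorem Observable.inner_self_eq (E : Observable Ω H) {X : Set Ω} (hX : MeasurableSet X) (v : H) :
    ⟪v, E.effect X v⟫_ℂ = ((⟪v, E.effect X v⟫_ℂ).re : ℂ) := by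
  have h := ((ContinuousLinearMap.nonneg_iff_isPositive _).1 (E.nonneg X hX)).inner_nonneg_right v
  rw [Complex.le_def] at h
  apply Complex.ext
  · simp
  · simpa using h.2.symm

theorem Observable.effect_adjoint (E : Observable Ω H) {X : Set Ω} (hX : MeasurableSet X) :
    (E.effect X).adjoint = E.effect X :=
  (ContinuousLinearMap.isSelfAdjoint_iff'.1
    ((ContinuousLinearMap.nonneg_iff_isPositive _).1 (E.nonneg X hX)).isSelfAdjoint)

/-- The measure `X ↦ ⟨v|E(X)|v⟩`. -/
def Observable.vecMeasure (E : Observable Ω H) (v : H) : Measure Ω :=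
  Measure.ofMeasurable (fun X _ => ENNReal.ofReal (⟪v, E.effect X v⟫_ℂ).re)
    (by simp [E.effect_empty]) (fun _ hX hd => E.ofReal_inner_iUnion hX hd v)

theorem Observable.vecMeasure_apply (E : Observable Ω H) (v : H) {X : Set Ω}
    (hX : MeasurableSet X) :
    E.vecMeasure v X = ENNReal.ofReal (⟪v, E.effect X v⟫_ℂ).re :=
  Measure.ofMeasurable_apply _ hX

instance (E : Observable Ω H) (v : H) : IsFiniteMeasure (E.vecMeasure v) :=
  ⟨by rw [E.vecMeasure_apply v MeasurableSet.univ]; exact ENNReal.ofReal_lt_top⟩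

theorem Observable.vecMeasure_real (E : Observable Ω H) (v : H) {X : Set Ω}
    (hX : MeasurableSet X) :
    (((E.vecMeasure v).real X : ℝ) : ℂ) = ⟪v, E.effect X v⟫_ℂ := by
  rw [Measure.real, E.vecMeasure_apply v hX, ENNReal.toReal_ofReal (E.inner_nonneg hX v),
    ← E.inner_self_eq hX]

/-- The pure state of a unit vector. -/
def pureState (b : HilbertBasis ℕ ℂ H) (v : H) (hv : ‖v‖ = 1) : State b where
  op := (ContinuousLinearMap.adjoint (innerSL ℂ v)) ∘L innerSL ℂ v
  nonneg := by
    rw [ContinuousLinearMap.nonneg_iff_isPositive]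
    exact ContinuousLinearMap.isPositive_adjoint_comp_self _
  hasTrace := by
    have h := b.hasSum_inner_mul_inner v v
    rw [inner_self_eq_norm_sq_to_K, hv] at h
    simp only [ContinuousLinearMap.comp_apply, ContinuousLinearMap.adjoint_inner_right]
    refine HasSum.congr_fun (by simpa using h) fun n => ?_
    rw [← inner_conj_symm (b n) v, Complex.mul_conj', innerSL_apply_apply,
      inner_self_eq_norm_sq_to_K]
    rfl

theorem outcomeMeasure_pureState (b : HilbertBasis ℕ ℂ H) (v : H) (hv : ‖v‖ = 1)
    (E : Observable Ω H) : outcomeMeasure E (pureState b v hv) = E.vecMeasure v := by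
  ext X hX
  rw [outcomeMeasure, Measure.ofMeasurable_apply _ hX, E.vecMeasure_apply v hX]
  congr 2
  have h := b.hasSum_inner_mul_inner ((E.effect X).adjoint v) v
  rw [ContinuousLinearMap.adjoint_inner_left] at h
  rw [trace, ← h.tsum_eq]
  refine tsum_congr fun n => ?_
  rw [pureState, ContinuousLinearMap.comp_apply, ContinuousLinearMap.comp_apply,
    ContinuousLinearMap.adjoint_inner_right, ContinuousLinearMap.adjoint_inner_left]
  simp

end Vector

/-! ### Covariant observables have phase matrices -/

theorem integral_char_mul_real_preimage (μ : Measure Circle) [IsFiniteMeasure μ] (k : ℤ)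
    {X : Set Circle} (hX : MeasurableSet X) :
    ∫ g, char k g * (μ.real ((fun x => g * x) ⁻¹' X) : ℂ) ∂circleMeasure =
      (∫ z, conj (char k z) ∂μ) * ∫ z in X, char k z ∂circleMeasure := by
  have hS : MeasurableSet {p : Circle × Circle | p.1 * p.2 ∈ X} :=
    (measurable_fst.mul measurable_snd) hX
  set G : Circle × Circle → ℂ :=
    {p : Circle × Circle | p.1 * p.2 ∈ X}.indicator fun p => char k p.1 with hG
  have hint : Integrable G (circleMeasure.prod μ) := by
    refine Integrable.indicator ?_ hS
    exact (integrable_const (1 : ℝ)).mono'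
      ((char k).continuous.comp continuous_fst).measurable.aestronglyMeasurable
      (ae_of_all _ fun p => (norm_char k p.1).le)
  have e1 : ∀ g, char k g * (μ.real ((fun x => g * x) ⁻¹' X) : ℂ) = ∫ z, G (g, z) ∂μ := by
    intro g
    have : (fun z => G (g, z)) = ((fun x => g * x) ⁻¹' X).indicator fun _ => char k g := by
      ext z; rfl
    rw [this, integral_indicator_const _ (measurable_const_mul g hX), Complex.real_smul, mul_comm]
  simp_rw [e1]
  rw [integral_integral_swap (f := fun g z => G (g, z)) hint, ← integral_mul_const]
  congr 1
  ext z
  -- Substituting `g z⁻¹` for `g` turns the condition `g z ∈ X` into `g ∈ X` and splits off the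
  -- conjugate of `z^k`, so the double integral factors.
  rw [← integral_mul_right_eq_self _ z⁻¹, ← integral_indicator hX, ← integral_const_mul]
  congr 1
  ext g
  by_cases hg : g ∈ X
  · simp [hG, hg, char_mul, char_inv, mul_comm]
  · simp [hG, hg]

/-- Covariance makes `g^k ⟨m|F(g⁻¹X)|n⟩` independent of `g`. Polarization writes it through four
finite positive measures, and averaging each over `g` factors it into a constant and `∫_X z^k`. -/
theorem exists_hasPhaseMatrix {b : HilbertBasis ℕ ℂ H} {F : Observable Circle H}
    (hF : IsCovariant (numberRep b) F) : ∃ d, HasPhaseMatrix b F d := by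
  have key : ∀ m n : ℕ, ∃ d : ℂ, ∀ X, MeasurableSet X → ⟪b m, F.effect X (b n)⟫_ℂ =
      d * ∫ z in X, char ((m : ℤ) - n) z ∂circleMeasure := by
    intro m n
    set k : ℤ := (m : ℤ) - n with hk
    have hpol : ∀ X, MeasurableSet X → ⟪b m, F.effect X (b n)⟫_ℂ =
        4⁻¹ * (((F.vecMeasure (b m + b n)).real X : ℂ) - (F.vecMeasure (b m - b n)).real X
          - Complex.I * (F.vecMeasure (b m + Complex.I • b n)).real X
          + Complex.I * (F.vecMeasure (b m - Complex.I • b n)).real X) := by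
      intro X hX
      simp only [F.vecMeasure_real _ hX, map_add, map_sub, map_smul, inner_add_left,
        inner_add_right, inner_sub_left, inner_sub_right, inner_smul_left, inner_smul_right,
        Complex.conj_I]
      ring_nf
      simp only [Complex.I_sq]
      ring
    set I4 : Measure Circle → ℂ := fun μ => ∫ z, conj (char k z) ∂μ
    refine ⟨4⁻¹ * (I4 (F.vecMeasure (b m + b n)) - I4 (F.vecMeasure (b m - b n))
          - Complex.I * I4 (F.vecMeasure (b m + Complex.I • b n))
          + Complex.I * I4 (F.vecMeasure (b m - Complex.I • b n))), fun X hX => ?_⟩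
    have hint : ∀ v, Integrable (fun g => char k g *
        ((F.vecMeasure v).real ((fun x => g * x) ⁻¹' X) : ℂ)) circleMeasure := by
      intro v
      refine (integrable_const ((F.vecMeasure v).real Set.univ)).mono' ?_
        (ae_of_all _ fun g => ?_)
      · refine ((char k).continuous.measurable.mul ?_).aestronglyMeasurable
        refine Complex.measurable_ofReal.comp (Measurable.ennreal_toReal ?_)
        exact measurable_measure_prodMk_left
          ((measurable_fst.mul measurable_snd) hX :
            MeasurableSet {p : Circle × Circle | p.1 * p.2 ∈ X})
      · rw [norm_mul, norm_char, one_mul, Complex.norm_real, Real.norm_of_nonneg measureReal_nonneg]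
        exact measureReal_mono (Set.subset_univ _)
    have hcov : ∀ g : Circle, char k g * ⟪b m, F.effect ((fun x => g * x) ⁻¹' X) (b n)⟫_ℂ =
        ⟪b m, F.effect X (b n)⟫_ℂ := by
      intro g
      rw [← inner_numberRep_conj, hF g _ (measurable_const_mul g hX),
        Set.image_preimage_eq X (mul_left_surjective g)]
    have h1 : ∫ g, char k g * ⟪b m, F.effect ((fun x => g * x) ⁻¹' X) (b n)⟫_ℂ ∂circleMeasure =
        ⟪b m, F.effect X (b n)⟫_ℂ := by
      simp_rw [hcov]; simp
    rw [← h1]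
    have e : ∀ g : Circle, char k g * ⟪b m, F.effect ((fun x => g * x) ⁻¹' X) (b n)⟫_ℂ =
        4⁻¹ * (char k g * ((F.vecMeasure (b m + b n)).real ((fun x => g * x) ⁻¹' X) : ℂ)
          - char k g * ((F.vecMeasure (b m - b n)).real ((fun x => g * x) ⁻¹' X) : ℂ)
          - Complex.I * (char k g *
            ((F.vecMeasure (b m + Complex.I • b n)).real ((fun x => g * x) ⁻¹' X) : ℂ))
          + Complex.I * (char k g *
            ((F.vecMeasure (b m - Complex.I • b n)).real ((fun x => g * x) ⁻¹' X) : ℂ))) := by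
      intro g
      rw [hpol _ (measurable_const_mul g hX)]; ring
    simp_rw [e]
    rw [integral_const_mul, integral_add (Integrable.sub' ((hint _).sub' (hint _))
      ((hint _).const_mul _)) ((hint _).const_mul _), integral_sub (Integrable.sub' (hint _) (hint _))
      ((hint _).const_mul _), integral_sub (hint _) (hint _), integral_const_mul,
      integral_const_mul]
    simp only [integral_char_mul_real_preimage _ k hX, I4]
    ring
  choose d hd using key
  exact ⟨d, hasPhaseMatrix_iff.2 fun X hX m n => hd m n X hX⟩

end

/-! ### Linear extension of affine maps of probability densities -/

/-- An affine functional on the probability densities extends to a linear functional. -/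
theorem exists_linear_extension {α : Type*} [TopologicalSpace α] [CompactSpace α]
    (I : C(α, ℝ) →ₗ[ℝ] ℝ) (hI : ∀ f, 0 ≤ f → 0 ≤ I f) (hI0 : ∀ f, 0 ≤ f → I f = 0 → f = 0)
    (T : C(α, ℝ) → ℂ)
    (hT : ∀ (s t : ℝ) (f g : C(α, ℝ)), 0 ≤ s → 0 ≤ t → s + t = 1 → 0 ≤ f → 0 ≤ g →
      I f = 1 → I g = 1 → T (s • f + t • g) = s * T f + t * T g) :
    ∃ L : C(α, ℝ) →ₗ[ℝ] ℂ, ∀ f, 0 ≤ f → I f = 1 → L f = T f := by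
  -- The homogeneous extension to the cone of nonnegative functions. Faithfulness of `I` handles the
  -- elements of integral 0, where the normalization is meaningless.
  set P : C(α, ℝ) → ℂ := fun f => (I f : ℂ) * T ((I f)⁻¹ • f) with hP
  have hP0 : P 0 = 0 := by simp [hP]
  have hnorm : ∀ f, 0 ≤ f → I f ≠ 0 → 0 ≤ (I f)⁻¹ • f ∧ I ((I f)⁻¹ • f) = 1 := fun f hf h =>
    ⟨smul_nonneg (inv_nonneg.2 (hI f hf)) hf, by rw [map_smul, smul_eq_mul, inv_mul_cancel₀ h]⟩
  have hadd : ∀ f g, 0 ≤ f → 0 ≤ g → P (f + g) = P f + P g := by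
    intro f g hf hg
    by_cases hf0 : I f = 0
    · rw [hI0 f hf hf0, zero_add, hP0, zero_add]
    by_cases hg0 : I g = 0
    · rw [hI0 g hg hg0, add_zero, hP0, add_zero]
    have hf1 : 0 < I f := lt_of_le_of_ne (hI f hf) (Ne.symm hf0)
    have hg1 : 0 < I g := lt_of_le_of_ne (hI g hg) (Ne.symm hg0)
    have hs : 0 < I f + I g := add_pos hf1 hg1
    have h := hT (I f / (I f + I g)) (I g / (I f + I g)) _ _ (by positivity) (by positivity)
      (by rw [← add_div, div_self hs.ne']) (hnorm f hf hf0).1 (hnorm g hg hg0).1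
      (hnorm f hf hf0).2 (hnorm g hg hg0).2
    have e : (I f / (I f + I g)) • (I f)⁻¹ • f + (I g / (I f + I g)) • (I g)⁻¹ • g =
        (I (f + g))⁻¹ • (f + g) := by
      rw [map_add, smul_smul, smul_smul, smul_add]
      congr 2 <;> field_simp
    rw [e] at h
    simp only [hP]
    rw [h, map_add]
    have : ((I f : ℂ) + I g) ≠ 0 := by exact_mod_cast hs.ne'
    push_cast
    field_simp
  have hsmul : ∀ (c : ℝ) f, 0 ≤ c → P (c • f) = c * P f := by
    intro c f hc
    rcases hc.eq_or_lt with rfl | hc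
    · simp [hP0]
    · simp only [hP, map_smul, smul_eq_mul, mul_inv, smul_smul]
      rw [show c⁻¹ * (I f)⁻¹ * c = (I f)⁻¹ by field_simp]
      push_cast; ring
  have hn : ∀ f : C(α, ℝ), 0 ≤ f + ‖f‖ • (1 : C(α, ℝ)) := by
    refine fun f => ContinuousMap.le_def.2 fun x => ?_
    have := (abs_le.1 (f.norm_coe_le_norm x)).1
    simp only [ContinuousMap.zero_apply, ContinuousMap.add_apply, ContinuousMap.smul_apply,
      ContinuousMap.one_apply, smul_eq_mul, mul_one]
    linarith
  have h1 : (0 : C(α, ℝ)) ≤ 1 := ContinuousMap.le_def.2 fun x => zero_le_one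
  -- Every function is the difference of the nonnegative functions `f + ‖f‖` and `‖f‖`; `hLsub`
  -- shows that any other such decomposition gives the same value.
  set L : C(α, ℝ) → ℂ := fun f => P (f + ‖f‖ • (1 : C(α, ℝ))) - ‖f‖ * P 1 with hL
  have hLsub : ∀ p q : C(α, ℝ), 0 ≤ p → 0 ≤ q → L (p - q) = P p - P q := by
    intro p q hp hq
    have h2 := hadd (p - q + ‖p - q‖ • (1 : C(α, ℝ))) q (hn _) hq
    have h3 := hadd p (‖p - q‖ • (1 : C(α, ℝ))) hp (smul_nonneg (norm_nonneg _) h1)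
    rw [show p - q + ‖p - q‖ • (1 : C(α, ℝ)) + q = p + ‖p - q‖ • (1 : C(α, ℝ)) by abel, h3,
      hsmul _ _ (norm_nonneg _)] at h2
    simp only [hL]
    linear_combination -h2
  have hsplit : ∀ f, L f = P (f + ‖f‖ • (1 : C(α, ℝ))) - ‖f‖ * P 1 := fun f => rfl
  have hsc : ∀ (c : ℝ) f, 0 ≤ c → L (c • f) = c * L f := by
    intro c f hc
    have e : c • f = c • (f + ‖f‖ • (1 : C(α, ℝ))) - (c * ‖f‖) • (1 : C(α, ℝ)) := by
      rw [smul_add, smul_smul, add_sub_cancel_right]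
    rw [e, hLsub _ _ (smul_nonneg hc (hn f)) (smul_nonneg (mul_nonneg hc (norm_nonneg f)) h1),
      hsmul _ _ hc, hsmul _ _ (mul_nonneg hc (norm_nonneg f)), hsplit f]
    push_cast; ring
  have hneg : ∀ f, L (-f) = -L f := by
    intro f
    have e : -f = ‖f‖ • (1 : C(α, ℝ)) - (f + ‖f‖ • (1 : C(α, ℝ))) := by abel
    rw [e, hLsub _ _ (smul_nonneg (norm_nonneg f) h1) (hn f), hsmul _ _ (norm_nonneg f), hsplit f]
    ring
  refine ⟨{ toFun := L, map_add' := fun f g => ?_, map_smul' := fun c f => ?_ }, fun f hf h => ?_⟩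
  · have e : f + g = (f + ‖f‖ • (1 : C(α, ℝ)) + (g + ‖g‖ • (1 : C(α, ℝ)))) -
        (‖f‖ • (1 : C(α, ℝ)) + ‖g‖ • (1 : C(α, ℝ))) := by abel
    rw [e, hLsub _ _ (add_nonneg (hn f) (hn g)) (add_nonneg (smul_nonneg (norm_nonneg f) h1)
      (smul_nonneg (norm_nonneg g) h1)), hadd _ _ (hn f) (hn g), hadd _ _
      (smul_nonneg (norm_nonneg f) h1) (smul_nonneg (norm_nonneg g) h1),
      hsmul _ _ (norm_nonneg f), hsmul _ _ (norm_nonneg g), hsplit f, hsplit g]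
    ring
  · rw [RingHom.id_apply, Complex.real_smul]
    rcases le_total 0 c with hc | hc
    · exact hsc c f hc
    · have h2 := hsc (-c) f (neg_nonneg.2 hc)
      rw [neg_smul, hneg] at h2
      push_cast at h2
      linear_combination -h2
  · have h2 := hLsub f 0 hf le_rfl
    rw [sub_zero, hP0, sub_zero] at h2
    refine h2.trans ?_
    simp [hP, h]

/-- A real functional with complex values extends to complex valued functions. -/
theorem exists_complex_extension {α : Type*} [TopologicalSpace α] (L : C(α, ℝ) →ₗ[ℝ] ℂ) :
    ∃ K : C(α, ℂ) →ₗ[ℂ] ℂ, ∀ (f : C(α, ℝ)) (h : C(α, ℂ)), (∀ x, h x = f x) → K h = L f := by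
  set re : C(α, ℂ) → C(α, ℝ) := fun h => ⟨fun x => (h x).re, by fun_prop⟩ with hre
  set im : C(α, ℂ) → C(α, ℝ) := fun h => ⟨fun x => (h x).im, by fun_prop⟩ with him
  refine ⟨{
    toFun := fun h => L (re h) + Complex.I * L (im h)
    map_add' := fun f g => ?_
    map_smul' := fun c f => ?_ }, fun f h hf => ?_⟩
  · change L (re (f + g)) + Complex.I * L (im (f + g)) =
      L (re f) + Complex.I * L (im f) + (L (re g) + Complex.I * L (im g))
    have e1 : re (f + g) = re f + re g := by ext x; simp [hre]
    have e2 : im (f + g) = im f + im g := by ext x; simp [him]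
    rw [e1, e2, map_add, map_add]; ring
  · change L (re (c • f)) + Complex.I * L (im (c • f)) =
      RingHom.id ℂ c • (L (re f) + Complex.I * L (im f))
    have e1 : re (c • f) = c.re • re f - c.im • im f := by ext x; simp [hre, him]
    have e2 : im (c • f) = c.re • im f + c.im • re f := by ext x; simp [hre, him]
    rw [e1, e2, map_sub, map_add, map_smul, map_smul, map_smul, map_smul, RingHom.id_apply]
    simp only [Complex.real_smul, smul_eq_mul]
    conv_rhs => rw [← Complex.re_add_im c]
    linear_combination -((c.im : ℂ) * L (im f)) * Complex.I_sq
  · have e1 : re h = f := by ext x; simp [hre, hf]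
    have e2 : im h = 0 := by ext x; simp [him, hf]
    change L (re h) + Complex.I * L (im h) = L f
    rw [e1, e2, map_zero]; ring

/-! ### Densities on the circle -/

theorem nonneg_apply {α : Type*} [TopologicalSpace α] {f : C(α, ℝ)} (hf : 0 ≤ f) (x : α) :
    0 ≤ f x := ContinuousMap.le_def.1 hf x

theorem integral_add_mul_add_mul {α : Type*} [MeasurableSpace α] {μ : Measure α}
    {f g h : α → ℂ} (hf : Integrable f μ) (hg : Integrable g μ) (hh : Integrable h μ) (u v : ℂ) :
    ∫ x, f x + (u * g x + v * h x) ∂μ =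
      ∫ x, f x ∂μ + (u * ∫ x, g x ∂μ + v * ∫ x, h x ∂μ) := by
  rw [integral_add hf (g := fun x => u * g x + v * h x) ((hg.const_mul u).add (hh.const_mul v)),
    integral_add (hg.const_mul u) (hh.const_mul v), integral_const_mul, integral_const_mul]

/-- The measure with density `f` with respect to the invariant measure. -/
def densityMeasure (f : C(Circle, ℝ)) : Measure Circle :=
  circleMeasure.withDensity fun z => ENNReal.ofReal (f z)

theorem integrable_continuousMap {E : Type*} [NormedAddCommGroup E] (f : C(Circle, E)) :
    Integrable f circleMeasure :=
  f.continuous.integrable_of_hasCompactSupport (HasCompactSupport.of_compactSpace _)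

/-- Integration of continuous functions as a linear functional. -/
def circleIntegral : C(Circle, ℝ) →ₗ[ℝ] ℝ where
  toFun f := ∫ z, f z ∂circleMeasure
  map_add' f g := integral_add (integrable_continuousMap f) (integrable_continuousMap g)
  map_smul' c f := integral_const_mul c f

theorem circleIntegral_apply (f : C(Circle, ℝ)) :
    circleIntegral f = ∫ z, f z ∂circleMeasure := rfl

theorem circleIntegral_nonneg (f : C(Circle, ℝ)) (hf : 0 ≤ f) : 0 ≤ circleIntegral f :=
  integral_nonneg fun z => nonneg_apply hf z

theorem circleIntegral_eq_zero (f : C(Circle, ℝ)) (hf : 0 ≤ f) (h : circleIntegral f = 0) :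
    f = 0 := by
  have h1 := (integral_eq_zero_iff_of_nonneg (fun z => nonneg_apply hf z) (integrable_continuousMap f)).1 h
  have h2 := (f.continuous.ae_eq_iff_eq circleMeasure continuous_const).1 h1
  ext z
  exact congrFun h2 z

theorem isProbabilityMeasure_densityMeasure (f : C(Circle, ℝ)) (hf : 0 ≤ f)
    (h : circleIntegral f = 1) : IsProbabilityMeasure (densityMeasure f) := by
  refine ⟨?_⟩
  rw [densityMeasure, withDensity_apply _ MeasurableSet.univ, Measure.restrict_univ,
    ← ofReal_integral_eq_lintegral_ofReal (integrable_continuousMap f) (ae_of_all _ (nonneg_apply hf)),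
    ← circleIntegral_apply, h, ENNReal.ofReal_one]

theorem densityMeasure_add_smul (s t : NNReal) (f g : C(Circle, ℝ)) (hf : 0 ≤ f) (hg : 0 ≤ g) :
    densityMeasure ((s : ℝ) • f + (t : ℝ) • g) = s • densityMeasure f + t • densityMeasure g := by
  have hm : ∀ f : C(Circle, ℝ), Measurable fun z => ENNReal.ofReal (f z) := fun f =>
    ENNReal.measurable_ofReal.comp f.continuous.measurable
  rw [densityMeasure, densityMeasure, densityMeasure, ENNReal.smul_def, ENNReal.smul_def,
    ← withDensity_smul _ (hm f), ← withDensity_smul _ (hm g),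
    ← withDensity_add_left ((hm f).const_smul _)]
  congr 1
  ext z
  simp only [ContinuousMap.add_apply, ContinuousMap.smul_apply, smul_eq_mul, Pi.add_apply,
    Pi.smul_apply]
  rw [ENNReal.ofReal_add (mul_nonneg s.coe_nonneg (nonneg_apply hf z))
    (mul_nonneg t.coe_nonneg (nonneg_apply hg z)),
    ENNReal.ofReal_mul s.coe_nonneg, ENNReal.ofReal_mul t.coe_nonneg, ENNReal.ofReal_coe_nnreal,
    ENNReal.ofReal_coe_nnreal]

theorem integral_densityMeasure (f : C(Circle, ℝ)) (hf : 0 ≤ f) (h : Circle → ℂ) :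
    ∫ z, h z ∂densityMeasure f = ∫ z, (f z : ℂ) * h z ∂circleMeasure := by
  have hm : Measurable fun z => ENNReal.ofReal (f z) :=
    ENNReal.measurable_ofReal.comp f.continuous.measurable
  rw [densityMeasure, integral_withDensity_eq_integral_toReal_smul hm
    (ae_of_all _ fun _ => ENNReal.ofReal_lt_top)]
  congr 1
  ext z
  rw [ENNReal.toReal_ofReal (nonneg_apply hf z), Complex.real_smul]

/-- The Fourier coefficients of `Ψ p`, for `p` with continuous density, depend linearly on the
density. -/
theorem IsAffine.exists_linear {Ψ : ProbabilityMeasure Circle → ProbabilityMeasure Circle}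
    (hΨ : IsAffine Ψ) (k : ℤ) : ∃ K : C(Circle, ℂ) →ₗ[ℂ] ℂ,
      ∀ (f : C(Circle, ℝ)) (h : C(Circle, ℂ)) (p : ProbabilityMeasure Circle), 0 ≤ f →
        (∀ z, h z = f z) → (p : Measure Circle) = densityMeasure f →
          ∫ z, char k z ∂(Ψ p : Measure Circle) = K h := by
  classical
  -- The value 0 off the densities is a dummy; linear extension uses `T` only on densities.
  set T : C(Circle, ℝ) → ℂ := fun f =>
    if hf : 0 ≤ f ∧ circleIntegral f = 1 then
      ∫ z, char k z ∂(Ψ ⟨densityMeasure f, isProbabilityMeasure_densityMeasure f hf.1 hf.2⟩ :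
        Measure Circle) else 0 with hT
  obtain ⟨L, hL⟩ := exists_linear_extension circleIntegral circleIntegral_nonneg
    circleIntegral_eq_zero T (by
      intro s t f g hs ht hst hf hg hf1 hg1
      lift s to NNReal using hs
      lift t to NNReal using ht
      have hfg : 0 ≤ (s : ℝ) • f + (t : ℝ) • g :=
        add_nonneg (smul_nonneg s.2 hf) (smul_nonneg t.2 hg)
      have hfg1 : circleIntegral ((s : ℝ) • f + (t : ℝ) • g) = 1 := by
        rw [map_add, map_smul, map_smul, hf1, hg1]; simpa using hst
      simp only [hT]
      rw [dif_pos ⟨hfg, hfg1⟩, dif_pos ⟨hf, hf1⟩, dif_pos ⟨hg, hg1⟩,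
        hΨ s t (by exact_mod_cast hst)
          ⟨densityMeasure f, isProbabilityMeasure_densityMeasure f hf hf1⟩
          ⟨densityMeasure g, isProbabilityMeasure_densityMeasure g hg hg1⟩
          ⟨_, isProbabilityMeasure_densityMeasure _ hfg hfg1⟩
          (densityMeasure_add_smul s t f g hf hg),
        integral_add_measure ((integrable_char _ k).smul_measure_nnreal)
          ((integrable_char _ k).smul_measure_nnreal),
        integral_smul_nnreal_measure, integral_smul_nnreal_measure]
      rfl)
  obtain ⟨K, hK⟩ := exists_complex_extension L
  refine ⟨K, fun f h p hf hh hp => ?_⟩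
  have hf1 : circleIntegral f = 1 := by
    have h1 : densityMeasure f Set.univ = 1 := by rw [← hp]; exact measure_univ
    rw [densityMeasure, withDensity_apply _ MeasurableSet.univ, Measure.restrict_univ,
      ← ofReal_integral_eq_lintegral_ofReal (integrable_continuousMap f) (ae_of_all _ (nonneg_apply hf)),
      ENNReal.ofReal_eq_one] at h1
    exact h1
  rw [hK f h hh, hL f hf hf1]
  simp only [hT]
  rw [dif_pos ⟨hf, hf1⟩]
  congr 3
  exact Subtype.ext hp

section

variable {H : Type*} [NormedAddCommGroup H] [InnerProductSpace ℂ H] [CompleteSpace H]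

/-! ### Outcome distributions of superpositions of two number states -/

theorem HasPhaseMatrix.self_eq_one {b : HilbertBasis ℕ ℂ H} {E : Observable Circle H}
    {c : ℕ → ℕ → ℂ} (h : HasPhaseMatrix b E c) (n : ℕ) : c n n = 1 := by
  have h1 := hasPhaseMatrix_iff.1 h Set.univ MeasurableSet.univ n n
  rw [E.univ, sub_self, setIntegral_univ, integral_char, if_pos rfl, mul_one] at h1
  rw [← h1]
  simpa using orthonormal_iff_ite.1 b.orthonormal n n

theorem inner_effect_conj {b : HilbertBasis ℕ ℂ H} {E : Observable Circle H}
    {X : Set Circle} (hX : MeasurableSet X)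
    (m n : ℕ) : ⟪b n, E.effect X (b m)⟫_ℂ = conj ⟪b m, E.effect X (b n)⟫_ℂ := by
  rw [inner_conj_symm, ← ContinuousLinearMap.adjoint_inner_right, E.effect_adjoint hX]

/-- The unit vector `(|m⟩ + ζ|n⟩)/√2`. -/
def superposition (b : HilbertBasis ℕ ℂ H) (m n : ℕ) (ζ : ℂ) : H :=
  ((√2)⁻¹ : ℂ) • (b m + ζ • b n)

theorem inner_superposition (b : HilbertBasis ℕ ℂ H) (m n : ℕ) {ζ : ℂ} (hζ : ‖ζ‖ = 1)
    (A : H →L[ℂ] H) : ⟪superposition b m n ζ, A (superposition b m n ζ)⟫_ℂ =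
      2⁻¹ * (⟪b m, A (b m)⟫_ℂ + ⟪b n, A (b n)⟫_ℂ + ζ * ⟪b m, A (b n)⟫_ℂ +
        conj ζ * ⟪b n, A (b m)⟫_ℂ) := by
  have h1 : ((√2 : ℝ) : ℂ)⁻¹ * ((√2 : ℝ) : ℂ)⁻¹ = 2⁻¹ := by
    rw [← mul_inv, ← Complex.ofReal_mul, Real.mul_self_sqrt zero_le_two]; norm_num
  have h2 : ζ * conj ζ = 1 := by rw [Complex.mul_conj', hζ]; norm_num
  simp only [superposition, map_smul, map_add, inner_smul_left, inner_smul_right, inner_add_left,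
    inner_add_right, map_inv₀, Complex.conj_ofReal]
  linear_combination (⟪b m, A (b m)⟫_ℂ + ζ * conj ζ * ⟪b n, A (b n)⟫_ℂ + ζ * ⟪b m, A (b n)⟫_ℂ +
        conj ζ * ⟪b n, A (b m)⟫_ℂ) * h1 + 2⁻¹ * ⟪b n, A (b n)⟫_ℂ * h2

theorem norm_superposition (b : HilbertBasis ℕ ℂ H) {m n : ℕ} (hmn : m ≠ n) {ζ : ℂ}
    (hζ : ‖ζ‖ = 1) : ‖superposition b m n ζ‖ = 1 := by
  have h1 := inner_superposition b m n hζ 1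
  simp only [one_apply_eq_self, orthonormal_iff_ite.1 b.orthonormal, if_neg hmn,
    if_neg hmn.symm, if_true, inner_self_eq_norm_sq_to_K] at h1
  have h2 : ((‖superposition b m n ζ‖ ^ 2 : ℝ) : ℂ) = 1 := by
    push_cast
    refine h1.trans ?_
    norm_num
  have h3 : ‖superposition b m n ζ‖ ^ 2 = 1 := by exact_mod_cast h2
  nlinarith [norm_nonneg (superposition b m n ζ)]

/-- The density `1 + Re (w zᵏ)`. -/
def cosDensity (w : ℂ) (k : ℤ) : C(Circle, ℝ) where
  toFun z := 1 + (w * char k z).re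
  continuous_toFun := by fun_prop

theorem ofReal_cosDensity (w : ℂ) (k : ℤ) (z : Circle) :
    (cosDensity w k z : ℂ) = 1 + (w / 2 * char k z + conj w / 2 * char (-k) z) := by
  have h := Complex.add_conj (w * char k z)
  change ((1 + (w * char k z).re : ℝ) : ℂ) = _
  rw [map_mul] at h
  rw [char_neg]
  push_cast at h ⊢
  linear_combination -(1 / 2 : ℂ) * h

/-- The diagonal entries contribute the constant 1, and the two off-diagonal entries are complex
conjugates, giving the cosine. -/
theorem HasPhaseMatrix.vecMeasure_superposition {b : HilbertBasis ℕ ℂ H}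
    {E : Observable Circle H} {c : ℕ → ℕ → ℂ} (h : HasPhaseMatrix b E c) (m n : ℕ)
    {ζ : ℂ} (hζ : ‖ζ‖ = 1) : 0 ≤ cosDensity (ζ * c m n) ((m : ℤ) - n) ∧
      E.vecMeasure (superposition b m n ζ) =
        densityMeasure (cosDensity (ζ * c m n) ((m : ℤ) - n)) := by
  set k : ℤ := (m : ℤ) - n with hk
  set f := cosDensity (ζ * c m n) k with hf
  have hX : ∀ X, MeasurableSet X →
      (⟪superposition b m n ζ, E.effect X (superposition b m n ζ)⟫_ℂ).re =
        ∫ z in X, f z ∂circleMeasure := by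
    intro X hX
    have hc : ∀ j, Integrable (char j) (circleMeasure.restrict X) := fun j =>
      (integrable_char _ j)
    have e : ((∫ z in X, f z ∂circleMeasure : ℝ) : ℂ) =
        ⟪superposition b m n ζ, E.effect X (superposition b m n ζ)⟫_ℂ := by
      rw [inner_superposition b m n hζ, inner_effect_conj hX m n]
      have h' := hasPhaseMatrix_iff.1 h X hX
      rw [h' m m, h' n n, h' m n, h.self_eq_one, h.self_eq_one, ← integral_complex_ofReal]
      simp_rw [hf, ofReal_cosDensity]
      rw [integral_add_mul_add_mul (integrable_const _) (hc k) (hc (-k))]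
      have e0 : ∀ j : ℕ, ∫ z in X, char ((j : ℤ) - j) z ∂circleMeasure =
          ∫ z in X, (1 : ℂ) ∂circleMeasure := fun j => by simp_rw [sub_self, char_zero]
      simp_rw [e0, char_neg, integral_conj, ← hk, map_mul]
      ring
    rw [← e, Complex.ofReal_re]
  have hint : Integrable f circleMeasure := integrable_continuousMap f
  have h0 : 0 ≤ f := by
    -- Positivity of the effects gives nonnegative integrals over all measurable sets, hence `f ≥ 0`
    -- almost everywhere; continuity and full support remove the exception.
    have h1 : 0 ≤ᵐ[circleMeasure] f :=
      ae_nonneg_of_forall_setIntegral_nonneg hint fun X hXm _ => by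
        rw [← hX X hXm]; exact E.inner_nonneg hXm _
    have h2 : (f : Circle → ℝ) =ᵐ[circleMeasure] fun z => max (f z) 0 := by
      filter_upwards [h1] with z hz
      exact (max_eq_left hz).symm
    have h3 := (f.continuous.ae_eq_iff_eq circleMeasure
      (f.continuous.max continuous_const)).1 h2
    refine ContinuousMap.le_def.2 fun z => ?_
    rw [congrFun h3 z]
    exact le_max_right _ _
  refine ⟨h0, ?_⟩
  ext X hXm
  rw [E.vecMeasure_apply _ hXm, hX X hXm, densityMeasure, withDensity_apply _ hXm,
    ofReal_integral_eq_lintegral_ofReal hint.integrableOn (ae_of_all _ (nonneg_apply h0))]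

/-- With `ζ` opposite to the phase of `c m n`, the density at the point 1 is `1 - ‖c m n‖`, which
must be nonnegative. -/
theorem HasPhaseMatrix.norm_le_one {b : HilbertBasis ℕ ℂ H}
    {E : Observable Circle H} {c : ℕ → ℕ → ℂ} (h : HasPhaseMatrix b E c) (m n : ℕ) :
    ‖c m n‖ ≤ 1 := by
  rcases eq_or_ne (c m n) 0 with h0 | h0
  · simp [h0]
  · have hn : (‖c m n‖ : ℂ) ≠ 0 := by simpa using h0
    have hζ : ‖(-(conj (c m n) / ‖c m n‖) : ℂ)‖ = 1 := by simp [h0]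
    have h1 := nonneg_apply (h.vecMeasure_superposition m n hζ).1 1
    have e : -(conj (c m n) / ‖c m n‖) * c m n = ((-‖c m n‖ : ℝ) : ℂ) := by
      have := Complex.conj_mul' (c m n)
      push_cast
      field_simp
      linear_combination -this
    change 0 ≤ 1 + (-(conj (c m n) / ‖c m n‖) * c m n * char _ 1).re at h1
    rw [e, char_one_right, mul_one, Complex.ofReal_re] at h1
    linarith

theorem exists_setIntegral_char_ne_zero (k : ℤ) :
    ∃ X, MeasurableSet X ∧ ∫ z in X, char k z ∂circleMeasure ≠ 0 := by
  by_contra! h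
  have h1 := (integrable_char circleMeasure k).ae_eq_zero_of_forall_setIntegral_eq_zero
    fun X hX _ => h X hX
  have h2 := ((char k).continuous.ae_eq_iff_eq circleMeasure continuous_const).1 h1
  have h3 := norm_char k 1
  rw [congrFun h2 1] at h3
  exact zero_ne_one (norm_zero.symm.trans h3)

theorem HasPhaseMatrix.conj_symm {b : HilbertBasis ℕ ℂ H}
    {E : Observable Circle H} {c : ℕ → ℕ → ℂ} (h : HasPhaseMatrix b E c) (m n : ℕ) :
    c m n = conj (c n m) := by
  obtain ⟨X, hX, h0⟩ := exists_setIntegral_char_ne_zero ((m : ℤ) - n)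
  have h1 := inner_effect_conj (E := E) (b := b) hX n m
  have h' := hasPhaseMatrix_iff.1 h X hX
  have e : conj (∫ z in X, char ((n : ℤ) - m) z ∂circleMeasure) =
      ∫ z in X, char ((m : ℤ) - n) z ∂circleMeasure := by
    rw [← integral_conj]
    refine integral_congr_ae (ae_of_all _ fun z => ?_)
    rw [← neg_sub (n : ℤ), char_neg]
  rw [h' m n, h' n m, map_mul, e] at h1
  exact mul_right_cancel₀ h0 h1

/-- Postprocessing multiplies the diagonals of the phase matrix by constants. -/
theorem HasPhaseMatrix.eq_mul_of_affine {b : HilbertBasis ℕ ℂ H} {E F : Observable Circle H}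
    {c d : ℕ → ℕ → ℂ} (hE : HasPhaseMatrix b E c) (hF : HasPhaseMatrix b F d)
    {Ψ : ProbabilityMeasure Circle → ProbabilityMeasure Circle}
    (hΘ : Theta b E = Ψ ∘ Theta b F) {m n : ℕ} (hmn : m ≠ n) {K : C(Circle, ℂ) →ₗ[ℂ] ℂ}
    (hK : ∀ (f : C(Circle, ℝ)) (h : C(Circle, ℂ)) (p : ProbabilityMeasure Circle), 0 ≤ f →
      (∀ z, h z = f z) → (p : Measure Circle) = densityMeasure f →
        ∫ z, char (-((m : ℤ) - n)) z ∂(Ψ p : Measure Circle) = K h) :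
    c m n = d m n * K (char ((m : ℤ) - n)) := by
  set k : ℤ := (m : ℤ) - n with hk
  have hk0 : k ≠ 0 := by omega
  -- The coefficient at `-k` of the outcome distribution of `E` is `ζ c m n / 2`, because `k ≠ 0`.
  -- Linearity of `K` evaluates the same number from the three characters in the density of `F`.
  have key : ∀ ζ : ℂ, ‖ζ‖ = 1 → ζ * c m n / 2 = K (char 0) + (ζ * d m n / 2 * K (char k) +
      conj (ζ * d m n) / 2 * K (char (-k))) := by
    intro ζ hζ
    obtain ⟨hf0, hf⟩ := hF.vecMeasure_superposition m n hζ
    obtain ⟨he0, he⟩ := hE.vecMeasure_superposition m n hζ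
    rw [← hk] at hf0 hf he0 he
    set ρ := pureState b (superposition b m n ζ) (norm_superposition b hmn hζ)
    have h1 := hK (cosDensity (ζ * d m n) k)
      (char 0 + ((ζ * d m n / 2) • char k + (conj (ζ * d m n) / 2) • char (-k)))
      (Theta b F ρ) hf0 (fun z => by
        rw [ofReal_cosDensity]
        simp only [ContinuousMap.add_apply, ContinuousMap.smul_apply, smul_eq_mul, char_zero])
      ((outcomeMeasure_pureState b _ _ F).trans hf)
    have h2 : Ψ (Theta b F ρ) = Theta b E ρ := (congrFun hΘ ρ).symm
    have h3 : (Theta b E ρ : Measure Circle) = densityMeasure (cosDensity (ζ * c m n) k) :=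
      (outcomeMeasure_pureState b _ _ E).trans he
    rw [h2, h3, integral_densityMeasure _ he0] at h1
    simp only [map_add, map_smul, smul_eq_mul] at h1
    rw [← h1]
    have hi : ∀ j, Integrable (char j) circleMeasure := integrable_char _
    have e : ∀ z, (cosDensity (ζ * c m n) k z : ℂ) * char (-k) z = char (-k) z +
        (ζ * c m n / 2 * char 0 z + conj (ζ * c m n) / 2 * char (-k + -k) z) := by
      intro z
      rw [ofReal_cosDensity, char_add, ← add_neg_cancel k, char_add]; ring
    simp_rw [e]
    rw [integral_add_mul_add_mul (hi _) (hi _) (hi _), integral_char, integral_char, integral_char, if_neg (by omega),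
      if_pos rfl, if_neg (by omega)]
    ring
  have k1 := key 1 (by simp)
  have k2 := key (-1) (by simp)
  have k3 := key Complex.I (by simp)
  have k4 := key (-Complex.I) (by simp)
  simp only [map_mul, map_neg, map_one, Complex.conj_I] at k1 k2 k3 k4
  -- Differences between `ζ` and `-ζ` remove `K (char 0)`; combining `ζ = 1` with `ζ = I` separates
  -- the part linear in `ζ` from the antilinear one.
  linear_combination (1 / 2 : ℂ) * (k1 - k2) - Complex.I / 2 * (k3 - k4) +
    (c m n / 2 - d m n * K (char k) / 2 +
      conj (d m n) * K (char (-k)) / 2) * Complex.I_sq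

end

/-! ### Averaging over roots of unity -/

theorem char_pow (k : ℤ) (w : Circle) (j : ℕ) : char k (w ^ j) = char k w ^ j := by
  rw [char_apply, char_apply, ← Circle.coe_pow, ← zpow_natCast, ← zpow_natCast, zpow_comm]

theorem sum_char_root {M : ℕ} (hM : 0 < M) {k : ℤ} (hk : |k| < M) :
    ∑ j ∈ Finset.range M, char k (Circle.exp (2 * Real.pi / M) ^ j) =
      if k = 0 then (M : ℂ) else 0 := by
  have hM' : (M : ℝ) ≠ 0 := by positivity
  split_ifs with h0
  · simp [h0, char_zero]
  · simp_rw [char_pow]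
    have h1 : char k (Circle.exp (2 * Real.pi / M)) ^ M = 1 := by
      rw [← char_pow, ← Circle.exp_nsmul, nsmul_eq_mul, mul_div_cancel₀ _ hM', Circle.exp_two_pi,
        char_one_right]
    have h2 : char k (Circle.exp (2 * Real.pi / M)) ≠ 1 := by
      intro h
      rw [char_apply, ← Circle.exp_zsmul, ← Circle.coe_one, Circle.coe_inj, ← Circle.exp_zero,
        Circle.exp_eq_exp] at h
      obtain ⟨m, hm⟩ := h
      have h3 : (k : ℝ) = m * M := by
        rw [zsmul_eq_mul] at hm
        field_simp at hm
        have h4 : (2 * Real.pi) * (k : ℝ) = (2 * Real.pi) * (m * M) := by linear_combination hm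
        exact mul_left_cancel₀ Real.two_pi_pos.ne' h4
      have h4 : k = m * M := by exact_mod_cast h3
      have h5 : m ≠ 0 := by rintro rfl; exact h0 (by simpa using h4)
      rw [h4, abs_mul, Nat.abs_cast] at hk
      have h6 : 1 ≤ |m| := Int.one_le_abs h5
      nlinarith
    have h3 := mul_geom_sum (char k (Circle.exp (2 * Real.pi / M))) M
    rw [h1, sub_self] at h3
    exact (mul_eq_zero.1 h3).resolve_left (sub_ne_zero.2 h2)

/-- The Fejér kernel, rotated by `w`. -/
def fejer (N : ℕ) (w : Circle) : C(Circle, ℝ) where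
  toFun z := (N : ℝ)⁻¹ * ‖∑ j ∈ Finset.range N, char j (w * z)‖ ^ 2
  continuous_toFun := by fun_prop

theorem fejer_nonneg (N : ℕ) (w : Circle) : 0 ≤ fejer N w :=
  ContinuousMap.le_def.2 fun z => by
    change 0 ≤ (N : ℝ)⁻¹ * ‖∑ j ∈ Finset.range N, char j (w * z)‖ ^ 2
    positivity

/-- The Fourier expansion of the Fejér kernel. -/
def fejerExpansion (N : ℕ) (w : Circle) : C(Circle, ℂ) :=
  (N : ℂ)⁻¹ • ∑ i ∈ Finset.range N, ∑ j ∈ Finset.range N,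
    char ((i : ℤ) - j) w • char ((i : ℤ) - j)

theorem fejerExpansion_apply (N : ℕ) (w z : Circle) : fejerExpansion N w z = fejer N w z := by
  change _ = (((N : ℝ)⁻¹ * ‖∑ j ∈ Finset.range N, char j (w * z)‖ ^ 2 : ℝ) : ℂ)
  push_cast
  rw [← Complex.mul_conj', map_sum, Finset.sum_mul_sum]
  simp only [fejerExpansion, ContinuousMap.smul_apply, ContinuousMap.coe_sum, Finset.sum_apply,
    smul_eq_mul]
  congr 1
  refine Finset.sum_congr rfl fun i _ => Finset.sum_congr rfl fun j _ => ?_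
  rw [← char_mul, ← char_neg, ← char_add, sub_eq_add_neg]

theorem sum_range_ite_sub_eq (N k : ℕ) (x : ℂ) :
    ∑ i ∈ Finset.range N, ∑ j ∈ Finset.range N, (if (i : ℤ) - j - k = 0 then x else 0) =
      ((N - k : ℕ) : ℂ) * x := by
  rw [Finset.sum_comm]
  have h : ∀ j ∈ Finset.range N, ∑ i ∈ Finset.range N, (if (i : ℤ) - j - k = 0 then x else 0) =
      if j + k < N then x else 0 := by
    intro j _
    have e : ∀ i : ℕ, ((i : ℤ) - j - k = 0) ↔ i = j + k := fun i => by omega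
    simp_rw [e]
    rw [Finset.sum_ite_eq']
    simp
  rw [Finset.sum_congr rfl h, ← Finset.sum_filter]
  have e : (Finset.range N).filter (fun j => j + k < N) = Finset.range (N - k) := by
    ext j
    simp only [Finset.mem_filter, Finset.mem_range]
    omega
  rw [e, Finset.sum_const, Finset.card_range, nsmul_eq_mul]

theorem circleIntegral_fejer {N : ℕ} (hN : 0 < N) (w : Circle) :
    circleIntegral (fejer N w) = 1 := by
  have h : ((circleIntegral (fejer N w) : ℝ) : ℂ) = 1 := by
    rw [circleIntegral_apply, ← integral_complex_ofReal]
    simp_rw [← fejerExpansion_apply]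
    simp only [fejerExpansion, ContinuousMap.smul_apply, ContinuousMap.coe_sum, Finset.sum_apply,
      smul_eq_mul]
    rw [integral_const_mul, integral_finsetSum _ fun i _ =>
      integrable_finsetSum _ fun j _ => (integrable_char _ _).const_mul _]
    simp_rw [integral_finsetSum (Finset.range N) fun j _ =>
      (integrable_char circleMeasure _).const_mul _, integral_const_mul, integral_char]
    have e : ∀ i j : ℕ, char ((i : ℤ) - j) w * (if (i : ℤ) - j = 0 then 1 else 0) =
        if (i : ℤ) - j - (0 : ℕ) = 0 then 1 else 0 := by
      intro i j
      by_cases hij : (i : ℤ) - j = 0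
      · simp [hij, char_zero]
      · simp [hij]
    simp_rw [e]
    rw [sum_range_ite_sub_eq, Nat.sub_zero, mul_one]
    exact inv_mul_cancel₀ (by exact_mod_cast hN.ne')
  exact_mod_cast h

/-- Averaging an affine map over rotations yields a probability measure whose Fourier coefficients
are those of the Fejér kernel times multipliers. -/
theorem exists_average {Ψ : ProbabilityMeasure Circle → ProbabilityMeasure Circle}
    {K : ℤ → C(Circle, ℂ) →ₗ[ℂ] ℂ}
    (hK : ∀ k (f : C(Circle, ℝ)) (h : C(Circle, ℂ)) (p : ProbabilityMeasure Circle), 0 ≤ f →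
      (∀ z, h z = f z) → (p : Measure Circle) = densityMeasure f →
        ∫ z, char (-k) z ∂(Ψ p : Measure Circle) = K k h) {N : ℕ} (hN : 0 < N) :
    ∃ μ : Measure Circle, IsProbabilityMeasure μ ∧ ∀ k : ℕ, k ≤ N →
      ∫ z, char (-k) z ∂μ = (N : ℂ)⁻¹ * ((N - k : ℕ) * K k (char k)) := by
  -- For `i, j < N` and `0 ≤ k ≤ N` the frequency `i - j - k` is smaller than `2N` in modulus, so
  -- averaging over `2N`-th roots of unity isolates `i - j = k` exactly. A finite average avoids any
  -- regularity assumption on `Ψ`.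
  set M := 2 * N with hM
  have hM0 : 0 < M := by omega
  set w : ℕ → Circle := fun l => Circle.exp (2 * Real.pi / M) ^ l with hw
  set p : ℕ → ProbabilityMeasure Circle := fun l => ⟨densityMeasure (fejer N (w l)),
    isProbabilityMeasure_densityMeasure _ (fejer_nonneg N _) (circleIntegral_fejer hN _)⟩ with hp
  -- The kernel argument is multiplied by `w l` before `Ψ`, which rotates the input by the inverse
  -- of `w l`; the pushforward rotates the output by `w l`. Thus `Ψ` is conjugated by a rotation.
  -- The weight `(N - k)/N` later counts the pairs with `i - j = k`.
  set ν : ℕ → Measure Circle := fun l => Measure.map (fun z => w l * z) (Ψ (p l)) with hν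
  have hνp : ∀ l, IsProbabilityMeasure (ν l) := fun l =>
    Measure.isProbabilityMeasure_map (measurable_const_mul _).aemeasurable
  have hME : (M : ENNReal) ≠ 0 := by exact_mod_cast hM0.ne'
  refine ⟨(M : ENNReal)⁻¹ • ∑ l ∈ Finset.range M, ν l, ⟨?_⟩, fun k hk => ?_⟩
  · simp only [Measure.smul_apply, Measure.finsetSum_apply, measure_univ, Finset.sum_const,
      Finset.card_range, smul_eq_mul, nsmul_eq_mul, mul_one]
    exact ENNReal.inv_mul_cancel hME (ENNReal.natCast_ne_top M)
  · have h1 : ∀ l, ∫ z, char (-k) z ∂(ν l) = (N : ℂ)⁻¹ * ∑ i ∈ Finset.range N,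
        ∑ j ∈ Finset.range N, char ((i : ℤ) - j - k) (w l) * K k (char ((i : ℤ) - j)) := by
      intro l
      rw [hν, integral_map (measurable_const_mul _).aemeasurable
        (char _).continuous.aestronglyMeasurable]
      simp_rw [char_mul]
      rw [integral_const_mul, hK k (fejer N (w l)) (fejerExpansion N (w l)) (p l)
        (fejer_nonneg N _) (fejerExpansion_apply N _) rfl, fejerExpansion]
      simp only [map_smul, map_sum, smul_eq_mul]
      rw [mul_left_comm, Finset.mul_sum]
      congr 1
      refine Finset.sum_congr rfl fun i _ => ?_
      rw [Finset.mul_sum]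
      refine Finset.sum_congr rfl fun j _ => ?_
      rw [sub_eq_add_neg ((i : ℤ) - j), char_add]
      ring
    rw [integral_smul_measure, integral_finsetSum_measure fun l _ => integrable_char _ _,
      ENNReal.toReal_inv, ENNReal.toReal_natCast, Complex.real_smul]
    simp_rw [h1]
    rw [← Finset.mul_sum, Finset.sum_comm]
    simp_rw [Finset.sum_comm (s := Finset.range M), ← Finset.sum_mul]
    have h2 : ∀ i ∈ Finset.range N, ∀ j ∈ Finset.range N,
        (∑ l ∈ Finset.range M, char ((i : ℤ) - j - k) (w l)) * K k (char ((i : ℤ) - j)) =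
          if (i : ℤ) - j - k = 0 then (M : ℂ) * K k (char k) else 0 := by
      intro i hi j hj
      rw [Finset.mem_range] at hi hj
      rw [sum_char_root hM0 (by rw [abs_lt, hM]; push_cast; constructor <;> omega)]
      split_ifs with h
      · rw [show (i : ℤ) - j = k by omega]
      · rw [zero_mul]
    rw [Finset.sum_congr rfl fun i hi => Finset.sum_congr rfl (h2 i hi), sum_range_ite_sub_eq]
    have : (M : ℂ) ≠ 0 := by exact_mod_cast hM0.ne'
    push_cast
    field_simp

/-! ### Measures that are nearly point masses, and the resulting multipliers -/

theorem norm_pow_sub_pow_le {x y : ℂ} (hx : ‖x‖ = 1) (hy : ‖y‖ = 1) (n : ℕ) :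
    ‖x ^ n - y ^ n‖ ≤ n * ‖x - y‖ := by
  induction n with
  | zero => simp
  | succ n ih =>
    have e : x ^ (n + 1) - y ^ (n + 1) = x * (x ^ n - y ^ n) + (x - y) * y ^ n := by ring
    rw [e]
    refine (norm_add_le _ _).trans ?_
    rw [norm_mul, norm_mul, norm_pow, hx, hy, one_pow]
    push_cast
    linarith

theorem norm_integral_char_le (μ : Measure Circle) [IsProbabilityMeasure μ] (k : ℤ) :
    ‖∫ z, char k z ∂μ‖ ≤ 1 := by
  refine (norm_integral_le_integral_norm _).trans ?_
  simp [norm_char]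

/-- A probability measure whose first Fourier coefficient is almost unimodular is almost a point
mass. -/
theorem norm_integral_char_sub_pow_le (μ : Measure Circle) [IsProbabilityMeasure μ] {u : ℂ}
    (hu : ‖u‖ = 1) {ε : ℝ} (hε : 0 < ε) (h : ∫ z, char (-1) z ∂μ = (1 - ε ^ 2 : ℝ) * u) (n : ℕ) :
    ‖∫ z, char (-n) z ∂μ - u ^ n‖ ≤ n * (3 / 2 * ε) := by
  have hi := integrable_char μ
  have hsq : ∀ z, ‖char (-1) z - u‖ ^ 2 = 2 - 2 * (conj u * char (-1) z).re := by
    intro z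
    have h1 := norm_sub_sq_real (char (-1) z) u
    rw [norm_char, hu, Complex.inner] at h1
    rw [h1]
    simp only [Complex.mul_re, Complex.conj_re, Complex.conj_im]
    ring
  have hc : Continuous fun z => ‖char (-1) z - u‖ := by fun_prop
  have hint1 : Integrable (fun z => ‖char (-1) z - u‖) μ := ((hi _).sub (integrable_const u)).norm
  have hintc : Integrable (fun z => conj u * char (-1) z) μ := (hi (-1)).const_mul (conj u)
  have hint3 : Integrable (fun z => (conj u * char (-1) z).re) μ := hintc.re
  have hint2 : Integrable (fun z => ‖char (-1) z - u‖ ^ 2) μ := by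
    simp_rw [hsq]
    exact (integrable_const _).sub (hint3.const_mul 2)
  have hvar : ∫ z, ‖char (-1) z - u‖ ^ 2 ∂μ = 2 * ε ^ 2 := by
    simp_rw [hsq]
    rw [integral_sub (integrable_const _) (hint3.const_mul 2), integral_const_mul]
    have e : ∫ z, (conj u * char (-1) z).re ∂μ = 1 - ε ^ 2 := by
      have h2 : ∫ z, (conj u * char (-1) z).re ∂μ = (∫ z, conj u * char (-1) z ∂μ).re :=
        integral_re hintc
      rw [h2, integral_const_mul, h]
      have h3 : conj u * ((1 - ε ^ 2 : ℝ) * u) = ((1 - ε ^ 2 : ℝ) : ℂ) := by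
        have := Complex.conj_mul' u
        rw [hu, Complex.ofReal_one, one_pow] at this
        linear_combination ((1 - ε ^ 2 : ℝ) : ℂ) * this
      rw [h3, Complex.ofReal_re]
    rw [e]
    simp
    ring
  -- In place of Cauchy–Schwarz, `x ≤ ε/2 + x²/(2ε)` is integrated; the second moment `2 ε²` gives
  -- `ε/2 + ε`.
  have h1 : ∫ z, ‖char (-1) z - u‖ ∂μ ≤ 3 / 2 * ε := by
    have h2 : ∫ z, ‖char (-1) z - u‖ ∂μ ≤
        ∫ z, (ε / 2 + (2 * ε)⁻¹ * ‖char (-1) z - u‖ ^ 2) ∂μ := by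
      refine integral_mono hint1 ((integrable_const _).add (hint2.const_mul _)) fun z => ?_
      change ‖char (-1) z - u‖ ≤ ε / 2 + (2 * ε)⁻¹ * ‖char (-1) z - u‖ ^ 2
      have e : ε / 2 + (2 * ε)⁻¹ * ‖char (-1) z - u‖ ^ 2 - ‖char (-1) z - u‖ =
          (2 * ε)⁻¹ * (‖char (-1) z - u‖ - ε) ^ 2 := by
        field_simp; ring
      have : 0 ≤ (2 * ε)⁻¹ * (‖char (-1) z - u‖ - ε) ^ 2 := by positivity
      linarith
    rw [integral_add (integrable_const _) (hint2.const_mul _), integral_const_mul, hvar] at h2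
    refine h2.trans (le_of_eq ?_)
    simp
    field_simp
    ring
  have e : ∫ z, char (-n) z ∂μ - u ^ n = ∫ z, (char (-n) z - u ^ n) ∂μ := by
    rw [integral_sub (hi _) (integrable_const _)]; simp
  rw [e]
  refine (norm_integral_le_integral_norm _).trans ?_
  have h3 : ∀ z, ‖char (-n) z - u ^ n‖ ≤ n * ‖char (-1) z - u‖ := by
    intro z
    have e : char (-n) z = char (-1) z ^ n := by
      rw [char_neg, char_neg, ← map_pow, char_natCast]
      simp [char_apply]
    rw [e]
    exact norm_pow_sub_pow_le (norm_char _ _) hu n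
  refine (integral_mono ((hi _).sub (integrable_const _)).norm (hint1.const_mul _) h3).trans ?_
  rw [integral_const_mul]
  exact mul_le_mul_of_nonneg_left h1 n.cast_nonneg

/-- The bound 1 on Fourier coefficients, as `N → ∞`, gives `‖a 1‖ ≤ 1`. With equality, the first
coefficient is `(1 - 1/N) a 1`, so the near-point-mass estimate with `ε = 1/√N` forces the other
coefficients to powers of `a 1` in the limit. -/
theorem multiplier_eq_pow {a : ℕ → ℂ}
    (h : ∀ N : ℕ, 0 < N → ∃ μ : Measure Circle, IsProbabilityMeasure μ ∧ ∀ k : ℕ, k ≤ N →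
      ∫ z, char (-k) z ∂μ = (N : ℂ)⁻¹ * ((N - k : ℕ) * a k))
    (h1 : 1 ≤ ‖a 1‖) : ‖a 1‖ = 1 ∧ ∀ k, a k = a 1 ^ k := by
  have hsub : ∀ N k : ℕ, 0 < N → k ≤ N →
      (N : ℂ)⁻¹ * ((N - k : ℕ) * a k) = (1 - k / N : ℝ) * a k := by
    intro N k hN hk
    have : (N : ℂ) ≠ 0 := by exact_mod_cast hN.ne'
    rw [Nat.cast_sub hk]
    push_cast
    field_simp
  have hlim : ∀ k : ℕ, Tendsto (fun N : ℕ => (1 - k / N : ℝ)) atTop (𝓝 1) := by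
    intro k
    have := (tendsto_const_nhds (x := (1 : ℝ))).sub
      (tendsto_const_div_atTop_nhds_zero_nat (k : ℝ))
    simpa using this
  have hle : ‖a 1‖ ≤ 1 := by
    have h2 : Tendsto (fun N : ℕ => (1 - (1 : ℕ) / N : ℝ) * ‖a 1‖) atTop (𝓝 (1 * ‖a 1‖)) :=
      (hlim 1).mul_const _
    rw [one_mul] at h2
    refine le_of_tendsto h2 (eventually_atTop.2 ⟨1, fun N hN => ?_⟩)
    obtain ⟨μ, hμ, hm⟩ := h N hN
    have h3 := hm 1 hN
    rw [hsub N 1 hN hN] at h3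
    have h4 := norm_integral_char_le μ (-(1 : ℕ))
    rw [h3, norm_mul, Complex.norm_real, Real.norm_eq_abs] at h4
    exact (mul_le_mul_of_nonneg_right (le_abs_self _) (norm_nonneg _)).trans h4
  have hu : ‖a 1‖ = 1 := le_antisymm hle h1
  refine ⟨hu, fun k => ?_⟩
  have h2 : Tendsto (fun N : ℕ => ‖((1 - k / N : ℝ) : ℂ) * a k - a 1 ^ k‖) atTop
      (𝓝 ‖a k - a 1 ^ k‖) := by
    have h3 : Tendsto (fun N : ℕ => ((1 - k / N : ℝ) : ℂ) * a k - a 1 ^ k) atTop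
        (𝓝 (((1 : ℝ) : ℂ) * a k - a 1 ^ k)) :=
      (((Complex.continuous_ofReal.tendsto _).comp (hlim k)).mul_const _).sub_const _
    rw [Complex.ofReal_one, one_mul] at h3
    exact h3.norm
  have h3 : Tendsto (fun N : ℕ => (k : ℝ) * (3 / 2 * (√(N : ℝ))⁻¹)) atTop (𝓝 0) := by
    have h4 : Tendsto (fun N : ℕ => (√(N : ℝ))⁻¹) atTop (𝓝 0) :=
      (Real.tendsto_sqrt_atTop.comp tendsto_natCast_atTop_atTop).inv_tendsto_atTop
    simpa using (h4.const_mul (3 / 2)).const_mul (k : ℝ)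
  have h4 : ‖a k - a 1 ^ k‖ ≤ 0 := by
    refine le_of_tendsto_of_tendsto h2 h3 (eventually_atTop.2 ⟨k + 1, fun N hN => ?_⟩)
    obtain ⟨μ, hμ, hm⟩ := h N (by omega)
    have hk := hm k (by omega)
    have h1' := hm 1 (by omega)
    rw [hsub N k (by omega) (by omega)] at hk
    rw [hsub N 1 (by omega) (by omega)] at h1'
    have hN0 : (0 : ℝ) < N := by exact_mod_cast (by omega : 0 < N)
    have h5 := norm_integral_char_sub_pow_le μ hu (ε := (√(N : ℝ))⁻¹)
      (inv_pos.2 (Real.sqrt_pos.2 hN0)) (by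
        rw [inv_pow, Real.sq_sqrt hN0.le, ← one_div]
        simpa using h1') k
    rw [hk] at h5
    exact h5
  exact sub_eq_zero.1 (norm_le_zero_iff.1 h4)

section

variable {H : Type*} [NormedAddCommGroup H] [InnerProductSpace ℂ H] [CompleteSpace H]

/-- If the phase matrix of a postprocessing of `F` tends to `1` next to the diagonal, then the
postprocessing is a rotation. -/
theorem IsPostprocessing.exists_rotation {b : HilbertBasis ℕ ℂ H} {E F : Observable Circle H}
    {c d : ℕ → ℕ → ℂ} (hE : HasPhaseMatrix b E c) (hF : HasPhaseMatrix b F d)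
    (h : IsPostprocessing b E F) (hc : Tendsto (fun n => c (n + 1) n) atTop (𝓝 1)) :
    ∃ t : Circle, ∀ m n, c m n = d m n * char ((m : ℤ) - n) t := by
  obtain ⟨Ψ, hΨ, hΘ⟩ := h
  -- The multiplier at `k` comes from the coefficient at `-k`, since the integral of `z^(-k)`
  -- against the measure reads off the amplitude of `z^k` in its density.
  choose K hK using fun k : ℤ => hΨ.exists_linear (-k)
  have hmul : ∀ m n : ℕ, m ≠ n → c m n = d m n * K ((m : ℤ) - n) (char ((m : ℤ) - n)) :=
    fun m n hmn => hE.eq_mul_of_affine hF hΘ hmn (hK _)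
  have h1 : 1 ≤ ‖K (1 : ℕ) (char (1 : ℕ))‖ := by
    have h2 : Tendsto (fun n => ‖c (n + 1) n‖) atTop (𝓝 1) := by simpa using hc.norm
    refine le_of_tendsto h2 (Eventually.of_forall fun n => ?_)
    rw [hmul (n + 1) n (by omega), norm_mul, show ((n + 1 : ℕ) : ℤ) - n = (1 : ℕ) by
      push_cast; ring]
    exact mul_le_of_le_one_left (norm_nonneg _) (hF.norm_le_one _ _)
  obtain ⟨hu, ha⟩ := multiplier_eq_pow (a := fun k : ℕ => K k (char k))
    (fun N hN => exists_average hK hN) h1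
  set t : Circle := ⟨_, mem_sphere_zero_iff_norm.2 hu⟩
  have hlow : ∀ m n : ℕ, n < m → c m n = d m n * char ((m : ℤ) - n) t := by
    intro m n hmn
    obtain ⟨j, rfl⟩ := Nat.exists_eq_add_of_lt hmn
    rw [hmul _ n (by omega), show ((n + j + 1 : ℕ) : ℤ) - n = ((j + 1 : ℕ) : ℤ) by
      push_cast; ring, ha (j + 1), char_natCast]
  refine ⟨t, fun m n => ?_⟩
  rcases lt_trichotomy n m with hmn | rfl | hmn
  · exact hlow m n hmn
  · rw [hE.self_eq_one, hF.self_eq_one, sub_self, char_zero, one_mul]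
  · rw [hE.conj_symm, hF.conj_symm, hlow n m hmn, map_mul, ← char_neg, neg_sub]

end

/-! ### Observables from isometries into L² spaces -/

section

variable {H : Type*} [NormedAddCommGroup H] [InnerProductSpace ℂ H] [CompleteSpace H]

/-- A Naimark dilation: the effect is the compression by `V` of multiplication by the indicator of
`α ⁻¹' X`. Written as `R* R`, with `R` restricting to that set, it is visibly positive, and the
complementary effect is of the same kind. -/
theorem exists_observable_of_isometry {Z Ω : Type*} [MeasurableSpace Z] [MeasurableSpace Ω]
    {M : Measure Z} (V : H →ₗᵢ[ℂ] Lp ℂ 2 M) {α : Z → Ω} (hα : Measurable α) :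
    ∃ E : Observable Ω H, ∀ X, MeasurableSet X → ∀ u v : H,
      ⟪u, E.effect X v⟫_ℂ = ∫ z in α ⁻¹' X, ⟪V u z, V v z⟫_ℂ ∂M := by
  set R : (X : Set Ω) → (H →L[ℂ] Lp ℂ 2 (M.restrict (α ⁻¹' X))) := fun X =>
    (LpToLpRestrictCLM Z ℂ ℂ M 2 (α ⁻¹' X)) ∘L V.toContinuousLinearMap with hR
  set E : Set Ω → (H →L[ℂ] H) := fun X => (R X).adjoint ∘L R X with hE
  have hinner : ∀ X, ∀ u v : H, ⟪u, E X v⟫_ℂ = ∫ z in α ⁻¹' X, ⟪V u z, V v z⟫_ℂ ∂M := by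
    intro X u v
    rw [hE, ContinuousLinearMap.comp_apply, ContinuousLinearMap.adjoint_inner_right, L2.inner_def]
    refine integral_congr_ae ?_
    filter_upwards [LpToLpRestrictCLM_coeFn ℂ (α ⁻¹' X) (V u),
      LpToLpRestrictCLM_coeFn ℂ (α ⁻¹' X) (V v)] with z h1 h2
    have e : ∀ w, R X w = LpToLpRestrictCLM Z ℂ ℂ M 2 (α ⁻¹' X) (V w) := fun w => rfl
    rw [e, e, h1, h2]
  have hpos : ∀ X, 0 ≤ E X := fun X => by
    rw [ContinuousLinearMap.nonneg_iff_isPositive]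
    exact ContinuousLinearMap.isPositive_adjoint_comp_self _
  have hint : ∀ u v, Integrable (fun z => ⟪V u z, V v z⟫_ℂ) M := fun u v =>
    L2.integrable_inner (V u) (V v)
  have huv : ∀ u v, ∫ z, ⟪V u z, V v z⟫_ℂ ∂M = ⟪u, v⟫_ℂ := fun u v => by
    rw [← L2.inner_def, V.inner_map_map]
  refine ⟨⟨E, fun X _ => hpos X, fun X hX => ?_, ?_, fun X hX hd u v => ?_⟩,
    fun X _ => hinner X⟩
  · have e : 1 - E X = E Xᶜ := by
      ext v
      refine ext_inner_left ℂ fun u => ?_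
      rw [sub_apply, inner_sub_right, one_apply_eq_self, hinner, hinner,
        Set.preimage_compl, ← huv u v, ← integral_add_compl (hα hX) (hint u v)]
      ring
    rw [← sub_nonneg, e]
    exact hpos _
  · ext v
    refine ext_inner_left ℂ fun u => ?_
    rw [hinner, Set.preimage_univ, setIntegral_univ, huv, one_apply_eq_self]
  · simp only [hinner, Set.preimage_iUnion]
    exact hasSum_integral_iUnion (fun i => hα (hX i))
      (fun i j hij => (hd hij).preimage α) (hint u v).integrableOn

/-- The isometry sending the `n`-th vector of `b` to `w n`, for an orthonormal sequence `w` in a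
Hilbert space. -/
def isometryInto {L : Type*} [NormedAddCommGroup L] [InnerProductSpace ℂ L] [CompleteSpace L]
    (b : HilbertBasis ℕ ℂ H) (w : ℕ → L) (hw : Orthonormal ℂ w) : H →ₗᵢ[ℂ] L :=
  hw.orthogonalFamily.linearIsometry.comp b.repr.toLinearIsometry

theorem isometryInto_apply {L : Type*} [NormedAddCommGroup L] [InnerProductSpace ℂ L]
    [CompleteSpace L] (b : HilbertBasis ℕ ℂ H) (w : ℕ → L) (hw : Orthonormal ℂ w) (n : ℕ) :
    isometryInto b w hw (b n) = w n := by
  change hw.orthogonalFamily.linearIsometry (b.repr (b n)) = w n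
  rw [b.repr_self, OrthogonalFamily.linearIsometry_apply_single]
  simp

/-- Orthonormal functions define an isometry into `L²`. -/
theorem exists_isometry_of_orthonormal {Z : Type*} [MeasurableSpace Z] {M : Measure Z}
    (b : HilbertBasis ℕ ℂ H) {f : ℕ → Z → ℂ} (hf : ∀ n, AEStronglyMeasurable (f n) M)
    (hint : ∀ n, Integrable (fun z => ‖f n z‖ ^ 2) M)
    (horth : ∀ m n, ∫ z, ⟪f m z, f n z⟫_ℂ ∂M = if m = n then 1 else 0) :
    ∃ V : H →ₗᵢ[ℂ] Lp ℂ 2 M, ∀ n, V (b n) =ᵐ[M] f n := by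
  have hL : ∀ n, MemLp (f n) 2 M := fun n =>
    (memLp_two_iff_integrable_sq_norm (hf n)).2 (hint n)
  have hw : Orthonormal ℂ fun n => (hL n).toLp (f n) := by
    rw [orthonormal_iff_ite]
    intro m n
    rw [L2.inner_def, ← horth m n]
    refine integral_congr_ae ?_
    filter_upwards [(hL m).coeFn_toLp, (hL n).coeFn_toLp] with z h1 h2
    rw [h1, h2]
  refine ⟨isometryInto b _ hw, fun n => ?_⟩
  rw [isometryInto_apply]
  exact (hL n).coeFn_toLp

/-- An isometry given by inner products on the basis is given by inner products everywhere. -/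
theorem isometry_ae_eq_inner {Z : Type*} [MeasurableSpace Z] {M : Measure Z}
    (b : HilbertBasis ℕ ℂ H) (V : H →ₗᵢ[ℂ] Lp ℂ 2 M) (W : Z → H)
    (h : ∀ n, V (b n) =ᵐ[M] fun z => ⟪W z, b n⟫_ℂ) (u : H) :
    V u =ᵐ[M] fun z => ⟪W z, u⟫_ℂ := by
  set s : ℕ → H := fun N => ∑ n ∈ Finset.range N, b.repr u n • b n with hs
  have hs1 : Tendsto s atTop (𝓝 u) := (b.hasSum_repr u).tendsto_sum_nat
  have hs2 : Tendsto (fun N => V (s N)) atTop (𝓝 (V u)) := (V.continuous.tendsto u).comp hs1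
  have hs3 : ∀ N, V (s N) =ᵐ[M] fun z => ⟪W z, s N⟫_ℂ := by
    intro N
    induction N with
    | zero =>
      simp only [hs, Finset.range_zero, Finset.sum_empty, map_zero, inner_zero_right]
      exact Lp.coeFn_zero ℂ 2 M
    | succ N ih =>
      have e : s (N + 1) = s N + b.repr u N • b N := Finset.sum_range_succ _ _
      rw [e, map_add, map_smul]
      filter_upwards [Lp.coeFn_add (V (s N)) (b.repr u N • V (b N)),
        Lp.coeFn_smul (b.repr u N) (V (b N)), ih, h N] with z h1 h2 h3 h4
      rw [h1, Pi.add_apply, h2, Pi.smul_apply, h3, h4, inner_add_right, inner_smul_right,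
        smul_eq_mul]
  -- `L²` convergence gives pointwise convergence only along a subsequence. That suffices, because
  -- the inner products with `W z` converge at every `z`.
  obtain ⟨ns, hns, hae⟩ := (tendstoInMeasure_of_tendsto_Lp hs2).exists_seq_tendsto_ae
  filter_upwards [hae, ae_all_iff.2 hs3] with z h1 h2
  refine tendsto_nhds_unique h1 ?_
  simp only [h2]
  exact ((innerSL ℂ (W z)).continuous.tendsto u).comp (hs1.comp hns.tendsto_atTop)

/-! ### The canonical phase observable -/

theorem inner_eq_conj_mul (x y : ℂ) : ⟪x, y⟫_ℂ = conj x * y := by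
  rw [RCLike.inner_apply, mul_comm]

/-- The orthonormal functions `z^(-n)` identify `H` with a subspace of `L²` of the circle, and the
observable is the compressed multiplication by indicators. -/
theorem exists_isCanonicalPhase (b : HilbertBasis ℕ ℂ H) :
    ∃ E : Observable Circle H, IsCanonicalPhase b E := by
  have e : ∀ (m n : ℕ) (z : Circle), ⟪char (-m) z, char (-n) z⟫_ℂ = char ((m : ℤ) - n) z := by
    intro m n z
    rw [inner_eq_conj_mul, char_neg m, Complex.conj_conj, ← char_add, sub_eq_add_neg]
  obtain ⟨V, hV⟩ := exists_isometry_of_orthonormal (M := circleMeasure) b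
    (f := fun n => char (-n)) (fun n => (char _).continuous.aestronglyMeasurable)
    (fun n => by simp [norm_char])
    (fun m n => by
      simp_rw [e, integral_char, sub_eq_zero, Nat.cast_inj])
  obtain ⟨E, hE⟩ := exists_observable_of_isometry V measurable_id
  refine ⟨E, hasPhaseMatrix_iff.2 fun X hX m n => ?_⟩
  rw [hE X hX, Set.preimage_id, one_mul]
  refine integral_congr_ae ?_
  filter_upwards [ae_restrict_of_ae (hV m), ae_restrict_of_ae (hV n)] with z h1 h2
  rw [h1, h2, e]

end

/-! ### State generated phase observables -/

theorem hasSum_integral_count {f : ℕ → ℂ} (hf : Integrable f Measure.count) :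
    HasSum f (∫ s, f s ∂Measure.count) := by
  have h := hasSum_integral_measure (μ := fun s : ℕ => Measure.dirac s) (f := f) hf
  simp only [integral_dirac] at h
  exact h

/-- Angles in `A`, positive radii, and an index in `ℕ`. -/
def polarMeasure (A : Set ℝ) : Measure ((ℝ × ℝ) × ℕ) :=
  ((volume.restrict A).prod (volume.restrict (Set.Ioi 0))).prod Measure.count

theorem polarMeasure_argSet {X : Set Circle} (hX : MeasurableSet X) :
    (polarMeasure (Set.Ico 0 (2 * Real.pi))).restrict
      ((fun z : (ℝ × ℝ) × ℕ => Circle.exp z.1.1) ⁻¹' X) = polarMeasure (argSet X) := by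
  have e : (fun z : (ℝ × ℝ) × ℕ => Circle.exp z.1.1) ⁻¹' X =
      ((Circle.exp ⁻¹' X) ×ˢ Set.univ) ×ˢ Set.univ := by
    ext z; simp
  rw [e, polarMeasure, ← Measure.prod_restrict, ← Measure.prod_restrict, Measure.restrict_univ,
    Measure.restrict_univ, Measure.restrict_restrict (measurable_circleExp hX), ← argSet_eq]
  rfl

/-- The coefficients of the displaced number states. -/
def dispCoeff (l : ℕ → ℝ) (n : ℕ) (z : (ℝ × ℝ) × ℕ) : ℂ :=
  (√(l z.2 * z.1.2 / Real.pi) : ℂ) * (Real.exp (-z.1.2 ^ 2 / 2) *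
    conj ((Circle.exp z.1.1 : ℂ) ^ n * conj (Circle.exp z.1.1 : ℂ) ^ z.2 *
      ((radial n z.2).eval z.1.2 : ℝ)))

theorem measurable_dispCoeff (l : ℕ → ℝ) (n : ℕ) : Measurable (dispCoeff l n) := by
  refine measurable_from_prod_countable_left fun s => Continuous.measurable ?_
  have h : Continuous fun p : ℝ × ℝ => (radial n s).eval p.2 :=
    (radial n s).continuous.comp continuous_snd
  simp only [dispCoeff]
  fun_prop

/-- The radial weight of a pair of displaced number states. -/
def radialWeight (m n s : ℕ) (r : ℝ) : ℝ :=
  2 * r * Real.exp (-r ^ 2) * (radial m s * radial n s).eval r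

/-- The phases depending on the index `s` cancel, and angle and radius separate. Angular integration
therefore supplies the character and radial integration the overlap of two radial polynomials. -/
theorem inner_dispCoeff {l : ℕ → ℝ} (hl : ∀ s, 0 ≤ l s) (m n : ℕ) (z : (ℝ × ℝ) × ℕ)
    (hz : 0 < z.1.2) : ⟪dispCoeff l m z, dispCoeff l n z⟫_ℂ =
      ((2 * Real.pi : ℂ)⁻¹ * char ((m : ℤ) - n) (Circle.exp z.1.1)) *
        ((l z.2 : ℂ) * (radialWeight m n z.2 z.1.2 : ℂ)) := by
  obtain ⟨⟨θ, r⟩, s⟩ := z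
  have h1 : ((√(l s * r / Real.pi) : ℝ) : ℂ) * ((√(l s * r / Real.pi) : ℝ) : ℂ) =
      l s * r / Real.pi := by
    rw [← Complex.ofReal_mul, Real.mul_self_sqrt
      (div_nonneg (mul_nonneg (hl s) (le_of_lt hz)) Real.pi_pos.le)]
    push_cast; rfl
  have h2 : ((Real.exp (-r ^ 2 / 2) : ℝ) : ℂ) * ((Real.exp (-r ^ 2 / 2) : ℝ) : ℂ) =
      (Real.exp (-r ^ 2) : ℝ) := by
    rw [← Complex.ofReal_mul, ← Real.exp_add]
    ring_nf
  have h3 : (Circle.exp θ : ℂ) ^ s * conj (Circle.exp θ : ℂ) ^ s = 1 := by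
    rw [← mul_pow, Complex.mul_conj', Circle.norm_coe]; norm_num
  have h4 : char ((m : ℤ) - n) (Circle.exp θ) =
      (Circle.exp θ : ℂ) ^ m * conj (Circle.exp θ : ℂ) ^ n := by
    rw [sub_eq_add_neg, char_add, char_neg, char_natCast, char_natCast, map_pow]
  have hpi : (Real.pi : ℂ) ≠ 0 := Complex.ofReal_ne_zero.2 Real.pi_ne_zero
  rw [inner_eq_conj_mul, h4]
  simp only [dispCoeff, radialWeight, map_mul, map_pow, Complex.conj_conj, Complex.conj_ofReal,
    eval_mul, Complex.ofReal_mul, Complex.ofReal_ofNat]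
  set ζ : ℂ := (Circle.exp θ : ℂ)
  set q := (((radial m s).eval r : ℝ) : ℂ)
  set q' := (((radial n s).eval r : ℝ) : ℂ)
  calc _ = (((√(l s * r / Real.pi) : ℝ) : ℂ) * ((√(l s * r / Real.pi) : ℝ) : ℂ)) *
        (((Real.exp (-r ^ 2 / 2) : ℝ) : ℂ) * ((Real.exp (-r ^ 2 / 2) : ℝ) : ℂ)) *
        (ζ ^ s * conj ζ ^ s) * (ζ ^ m * conj ζ ^ n) * q * q' := by ring
    _ = _ := by
      rw [h1, h2, h3]
      field_simp

theorem integrableOn_radialWeight (m n s : ℕ) :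
    IntegrableOn (radialWeight m n s) (Set.Ioi 0) :=
  integrableOn_eval_mul_gaussian _

theorem integral_radialWeight (m n s : ℕ) :
    ∫ r in Set.Ioi (0 : ℝ), radialWeight m n s r = gaussInt (radial m s * radial n s) := rfl

theorem norm_sq_dispCoeff {l : ℕ → ℝ} (hl : ∀ s, 0 ≤ l s) (n : ℕ) (z : (ℝ × ℝ) × ℕ)
    (hz : 0 < z.1.2) : ‖dispCoeff l n z‖ ^ 2 =
      (2 * Real.pi)⁻¹ * (l z.2 * radialWeight n n z.2 z.1.2) := by
  have h := inner_dispCoeff hl n n z hz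
  rw [sub_self, char_zero, inner_self_eq_norm_sq_to_K] at h
  have h2 : ((‖dispCoeff l n z‖ ^ 2 : ℝ) : ℂ) =
      (((2 * Real.pi)⁻¹ * (l z.2 * radialWeight n n z.2 z.1.2) : ℝ) : ℂ) := by
    push_cast
    rw [mul_one] at h
    exact h
  exact_mod_cast h2

theorem integrable_norm_sq_dispCoeff {l : ℕ → ℝ} (hl : ∀ s, 0 ≤ l s) (hs : Summable l) (n : ℕ)
    {A : Set ℝ} (hA : volume A ≠ ⊤) :
    Integrable (fun z => ‖dispCoeff l n z‖ ^ 2) (polarMeasure A) := by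
  have : IsFiniteMeasure (volume.restrict A) :=
    ⟨by rw [Measure.restrict_apply_univ]; exact hA.lt_top⟩
  have hfin : ∀ s, Integrable (fun p : ℝ × ℝ => (2 * Real.pi)⁻¹ * (l s * radialWeight n n s p.2))
      ((volume.restrict A).prod (volume.restrict (Set.Ioi 0))) := fun s =>
    (((integrableOn_radialWeight n n s).comp_snd (volume.restrict A)).const_mul (l s)).const_mul _
  have hpos : ∀ᵐ p ∂((volume.restrict A).prod (volume.restrict (Set.Ioi (0 : ℝ)))), 0 < p.2 :=
    Measure.quasiMeasurePreserving_snd.ae (ae_restrict_mem measurableSet_Ioi)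
  rw [polarMeasure, integrable_prod_iff'
    ((measurable_dispCoeff l n).norm.pow_const 2).aestronglyMeasurable]
  refine ⟨ae_of_all _ fun s => (hfin s).congr ?_, ?_⟩
  · filter_upwards [hpos] with p hp
    exact (norm_sq_dispCoeff hl n (p, s) hp).symm
  · have e : ∀ s, ∫ p, ‖‖dispCoeff l n (p, s)‖ ^ 2‖
        ∂((volume.restrict A).prod (volume.restrict (Set.Ioi 0))) =
          (2 * Real.pi)⁻¹ * (l s * (volume.real A)) := by
      intro s
      have e1 : ∫ p, ‖‖dispCoeff l n (p, s)‖ ^ 2‖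
          ∂((volume.restrict A).prod (volume.restrict (Set.Ioi 0))) =
          ∫ p : ℝ × ℝ, (2 * Real.pi)⁻¹ * (l s * radialWeight n n s p.2)
            ∂((volume.restrict A).prod (volume.restrict (Set.Ioi 0))) := by
        refine integral_congr_ae ?_
        filter_upwards [hpos] with p hp
        rw [Real.norm_of_nonneg (by positivity), norm_sq_dispCoeff hl n (p, s) hp]
      rw [e1, integral_const_mul, integral_const_mul, integral_fun_snd, integral_radialWeight,
        gaussInt_radial_self, smul_eq_mul, mul_one, measureReal_restrict_apply_univ]
    simp_rw [e]
    rw [integrable_count_iff]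
    exact ((hs.mul_right _).mul_left _).norm

theorem integrable_inner_dispCoeff {l : ℕ → ℝ} (hl : ∀ s, 0 ≤ l s) (hs : Summable l) (m n : ℕ)
    {A : Set ℝ} (hA : volume A ≠ ⊤) :
    Integrable (fun z => ⟪dispCoeff l m z, dispCoeff l n z⟫_ℂ) (polarMeasure A) := by
  refine ((integrable_norm_sq_dispCoeff hl hs m hA).add
    (integrable_norm_sq_dispCoeff hl hs n hA)).mono' ?_ (ae_of_all _ fun z => ?_)
  · exact ((measurable_dispCoeff l m).inner (measurable_dispCoeff l n)).aestronglyMeasurable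
  · refine (norm_inner_le_norm _ _).trans ?_
    change _ ≤ ‖dispCoeff l m z‖ ^ 2 + ‖dispCoeff l n z‖ ^ 2
    nlinarith [sq_nonneg (‖dispCoeff l m z‖ - ‖dispCoeff l n z‖), sq_nonneg ‖dispCoeff l m z‖,
      sq_nonneg ‖dispCoeff l n z‖]

/-- The phase matrix of the phase observable generated by `∑ l s |s⟩⟨s|`. -/
def generatedMatrix (l : ℕ → ℝ) (m n : ℕ) : ℝ :=
  ∑' s, l s * gaussInt (radial m s * radial n s)

theorem summable_generatedMatrix {l : ℕ → ℝ} (hl : ∀ s, 0 ≤ l s) (hs : Summable l) (m n : ℕ) :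
    Summable fun s => l s * gaussInt (radial m s * radial n s) := by
  refine Summable.of_norm_bounded hs fun s => ?_
  rw [Real.norm_eq_abs, abs_mul, abs_of_nonneg (hl s)]
  exact mul_le_of_le_one_right (hl s) (abs_gaussInt_radial_mul_le _ _ _ _)

theorem integral_inner_dispCoeff {l : ℕ → ℝ} (hl : ∀ s, 0 ≤ l s) (hs : Summable l) (m n : ℕ)
    {A : Set ℝ} (hA : volume A ≠ ⊤) :
    ∫ z, ⟪dispCoeff l m z, dispCoeff l n z⟫_ℂ ∂polarMeasure A =
      generatedMatrix l m n *
        ((2 * Real.pi : ℂ)⁻¹ * ∫ θ in A, char ((m : ℤ) - n) (Circle.exp θ)) := by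
  have hi := integrable_inner_dispCoeff hl hs m n hA
  rw [polarMeasure] at hi ⊢
  rw [integral_prod_symm _ hi]
  have hpos : ∀ᵐ p ∂((volume.restrict A).prod (volume.restrict (Set.Ioi (0 : ℝ)))), 0 < p.2 :=
    Measure.quasiMeasurePreserving_snd.ae (ae_restrict_mem measurableSet_Ioi)
  have e : ∀ s, ∫ p, ⟪dispCoeff l m (p, s), dispCoeff l n (p, s)⟫_ℂ
      ∂((volume.restrict A).prod (volume.restrict (Set.Ioi 0))) =
      ((l s * gaussInt (radial m s * radial n s) : ℝ) : ℂ) *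
        ((2 * Real.pi : ℂ)⁻¹ * ∫ θ in A, char ((m : ℤ) - n) (Circle.exp θ)) := by
    intro s
    have e1 : ∫ p, ⟪dispCoeff l m (p, s), dispCoeff l n (p, s)⟫_ℂ
        ∂((volume.restrict A).prod (volume.restrict (Set.Ioi 0))) =
        ∫ p : ℝ × ℝ, ((2 * Real.pi : ℂ)⁻¹ * char ((m : ℤ) - n) (Circle.exp p.1)) *
          ((l s : ℂ) * (radialWeight m n s p.2 : ℂ))
          ∂((volume.restrict A).prod (volume.restrict (Set.Ioi 0))) := by
      refine integral_congr_ae ?_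
      filter_upwards [hpos] with p hp
      exact inner_dispCoeff hl m n (p, s) hp
    rw [e1, integral_prod_mul (fun θ : ℝ => (2 * Real.pi : ℂ)⁻¹ * char ((m : ℤ) - n) (Circle.exp θ))
      (fun r : ℝ => (l s : ℂ) * (radialWeight m n s r : ℂ)), integral_const_mul,
      integral_const_mul, integral_complex_ofReal, integral_radialWeight]
    push_cast
    ring
  have h1 := hasSum_integral_count hi.integral_prod_right
  have h2 : HasSum (fun s => ((l s * gaussInt (radial m s * radial n s) : ℝ) : ℂ))
      (generatedMatrix l m n : ℂ) :=
    Complex.hasSum_ofReal.2 (summable_generatedMatrix hl hs m n).hasSum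
  refine h1.unique ?_
  simp_rw [e]
  exact h2.mul_right _

section

variable {H : Type*} [NormedAddCommGroup H] [InnerProductSpace ℂ H] [CompleteSpace H]

theorem shiftOp_apply (b : HilbertBasis ℕ ℂ H) (z : ℂ) (s : ℕ) :
    shiftOp b z (b s) = shiftVector b z s :=
  isometryOfOrthonormal_apply b _ (orthonormal_shiftVector b z) s

theorem hasSum_inner_generated (b : HilbertBasis ℕ ℂ H) {T : H →L[ℂ] H} {l : ℕ → ℝ}
    (hT : ∀ v, HasSum (fun n => (l n : ℂ) • ⟪b n, v⟫_ℂ • b n) (T v)) (D : H →L[ℂ] H) (u v : H) :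
    HasSum (fun s => (l s : ℂ) * (⟪u, D (b s)⟫_ℂ * ⟪D (b s), v⟫_ℂ))
      ⟪u, (D ∘L T ∘L D.adjoint) v⟫_ℂ := by
  have h := (innerSL ℂ (D.adjoint u)).hasSum (hT (D.adjoint v))
  simp only [innerSL_apply_apply, ContinuousLinearMap.adjoint_inner_left] at h
  refine HasSum.congr_fun h fun s => ?_
  simp only [map_smul, inner_smul_right, ContinuousLinearMap.adjoint_inner_right]
  ring

/-- Dilation on angle, radius and eigenvalue index. The coordinates of the weighted displaced number
states are orthonormal: angular integration handles distinct indices, and the normalization of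
`radial` with `∑ l s = 1` handles equal ones. This yields `E_T(𝕋) = 1`; the weak integral formula
follows by Fubini. -/
theorem exists_isGeneratedBy (b : HilbertBasis ℕ ℂ H) {T : H →L[ℂ] H} {l : ℕ → ℝ}
    (hl : ∀ n, 0 ≤ l n) (hsum : HasSum l 1)
    (hT : ∀ v, HasSum (fun n => (l n : ℂ) • ⟪b n, v⟫_ℂ • b n) (T v)) :
    ∃ E : Observable Circle H, IsGeneratedBy b T E ∧
      HasPhaseMatrix b E fun m n => (generatedMatrix l m n : ℂ) := by
  have hvol : ∀ X, volume (argSet X) ≠ ⊤ := fun X =>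
    ((measure_mono fun θ hθ => hθ.1).trans_lt measure_Ico_lt_top).ne
  have hIco : Set.Ico 0 (2 * Real.pi) = argSet Set.univ := by
    rw [argSet_eq, Set.preimage_univ, Set.univ_inter]
  have hint : ∀ X, MeasurableSet X → ∀ m n,
      ∫ z, ⟪dispCoeff l m z, dispCoeff l n z⟫_ℂ ∂polarMeasure (argSet X) =
        generatedMatrix l m n * ∫ z in X, char ((m : ℤ) - n) z ∂circleMeasure := by
    intro X hX m n
    rw [integral_inner_dispCoeff hl hsum.summable m n (hvol X),
      setIntegral_circleMeasure hX (char _).continuous.measurable]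
  obtain ⟨V, hV⟩ := exists_isometry_of_orthonormal (M := polarMeasure (argSet Set.univ)) b
    (f := dispCoeff l) (fun n => (measurable_dispCoeff l n).aestronglyMeasurable)
    (fun n => integrable_norm_sq_dispCoeff hl hsum.summable n (hvol _))
    (fun m n => by
      rw [hint _ MeasurableSet.univ, setIntegral_univ, integral_char]
      by_cases hmn : m = n
      · subst hmn
        simp [generatedMatrix, gaussInt_radial_self, hsum.tsum_eq]
      · rw [if_neg (by omega), if_neg hmn, mul_zero])
  have hα : Measurable fun z : (ℝ × ℝ) × ℕ => Circle.exp z.1.1 :=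
    measurable_circleExp.comp (measurable_fst.comp measurable_fst)
  obtain ⟨E, hE⟩ := exists_observable_of_isometry V hα
  have hrestr : ∀ X, MeasurableSet X → (polarMeasure (argSet Set.univ)).restrict
      ((fun z : (ℝ × ℝ) × ℕ => Circle.exp z.1.1) ⁻¹' X) = polarMeasure (argSet X) := by
    intro X hX
    rw [← hIco, polarMeasure_argSet hX]
  choose κ hκ1 hκ using fun p : ℝ × ℝ =>
    exists_phase_shiftVector b p.2 (Circle.norm_coe (Circle.exp p.1))
  set D : ℝ × ℝ → H →L[ℂ] H := fun p => shiftOp b (p.2 * (Circle.exp p.1 : ℂ)) with hD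
  -- The unknown phase `κ` makes the coordinates of `W` equal to the explicit, measurable
  -- `dispCoeff`. It has modulus 1 and disappears in `hWW`.
  set W : (ℝ × ℝ) × ℕ → H := fun z =>
    (√(l z.2 * z.1.2 / Real.pi) : ℂ) • κ z.1 • D z.1 (b z.2) with hW
  have hWV : ∀ u, V u =ᵐ[polarMeasure (argSet Set.univ)] fun z => ⟪W z, u⟫_ℂ := by
    refine isometry_ae_eq_inner b V W fun n => ?_
    filter_upwards [hV n] with z hz
    rw [hz, dispCoeff, ← inner_conj_symm]
    simp only [hW, hD, inner_smul_right, map_mul, shiftOp_apply, Complex.conj_ofReal]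
    rw [← map_mul (starRingEnd ℂ) (κ z.1), hκ]
    simp only [map_mul, Complex.conj_ofReal]
  have hWW : ∀ (p : ℝ × ℝ) (s : ℕ) (u v : H), 0 < p.2 → ⟪⟪W (p, s), u⟫_ℂ, ⟪W (p, s), v⟫_ℂ⟫_ℂ =
      (p.2 / Real.pi : ℂ) * ((l s : ℂ) * (⟪u, D p (b s)⟫_ℂ * ⟪D p (b s), v⟫_ℂ)) := by
    intro p s u v hp
    have h1 : ((√(l s * p.2 / Real.pi) : ℝ) : ℂ) * ((√(l s * p.2 / Real.pi) : ℝ) : ℂ) =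
        l s * p.2 / Real.pi := by
      rw [← Complex.ofReal_mul, Real.mul_self_sqrt
        (div_nonneg (mul_nonneg (hl s) hp.le) Real.pi_pos.le)]
      push_cast; rfl
    have h2 : κ p * conj (κ p) = 1 := by rw [Complex.mul_conj', hκ1]; norm_num
    rw [inner_eq_conj_mul, inner_conj_symm]
    simp only [hW, inner_smul_left, inner_smul_right, Complex.conj_ofReal]
    linear_combination (⟪u, D p (b s)⟫_ℂ * ⟪D p (b s), v⟫_ℂ * (κ p * conj (κ p))) * h1 +
      (l s * p.2 / Real.pi) * ⟪u, D p (b s)⟫_ℂ * ⟪D p (b s), v⟫_ℂ * h2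
  refine ⟨E, ?_, hasPhaseMatrix_iff.2 fun X hX m n => ?_⟩
  · intro X hX u v
    set Φ : (ℝ × ℝ) × ℕ → ℂ := fun z => ⟪⟪W z, u⟫_ℂ, ⟪W z, v⟫_ℂ⟫_ℂ with hΦ
    have hVΦ : (fun z => ⟪V u z, V v z⟫_ℂ) =ᵐ[polarMeasure (argSet X)] Φ := by
      rw [← hrestr X hX]
      filter_upwards [ae_restrict_of_ae (hWV u), ae_restrict_of_ae (hWV v)] with z h1 h2
      rw [h1, h2]
    have hΦi : Integrable Φ (polarMeasure (argSet X)) := by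
      refine Integrable.congr ?_ hVΦ
      rw [← hrestr X hX]
      exact (L2.integrable_inner (V u) (V v)).restrict
    have hEΦ : ⟪u, E.effect X v⟫_ℂ = ∫ z, Φ z ∂polarMeasure (argSet X) := by
      rw [hE X hX, hrestr X hX, integral_congr_ae hVΦ]
    set μ2 := (volume.restrict (argSet X)).prod (volume.restrict (Set.Ioi (0 : ℝ))) with hμ2
    have hpos : ∀ᵐ p ∂μ2, 0 < p.2 :=
      Measure.quasiMeasurePreserving_snd.ae (ae_restrict_mem measurableSet_Ioi)
    have hDexp : ∀ p : ℝ × ℝ, D p = shiftOp b (p.2 * Complex.exp (Complex.I * p.1)) := by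
      intro p
      change shiftOp b (p.2 * (Circle.exp p.1 : ℂ)) = _
      rw [Circle.coe_exp, mul_comm (p.1 : ℂ)]
    set Q : ℝ × ℝ → ℂ := fun p => (p.2 : ℂ) *
      ⟪u, (shiftOp b (p.2 * Complex.exp (Complex.I * p.1)) ∘L T ∘L
        (shiftOp b (p.2 * Complex.exp (Complex.I * p.1))).adjoint) v⟫_ℂ with hQ
    rw [polarMeasure] at hΦi hEΦ
    -- Integration over the counting variable resums the spectral expansion of `T`, conjugated by
    -- the displacement.
    have hinner : (fun p => ∫ s, Φ (p, s) ∂Measure.count) =ᵐ[μ2]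
        fun p => (Real.pi : ℂ)⁻¹ * Q p := by
      filter_upwards [hpos, hΦi.prod_right_ae] with p hp hpi
      refine (hasSum_integral_count hpi).unique ?_
      have h1 := (hasSum_inner_generated b hT (D p) u v).mul_left (p.2 / Real.pi : ℂ)
      rw [hDexp] at h1
      have e : (Real.pi : ℂ)⁻¹ * Q p = (p.2 / Real.pi : ℂ) *
          ⟪u, (shiftOp b (p.2 * Complex.exp (Complex.I * p.1)) ∘L T ∘L
            (shiftOp b (p.2 * Complex.exp (Complex.I * p.1))).adjoint) v⟫_ℂ := by
        simp only [hQ]; ring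
      rw [e]
      refine h1.congr_fun fun s => ?_
      rw [← hDexp]
      exact hWW p s u v hp
    have hpi : (Real.pi : ℂ) ≠ 0 := Complex.ofReal_ne_zero.2 Real.pi_ne_zero
    have hQi : Integrable Q μ2 := by
      have h1 := (hΦi.integral_prod_left.congr hinner).const_mul (Real.pi : ℂ)
      refine h1.congr (ae_of_all _ fun p => ?_)
      change (Real.pi : ℂ) * ((Real.pi : ℂ)⁻¹ * Q p) = Q p
      rw [mul_inv_cancel_left₀ hpi]
    constructor
    · rw [IntegrableOn, Measure.volume_eq_prod, ← Measure.prod_restrict]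
      exact hQi
    · rw [hEΦ, integral_prod _ hΦi, integral_congr_ae hinner, integral_const_mul,
        integral_prod _ hQi]
  · rw [hE X hX, hrestr X hX, ← hint X hX]
    refine integral_congr_ae ?_
    rw [← hrestr X hX]
    filter_upwards [ae_restrict_of_ae (hV m), ae_restrict_of_ae (hV n)] with z h1 h2
    rw [h1, h2]

/-- The weak formula determines all effects on measurable sets, so the matrix computed for the
constructed observable belongs to every observable generated by `T`. -/
theorem IsGeneratedBy.hasPhaseMatrix {b : HilbertBasis ℕ ℂ H} {T : H →L[ℂ] H} {l : ℕ → ℝ}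
    (hl : ∀ n, 0 ≤ l n) (hsum : HasSum l 1)
    (hT : ∀ v, HasSum (fun n => (l n : ℂ) • ⟪b n, v⟫_ℂ • b n) (T v)) {E : Observable Circle H}
    (hE : IsGeneratedBy b T E) : HasPhaseMatrix b E fun m n => (generatedMatrix l m n : ℂ) := by
  obtain ⟨E', h1, h2⟩ := exists_isGeneratedBy b hl hsum hT
  intro X hX m n
  rw [← h2 X hX m n, (hE X hX _ _).2, (h1 X hX _ _).2]

end

/-! ### Limits and identification of the generated phase matrices -/

/-- Each overlap tends to 1 and has modulus at most 1, so dominated convergence applies with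
dominating sequence `l`. -/
theorem tendsto_generatedMatrix {l : ℕ → ℝ} (hl : ∀ s, 0 ≤ l s) (hsum : HasSum l 1) :
    Tendsto (fun n => (generatedMatrix l (n + 1) n : ℂ)) atTop (𝓝 1) := by
  have h : Tendsto (fun n => generatedMatrix l (n + 1) n) atTop (𝓝 (∑' s, l s)) := by
    refine tendsto_tsum_of_dominated_convergence hsum.summable (fun s => ?_)
      (Eventually.of_forall fun n s => ?_)
    · simpa using (tendsto_gaussInt_radial_succ s).const_mul (l s)
    · rw [Real.norm_eq_abs, abs_mul, abs_of_nonneg (hl s)]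
      exact mul_le_of_le_one_right (hl s) (abs_gaussInt_radial_mul_le _ _ _ _)
  rw [hsum.tsum_eq] at h
  simpa [Function.comp_def] using (Complex.continuous_ofReal.tendsto 1).comp h

theorem generatedMatrix_zero_left (l : ℕ → ℝ) (k : ℕ) : generatedMatrix l 0 (2 * k + 2) =
    ∑ s ∈ Finset.range (k + 1), l s * gaussInt (radial 0 s * radial (2 * k + 2) s) :=
  tsum_eq_sum fun s hs => by
    rw [gaussInt_radial_zero_mul_eq_zero (by simpa using hs), mul_zero]

/-- The entries at `(0, 2k+2)` form a triangular system in the eigenvalues with nonzero diagonal,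
solved by strong induction. -/
theorem generatedMatrix_injective {l l' : ℕ → ℝ}
    (h : ∀ m n, generatedMatrix l m n = generatedMatrix l' m n) : l = l' := by
  funext k
  induction k using Nat.strong_induction_on with
  | _ k ih =>
    have hk := h 0 (2 * k + 2)
    rw [generatedMatrix_zero_left, generatedMatrix_zero_left, Finset.sum_range_succ,
      Finset.sum_range_succ, Finset.sum_congr rfl fun s hs => by
        rw [ih s (Finset.mem_range.1 hs)]] at hk
    exact mul_right_cancel₀ (gaussInt_radial_zero_mul_ne_zero k) (add_left_cancel hk)

theorem generatedMatrix_zero_two_lt_one {l : ℕ → ℝ} (hl : ∀ s, 0 ≤ l s) (hsum : HasSum l 1) :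
    generatedMatrix l 0 2 < 1 := by
  have h := generatedMatrix_zero_left l 0
  rw [Finset.sum_range_one, mul_zero, zero_add, gaussInt_radial_zero_two] at h
  have h0 : l 0 ≤ 1 := le_hasSum hsum 0 fun s _ => hl s
  rw [h]
  refine (mul_le_of_le_one_left (by positivity) h0).trans_lt (inv_lt_one_of_one_lt₀ ?_)
  exact Real.one_lt_sqrt_two

/-! ### Rotated phase observables -/

section

variable {H : Type*} [NormedAddCommGroup H] [InnerProductSpace ℂ H] [CompleteSpace H]

theorem isAffine_map {g : Circle → Circle} (hg : Measurable g) :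
    IsAffine fun p : ProbabilityMeasure Circle => p.map hg.aemeasurable := by
  intro s t _ p q r h
  simp only [ProbabilityMeasure.toMeasure_map, h]
  rw [Measure.map_add _ _ hg, Measure.map_smul, Measure.map_smul]

/-- The matrix relation says that `F(X) = E(t⁻¹X)`, so pushing forward along multiplication by `t`
turns the distributions of `E` into those of `F`. -/
theorem IsPostprocessing.of_rotation {b : HilbertBasis ℕ ℂ H} {E F : Observable Circle H}
    {c d : ℕ → ℕ → ℂ} (hE : HasPhaseMatrix b E c) (hF : HasPhaseMatrix b F d) (t : Circle)
    (h : ∀ m n, c m n = d m n * char ((m : ℤ) - n) t) : IsPostprocessing b F E := by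
  have hg : Measurable fun x : Circle => t * x := measurable_const_mul t
  refine ⟨fun p => p.map hg.aemeasurable, isAffine_map hg, ?_⟩
  funext ρ
  refine Subtype.ext ?_
  change outcomeMeasure F ρ = Measure.map (fun x => t * x) (outcomeMeasure E ρ)
  ext X hX
  rw [Measure.map_apply hg hX, outcomeMeasure, outcomeMeasure, Measure.ofMeasurable_apply _ hX,
    Measure.ofMeasurable_apply _ (hg hX)]
  have e : F.effect X = E.effect ((fun x => t * x) ⁻¹' X) := by
    refine operator_ext b fun m n => ?_
    have hi := setIntegral_char_image ((m : ℤ) - n) t (hg hX)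
    rw [Set.image_preimage_eq X (mul_left_surjective t)] at hi
    rw [hasPhaseMatrix_iff.1 hF X hX, hasPhaseMatrix_iff.1 hE _ (hg hX), h, hi, mul_assoc]
  rw [e]

theorem HasPhaseMatrix.isPostClean {b : HilbertBasis ℕ ℂ H} {E : Observable Circle H}
    {c : ℕ → ℕ → ℂ} (hE : HasPhaseMatrix b E c)
    (hc : Tendsto (fun n => c (n + 1) n) atTop (𝓝 1)) :
    IsPostClean b (phaseObservables b) E := by
  refine ⟨hE.isCovariant, fun F hF h => ⟨?_, h⟩⟩
  obtain ⟨d, hd⟩ := exists_hasPhaseMatrix hF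
  obtain ⟨t, ht⟩ := h.exists_rotation hE hd hc
  exact .of_rotation hE hd t ht

/-- The matrices differ by a rotation `t`. On the subdiagonal the quotient is `t` itself, and both
subdiagonals tend to 1, so `t = 1`. -/
theorem HasPhaseMatrix.eq_of_postEquiv {b : HilbertBasis ℕ ℂ H} {E F : Observable Circle H}
    {c d : ℕ → ℕ → ℂ} (hE : HasPhaseMatrix b E c) (hF : HasPhaseMatrix b F d)
    (hc : Tendsto (fun n => c (n + 1) n) atTop (𝓝 1))
    (hd : Tendsto (fun n => d (n + 1) n) atTop (𝓝 1)) (h : PostEquiv b E F) (m n : ℕ) :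
    c m n = d m n := by
  obtain ⟨t, ht⟩ := h.2.exists_rotation hE hF hc
  have h1 : (t : ℂ) = 1 := by
    refine tendsto_nhds_unique ?_ hc
    have h2 : (fun n => c (n + 1) n) = fun n => d (n + 1) n * (t : ℂ) := by
      funext n
      rw [ht, show ((n + 1 : ℕ) : ℤ) - n = (1 : ℕ) by push_cast; ring, char_natCast, pow_one]
    rw [h2]
    simpa using hd.mul_const (t : ℂ)
  have h2 : t = 1 := Subtype.ext h1
  rw [ht, h2, char_one_right, mul_one]

end

end PhaseObs

end

/-! ### Assembly of the proposition -/

theorem mainTheorem7 {H : Type*} [NormedAddCommGroup H] [InnerProductSpace ℂ H] [CompleteSpace H]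
    (b : HilbertBasis ℕ ℂ H) :
    -- the canonical and the state generated phase observables exist
    (∃ E ∈ PhaseObs.phaseObservables b, PhaseObs.IsCanonicalPhase b E) ∧
    (∀ T : H →L[ℂ] H, PhaseObs.IsDiagonalState b T →
      ∃ E ∈ PhaseObs.phaseObservables b, PhaseObs.IsGeneratedBy b T E) ∧
    -- they are postprocessing clean in the set of phase observables
    (∀ E : PhaseObs.Observable Circle H, PhaseObs.IsCanonicalPhase b E →
      PhaseObs.IsPostClean b (PhaseObs.phaseObservables b) E) ∧
    (∀ (T : H →L[ℂ] H) (E : PhaseObs.Observable Circle H), PhaseObs.IsDiagonalState b T →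
      PhaseObs.IsGeneratedBy b T E → PhaseObs.IsPostClean b (PhaseObs.phaseObservables b) E) ∧
    -- no two of them are postprocessing equivalent
    (∀ (T : H →L[ℂ] H) (Ecan E : PhaseObs.Observable Circle H), PhaseObs.IsDiagonalState b T →
      PhaseObs.IsCanonicalPhase b Ecan → PhaseObs.IsGeneratedBy b T E →
        ¬ PhaseObs.PostEquiv b Ecan E) ∧
    (∀ (T T' : H →L[ℂ] H) (E E' : PhaseObs.Observable Circle H), PhaseObs.IsDiagonalState b T →
      PhaseObs.IsDiagonalState b T' → T ≠ T' → PhaseObs.IsGeneratedBy b T E →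
        PhaseObs.IsGeneratedBy b T' E' → ¬ PhaseObs.PostEquiv b E E') := by
  have hcan : Filter.Tendsto (fun _ : ℕ => (1 : ℂ)) Filter.atTop (nhds 1) := tendsto_const_nhds
  refine ⟨?_, ?_, fun E hE => PhaseObs.HasPhaseMatrix.isPostClean hE hcan, ?_, ?_, ?_⟩
  · obtain ⟨E, hE⟩ := PhaseObs.exists_isCanonicalPhase b
    exact ⟨E, PhaseObs.HasPhaseMatrix.isCovariant hE, hE⟩
  · rintro T ⟨l, hl, hsum, hT⟩
    obtain ⟨E, hE, hc⟩ := PhaseObs.exists_isGeneratedBy b hl hsum hT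
    exact ⟨E, hc.isCovariant, hE⟩
  · rintro T E ⟨l, hl, hsum, hT⟩ hE
    exact (hE.hasPhaseMatrix hl hsum hT).isPostClean (PhaseObs.tendsto_generatedMatrix hl hsum)
  · rintro T Ecan E ⟨l, hl, hsum, hT⟩ hcanE hE h
    have h1 := PhaseObs.HasPhaseMatrix.eq_of_postEquiv hcanE (hE.hasPhaseMatrix hl hsum hT) hcan
      (PhaseObs.tendsto_generatedMatrix hl hsum) h 0 2
    -- Equivalence would make the entry at `(0, 2)` equal to 1.
    exact (PhaseObs.generatedMatrix_zero_two_lt_one hl hsum).ne (by exact_mod_cast h1.symm)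
  · rintro T T' E E' ⟨l, hl, hsum, hT⟩ ⟨l', hl', hsum', hT'⟩ hne hE hE' h
    have h1 := (hE.hasPhaseMatrix hl hsum hT).eq_of_postEquiv (hE'.hasPhaseMatrix hl' hsum' hT')
      (PhaseObs.tendsto_generatedMatrix hl hsum) (PhaseObs.tendsto_generatedMatrix hl' hsum') h
    obtain rfl : l = l' := PhaseObs.generatedMatrix_injective fun m n => by
      exact_mod_cast h1 m n
    exact hne (ContinuousLinearMap.ext fun v => (hT v).unique (hT' v))
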